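/- All multigraphs are finite, undirected and loopless. For a multigraph $G$ and vertices $x,z$, let $\deg(x)$ be the number of edges incident to $x$, let $\mu(x,z)$ be the number of edges between $x$ and $z$, let $\mu(x)=\max_z\mu(x,z)$, and write $[r]=\{1,\dots,r\}$. An edge-coloring $\phi\colon E(G)\to\mathbb N$ is proper if $\phi(e)\ne\phi(f)$ for all distinct edges $e,f$ with a common endpoint. Let $G$ be a multigraph with $n$ vertices and maximum degree $\Delta$. 1. There is a proper edge-coloring $\phi$ of $G$ such that every edge $e$, with endpoints $x,y$, satisfies $\phi(e)\in[\max\{\lfloor 3\deg(x)/2\rfloor,\lfloor 3\deg(y)/2\rfloor\}]$. 2. There is a proper edge-coloring $\phi$ of $G$ such that every edge $e$, with endpoints $x,y$, satisfies $\phi(e)\in[\max\{\deg(x)+\mu(x),\deg(y)+\mu(y)\}]$. 3. If $G$ is bipartite, there is a proper edge-coloring $\phi$ of $G$ such that every edge $e$, with endpoints $x,y$, satisfies $\phi(e)\in[\max\{\deg(x),\deg(y)\}]$. Moreover, for each of 1, 2 and 3 there is an algorithm (a single program for a unit-cost random access machine with addition, truncated subtraction and comparison of natural numbers) and constants $C,k\in\mathbb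 N$ such that, for every multigraph $G$ (every bipartite multigraph $G$ in the case of 3), given as its number of vertices and the list of the endpoints of its edges, the algorithm halts after at most $C(n+\Delta+1)^k$ steps and outputs a coloring as described. -/

import Mathlib

open scoped Graph

universe u v

namespace Graph

variable {α : Type u} {β : Type v}

/-- `deg(x)`: the number of edges incident to `x`. -/
noncomputable def degree (G : Graph α β) (x : α) : ℕ := (G.incidenceSet x).ncard

/-- `μ(x, y)`: the number of edges between `x` and `y`. -/
noncomputable def multiplicity (G : Graph α β) (x y : α) : ℕ := {e | G.IsLink e x y}.ncard

/-- `μ(x)`: the maximum of `μ(x, z)` over all vertices `z`. -/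
noncomputable def maxMultiplicityAt (G : Graph α β) (x : α) : ℕ :=
  sSup (G.multiplicity x '' V(G))

/-- `Δ(G)`: the maximum degree (`0` if there are no vertices). -/
noncomputable def maxDegree (G : Graph α β) : ℕ := sSup (G.degree '' V(G))

/-- `G` is bipartite: some set `A` contains exactly one end of every edge. -/
def IsBipartite (G : Graph α β) : Prop :=
  ∃ A : Set α, ∀ e x y, G.IsLink e x y → (x ∈ A ↔ y ∉ A)

/-- A proper edge-coloring: distinct edges with a common end have distinct colors.
Only the values of `φ` on the edge set of `G` matter. -/
def IsProperEdgeColoring (G : Graph α β) (φ : β → ℕ) : Prop :=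
  ∀ e f x, e ≠ f → G.Inc e x → G.Inc f x → φ e ≠ φ f

/-- An edge-list description of a finite multigraph: the `n` vertices are numbered by `Fin n`, the
`m` edges by `Fin m`, and the ends of the edge number `i` are the vertices number `fst i` and
`snd i`. Numberings and the order of the two ends of an edge are arbitrary. -/
structure EdgeList (G : Graph α β) where
  n : ℕ
  m : ℕ
  vertex : Fin n ≃ V(G)
  edge : Fin m ≃ E(G)
  fst : Fin m → Fin n
  snd : Fin m → Fin n
  isLink : ∀ i, G.IsLink (edge i) (vertex (fst i)) (vertex (snd i))

end Graph

/-! A random access machine in structured form, with unit cost. It has registers and arrays of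
unbounded length, all of whose cells hold natural numbers. The arithmetic is addition, truncated
subtraction and comparison; there is no multiplication, so that cells hold only numbers of
`O(t)` bits after `t` steps. -/
namespace RAM

/-- `reg x` is the content of register `x`; `arr a i` is the content of cell `i` of array `a`. -/
structure State where
  reg : ℕ → ℕ
  arr : ℕ → ℕ → ℕ

inductive Expr where
  | lit (k : ℕ)
  | reg (x : ℕ)
  | get (a : ℕ) (i : Expr)
  | add (e f : Expr)
  | sub (e f : Expr)
  | lt (e f : Expr)
  | eq (e f : Expr)

def Expr.eval (σ : State) : Expr → ℕ
  | lit k => k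
  | reg x => σ.reg x
  | get a i => σ.arr a (i.eval σ)
  | add e f => e.eval σ + f.eval σ
  | sub e f => e.eval σ - f.eval σ
  | lt e f => if e.eval σ < f.eval σ then 1 else 0
  | eq e f => if e.eval σ = f.eval σ then 1 else 0

/-- The number of elementary operations (constants, memory accesses, arithmetic operations and
comparisons) made in evaluating an expression. -/
def Expr.cost : Expr → ℕ
  | lit _ => 1
  | reg _ => 1
  | get _ i => i.cost + 1
  | add e f => e.cost + f.cost + 1
  | sub e f => e.cost + f.cost + 1
  | lt e f => e.cost + f.cost + 1
  | eq e f => e.cost + f.cost + 1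

/-- Programs: doing nothing, `reg x := e`, `arr a i := e`, sequential composition, conditionals,
and while loops. A test succeeds if its value is nonzero. -/
inductive Program where
  | skip
  | set (x : ℕ) (e : Expr)
  | put (a : ℕ) (i e : Expr)
  | seq (p q : Program)
  | cond (e : Expr) (p q : Program)
  | loop (e : Expr) (p : Program)

def State.setReg (σ : State) (x k : ℕ) : State :=
  { σ with reg := Function.update σ.reg x k }

def State.setArr (σ : State) (a i k : ℕ) : State :=
  { σ with arr := Function.update σ.arr a (Function.update (σ.arr a) i k) }

/-- `Run p σ t τ`: started in state `σ`, the program `p` halts in state `τ` after exactly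
`t` steps. -/
inductive Run : Program → State → ℕ → State → Prop where
  | skip (σ) : Run .skip σ 1 σ
  | set (σ x e) : Run (.set x e) σ (e.cost + 1) (σ.setReg x (e.eval σ))
  | put (σ a i e) : Run (.put a i e) σ (i.cost + e.cost + 1) (σ.setArr a (i.eval σ) (e.eval σ))
  | seq {p q σ τ ρ s t} : Run p σ s τ → Run q τ t ρ → Run (.seq p q) σ (s + t) ρ
  | cond_true {e p q σ τ t} : e.eval σ ≠ 0 → Run p σ t τ →
      Run (.cond e p q) σ (e.cost + 1 + t) τ
  | cond_false {e p q σ τ t} : e.eval σ = 0 → Run q σ t τ →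
      Run (.cond e p q) σ (e.cost + 1 + t) τ
  | loop_done {e p σ} : e.eval σ = 0 → Run (.loop e p) σ (e.cost + 1) σ
  | loop_step {e p σ τ ρ s t} : e.eval σ ≠ 0 → Run p σ s τ → Run (.loop e p) τ t ρ →
      Run (.loop e p) σ (e.cost + 1 + s + t) ρ

/-- The initial state on an edge list: `reg 0` holds the number of vertices, `reg 1` the number of
edges, `arr 0` and `arr 1` the numbers of the two ends of each edge; all else is `0`. -/
def State.init {α β : Type*} {G : Graph α β} (D : G.EdgeList) : State where
  reg x := if x = 0 then D.n else if x = 1 then D.m else 0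
  arr a i := if h : i < D.m then
      (if a = 0 then (D.fst ⟨i, h⟩ : ℕ) else if a = 1 then (D.snd ⟨i, h⟩ : ℕ) else 0)
    else 0

/-- On the edge list `D`, the program `p` halts after at most `T` steps, and then `arr 2` holds the
color `φ e` of each edge `e` (in the order of the list). -/
def Program.Outputs {α β : Type*} {G : Graph α β} (p : Program) (D : G.EdgeList) (T : ℕ)
    (φ : β → ℕ) : Prop :=
  ∃ t σ, Run p (State.init D) t σ ∧ t ≤ T ∧ ∀ i : Fin D.m, σ.arr 2 i = φ (D.edge i)

end RAM

/-!
Let `f x` be the number of colors promised at the vertex `x`, that is `⌊3 deg x / 2⌋`,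
`deg x + μ x` or `deg x`. Call the colors `1, …, f x` reserved at `x`; an edge may get any color
that is reserved at one of its ends. As `deg x ≤ f x`, a reserved color is missing at every end of
an uncolored edge. The coloring is built up from the empty one by augmentation along fans and
alternating walks, as in the classical proofs of the theorems of Kőnig, Vizing and Shannon, but
the reserved colors vary from vertex to vertex, and two things have to be added.

* *Walks may be abandoned.* Flipping the colors `a`, `b` along a path can put a color on an edge
  where it is not reserved at either end. Therefore the flip is done edge by edge: a color moves
  from an edge to an adjacent uncolored one (`EdgeData.kick`), so that the hole in the coloring travels
  along the path. If the color to be tried is not admissible for the edge with the hole, the walk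
  stops there, and the hole stays. What is gained then is a decrease of the number `F` of pairs of
  an edge and an end of it where the color of the edge is foreign, that is not reserved
  (`EdgeData.Walk.improved_of_illegal`): along the walk, `F` together with the foreignness of the
  two colors at the two ends of the hole never increases, and it starts with reserved colors.
  Filling the hole makes `F` grow by at most `1`. With `U` uncolored edges, `2 U + F` therefore
  decreases in both cases (`EdgeData.Improved`).
* *Fans have reserved colors at their outer ends.* In a fan at `x`, the color of the next edge is
  a reserved color that is missing at the outer end of the edge before. Moving the colors down the
  fan does not let `F` grow. A fan is extended until its last reserved missing color `b` is missing
  at `x` too, or is a color of the fan already. In the second case a walk in `b` and a color `a`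
  missing at `x` starts from the fan edge below that color; if it comes back to this edge, then `b`
  has become missing at `x`, and the rest of the fan can be used (`EdgeData.Returned.improved`).

For Vizing's bound, `deg y + μ y` reserved colors at `y` suffice to take different colors for
parallel edges of the fan (`EdgeData.Fan.exists_avail`). In the bipartite case the fan is a single
edge, and the walk cannot come back, by parity. For Shannon's bound the fan has at most two edges,
where counting needs that the center `x` has no larger degree than the outer ends
(`EdgeData.exists_common_avail`). If the second outer end has a smaller degree than `x`, then the
colors are just moved: the new uncolored edge has an end of smaller degree. Hence an uncolored edge
gets the weight `2 K` plus its smaller degree, where `K` exceeds all degrees, and the quantity that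
decreases in each round is `K F` plus the sum of these weights (`EdgeData.potential`). It is less
than `K ^ 3` at the start (`EdgeData.potential_zero_lt`), which bounds the number of rounds by a
polynomial.

The algorithm is written in a small language with bounded loops, sums and searches (`RAM.Cmd`,
`RAM.Term`) that is compiled to programs of the machine. The state in which a command halts is given
by a function (`RAM.Cmd.exec`), and its running time is bounded by a polynomial in the common bound
`B = n + 2 m + 2` of all its loops (`RAM.Cmd.polyBounded_time`). As `m ≤ n Δ`, this is polynomial in
`n` and `Δ`. The existence of the colorings follows from the correctness of the algorithms, as
every finite multigraph has an edge list.
-/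

/-! ### Total correctness of programs with a time bound -/

namespace RAM

/-- Started in `σ`, the program halts after at most `T` steps in a state satisfying `Q`. -/
def Halts (p : Program) (σ : State) (T : ℕ) (Q : State → Prop) : Prop :=
  ∃ t τ, Run p σ t τ ∧ t ≤ T ∧ Q τ

namespace Halts

variable {p q : Program} {σ : State} {S T : ℕ} {P Q : State → Prop}

theorem mono (h : Halts p σ S P) (hST : S ≤ T) (hPQ : ∀ τ, P τ → Q τ) : Halts p σ T Q := by
  obtain ⟨t, τ, hr, ht, hP⟩ := h
  exact ⟨t, τ, hr, ht.trans hST, hPQ τ hP⟩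

theorem skip (h : Q σ) : Halts .skip σ 1 Q := ⟨1, σ, .skip σ, le_rfl, h⟩

theorem set {x : ℕ} {e : Expr} (h : Q (σ.setReg x (e.eval σ))) :
    Halts (.set x e) σ (e.cost + 1) Q := ⟨_, _, .set σ x e, le_rfl, h⟩

theorem put {a : ℕ} {i e : Expr} (h : Q (σ.setArr a (i.eval σ) (e.eval σ))) :
    Halts (.put a i e) σ (i.cost + e.cost + 1) Q := ⟨_, _, .put σ a i e, le_rfl, h⟩

theorem seq (h : Halts p σ S fun τ => Halts q τ T Q) : Halts (.seq p q) σ (S + T) Q := by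
  obtain ⟨s, τ, hr, hs, t, ρ, hr', ht, hQ⟩ := h
  exact ⟨s + t, ρ, .seq hr hr', add_le_add hs ht, hQ⟩

theorem cond {e : Expr} (h₁ : e.eval σ ≠ 0 → Halts p σ S Q) (h₂ : e.eval σ = 0 → Halts q σ T Q) :
    Halts (.cond e p q) σ (e.cost + 1 + (S + T)) Q := by
  by_cases h : e.eval σ = 0
  · obtain ⟨t, τ, hr, ht, hQ⟩ := h₂ h
    exact ⟨_, τ, .cond_false h hr, by omega, hQ⟩
  · obtain ⟨t, τ, hr, ht, hQ⟩ := h₁ h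
    exact ⟨_, τ, .cond_true h hr, by omega, hQ⟩

/-- A loop that counts register `v` up to the content `N` of register `2`. -/
theorem count {v N : ℕ} {I : ℕ → State → Prop}
    (hN : ∀ i ≤ N, ∀ τ, I i τ → τ.reg v = i ∧ τ.reg 2 = N)
    (hI : ∀ i < N, ∀ τ, I i τ → Halts p τ T (I (i + 1))) (h : I 0 σ) :
    Halts (.loop (.lt (.reg v) (.reg 2)) p) σ (N * (T + 4) + 4) (I N) := by
  suffices H : ∀ k ≤ N, ∀ τ, I (N - k) τ →
      Halts (.loop (.lt (.reg v) (.reg 2)) p) τ (k * (T + 4) + 4) (I N) from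
    H N le_rfl σ (by simpa using h)
  intro k
  induction k with
  | zero =>
    intro _ τ hτ
    obtain ⟨h₁, h₂⟩ := hN _ (Nat.sub_le _ _) τ hτ
    exact ⟨_, τ, .loop_done (by simp [Expr.eval, h₁, h₂]), by simp [Expr.cost], by simpa using hτ⟩
  | succ k ih =>
    intro hk τ hτ
    obtain ⟨h₁, h₂⟩ := hN _ (Nat.sub_le _ _) τ hτ
    obtain ⟨s, ρ, hr, hs, hρ⟩ := hI _ (by omega) τ hτ
    obtain ⟨t, ρ', hr', ht, hρ'⟩ := ih (by omega) ρ (by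
      rwa [show N - k = N - (k + 1) + 1 by omega])
    refine ⟨_, ρ', .loop_step ?_ hr hr', ?_, hρ'⟩
    · simp only [Expr.eval, h₁, h₂]
      rw [if_pos (by omega)]
      exact one_ne_zero
    · simp only [Expr.cost]
      nlinarith

end Halts

@[simp] theorem State.setReg_reg (σ : State) (x k y : ℕ) :
    (σ.setReg x k).reg y = if y = x then k else σ.reg y := by
  simp [State.setReg, Function.update_apply]

@[simp] theorem State.setReg_arr (σ : State) (x k : ℕ) : (σ.setReg x k).arr = σ.arr := rfl

@[simp] theorem State.setArr_reg (σ : State) (a i k : ℕ) : (σ.setArr a i k).reg = σ.reg := rfl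

@[simp] theorem State.setArr_arr (σ : State) (a i k b : ℕ) :
    (σ.setArr a i k).arr b = if b = a then Function.update (σ.arr a) i k else σ.arr b := by
  by_cases h : b = a
  · subst h; simp [State.setArr]
  · simp [State.setArr, h]

/-! ### Terms with bounded sums and searches -/

/-- The binary operations of the machine. -/
inductive Op where
  | add | sub | lt | eq

def Op.eval : Op → ℕ → ℕ → ℕ
  | add, a, b => a + b
  | sub, a, b => a - b
  | lt, a, b => if a < b then 1 else 0
  | eq, a, b => if a = b then 1 else 0

/-- The machine expression for an operation. -/
def Op.toExpr : Op → Expr → Expr → Expr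
  | add => .add
  | sub => .sub
  | lt => .lt
  | eq => .eq

/-- The last `i < n` with `P i ≠ 0`, or `b` if there is none. -/
def lastIndex (P : ℕ → ℕ) (b : ℕ) : ℕ → ℕ
  | 0 => b
  | n + 1 => if P n = 0 then lastIndex P b n else n

/-- Expressions of a richer language: besides the operations of the machine there are
conditionals, sums `∑ i < B, t i` and searches for an `i < B` with `t i ≠ 0`, where the bound
variable `i` is a register and the bound `B` is always the content of register `2`. -/
inductive Term where
  | lit (k : ℕ)
  | reg (x : ℕ)
  | get (a : ℕ) (t : Term)
  | op (o : Op) (s t : Term)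
  | ite (c s t : Term)
  | sum (v : ℕ) (t : Term)
  | find (v : ℕ) (t : Term)

namespace Term

def eval : Term → State → ℕ
  | lit k, _ => k
  | reg x, σ => σ.reg x
  | get a t, σ => σ.arr a (t.eval σ)
  | op o s t, σ => o.eval (s.eval σ) (t.eval σ)
  | ite c s t, σ => if c.eval σ = 0 then t.eval σ else s.eval σ
  | sum v t, σ => ∑ i ∈ Finset.range (σ.reg 2), t.eval (σ.setReg v i)
  | find v t, σ => lastIndex (fun i => t.eval (σ.setReg v i)) (σ.reg 2) (σ.reg 2)

/-- The registers from `64` on are reserved for intermediate results, and the register `2` holds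
the bound of the loops. -/
def wf : Term → Bool
  | lit _ => true
  | reg x => x < 64
  | get _ t => t.wf
  | op _ s t => s.wf && t.wf
  | ite c s t => c.wf && s.wf && t.wf
  | sum v t => v < 64 && v != 2 && t.wf
  | find v t => v < 64 && v != 2 && t.wf

/-- A program that puts the value of the term into register `d` and changes no register below
`d`. -/
def compile : Term → ℕ → Program
  | lit k, d => .set d (.lit k)
  | reg x, d => .set d (.reg x)
  | get a t, d => .seq (t.compile d) (.set d (.get a (.reg d)))
  | op o s t, d =>
    .seq (s.compile d) (.seq (t.compile (d + 1)) (.set d (o.toExpr (.reg d) (.reg (d + 1)))))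
  | ite c s t, d => .seq (c.compile d) (.cond (.reg d) (s.compile d) (t.compile d))
  | sum v t, d =>
    .seq (.set d (.lit 0)) (.seq (.set (d + 1) (.reg v)) (.seq (.set v (.lit 0))
      (.seq (.loop (.lt (.reg v) (.reg 2)) (.seq (t.compile (d + 2))
        (.seq (.set d (.add (.reg d) (.reg (d + 2)))) (.set v (.add (.reg v) (.lit 1))))))
      (.set v (.reg (d + 1))))))
  | find v t, d =>
    .seq (.set d (.reg 2)) (.seq (.set (d + 1) (.reg v)) (.seq (.set v (.lit 0))
      (.seq (.loop (.lt (.reg v) (.reg 2)) (.seq (t.compile (d + 2))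
        (.seq (.cond (.reg (d + 2)) (.set d (.reg v)) .skip) (.set v (.add (.reg v) (.lit 1))))))
      (.set v (.reg (d + 1))))))

/-- A bound for the running time of `compile`, in terms of the content `N` of register `2`. -/
def time : Term → ℕ → ℕ
  | lit _, _ => 2
  | reg _, _ => 2
  | get _ t, N => t.time N + 3
  | op _ s t, N => s.time N + (t.time N + 4)
  | ite c s t, N => c.time N + (2 + (s.time N + t.time N))
  | sum _ t, N => 2 + (2 + (2 + (N * (t.time N + (4 + 4) + 4) + 4 + 2)))
  | find _ t, N => 2 + (2 + (2 + (N * (t.time N + (2 + (2 + 1) + 4) + 4) + 4 + 2)))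

theorem eval_congr {t : Term} (ht : t.wf) {σ τ : State} (hr : ∀ x < 64, σ.reg x = τ.reg x)
    (ha : σ.arr = τ.arr) : t.eval σ = t.eval τ := by
  induction t generalizing σ τ with
  | lit k => rfl
  | reg x => simp only [wf, decide_eq_true_eq] at ht; exact hr x ht
  | get a t ih => simp only [eval, ha, ih ht hr ha]
  | op o s t ihs iht =>
    simp only [wf, Bool.and_eq_true] at ht
    simp only [eval, ihs ht.1 hr ha, iht ht.2 hr ha]
  | ite c s t ihc ihs iht =>
    simp only [wf, Bool.and_eq_true] at ht
    simp only [eval, ihc ht.1.1 hr ha, ihs ht.1.2 hr ha, iht ht.2 hr ha]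
  | sum v t ih =>
    simp only [wf, Bool.and_eq_true] at ht
    have h : ∀ i, t.eval (σ.setReg v i) = t.eval (τ.setReg v i) := fun i =>
      ih ht.2 (fun x hx => by simp [hr x hx]) (by simpa using ha)
    simp only [eval, h, hr 2 (by norm_num)]
  | find v t ih =>
    simp only [wf, Bool.and_eq_true] at ht
    have h : ∀ i, t.eval (σ.setReg v i) = t.eval (τ.setReg v i) := fun i =>
      ih ht.2 (fun x hx => by simp [hr x hx]) (by simpa using ha)
    simp only [eval, h, hr 2 (by norm_num)]

theorem halts_compile {t : Term} (ht : t.wf) {d : ℕ} (hd : 64 ≤ d) (σ : State) :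
    Halts (t.compile d) σ (t.time (σ.reg 2)) fun τ =>
      τ.reg d = t.eval σ ∧ τ.arr = σ.arr ∧ ∀ x < d, τ.reg x = σ.reg x := by
  induction t generalizing d σ with
  | lit k => exact .set (by simpa [eval, Expr.eval] using fun x hx h => absurd h (by omega))
  | reg x => exact .set (by simpa [eval, Expr.eval] using fun x hx h => absurd h (by omega))
  | get a t ih =>
    refine .seq ((ih ht hd σ).mono le_rfl fun τ hτ => .set ?_)
    obtain ⟨h₁, h₂, h₃⟩ := hτ
    refine ⟨by simp [eval, Expr.eval, h₁, h₂], by simp [h₂], fun x hx => ?_⟩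
    simp [h₃ x hx, hx.ne]
  | op o s t ihs iht =>
    simp only [wf, Bool.and_eq_true] at ht
    refine .seq ((ihs ht.1 hd σ).mono le_rfl fun τ hτ => .seq ?_)
    obtain ⟨h₁, h₂, h₃⟩ := hτ
    have h2 : τ.reg 2 = σ.reg 2 := h₃ 2 (by omega)
    have ht' := iht ht.2 (d := d + 1) (by omega) τ
    have he : t.eval τ = t.eval σ := eval_congr ht.2 (fun x hx => h₃ x (by omega)) h₂
    refine ht'.mono (by rw [h2]) fun ρ hρ => ?_
    obtain ⟨h₄, h₅, h₆⟩ := hρ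
    have hc : (o.toExpr (.reg d) (.reg (d + 1))).cost + 1 = 4 := by
      cases o <;> simp [Op.toExpr, Expr.cost]
    rw [← hc]
    refine .set ⟨?_, by simp [h₅, h₂], fun x hx => ?_⟩
    · have := h₆ d (by omega)
      cases o <;> simp [eval, Op.toExpr, Expr.eval, Op.eval, h₄, this, h₁, he]
    · simp [hx.ne, h₆ x (by omega), h₃ x hx]
  | ite c s t ihc ihs iht =>
    simp only [wf, Bool.and_eq_true] at ht
    refine .seq ((ihc ht.1.1 hd σ).mono le_rfl fun τ hτ => ?_)
    obtain ⟨h₁, h₂, h₃⟩ := hτ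
    have h2 : τ.reg 2 = σ.reg 2 := h₃ 2 (by omega)
    refine .cond (fun h => ?_) (fun h => ?_)
    · have he : s.eval τ = s.eval σ := eval_congr ht.1.2 (fun x hx => h₃ x (by omega)) h₂
      refine (ihs ht.1.2 hd τ).mono (by rw [h2]) fun ρ hρ => ?_
      simp only [Expr.eval, h₁] at h
      refine ⟨by simp [eval, h, hρ.1, he], by simp [hρ.2.1, h₂], fun x hx => ?_⟩
      rw [hρ.2.2 x hx, h₃ x hx]
    · have he : t.eval τ = t.eval σ := eval_congr ht.2 (fun x hx => h₃ x (by omega)) h₂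
      refine (iht ht.2 hd τ).mono (by rw [h2]) fun ρ hρ => ?_
      simp only [Expr.eval, h₁] at h
      refine ⟨by simp [eval, h, hρ.1, he], by simp [hρ.2.1, h₂], fun x hx => ?_⟩
      rw [hρ.2.2 x hx, h₃ x hx]
  | sum v t ih =>
    simp only [wf, Bool.and_eq_true, decide_eq_true_eq, bne_iff_ne] at ht
    obtain ⟨⟨hv, hv2⟩, ht⟩ := ht
    refine .seq (.set (.seq (.set (.seq (.set (.seq ?_))))))
    refine (Halts.count (N := σ.reg 2) (T := t.time (σ.reg 2) + (4 + 4)) (I := fun i τ =>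
      τ.reg v = i ∧ τ.reg d = ∑ j ∈ Finset.range i, t.eval (σ.setReg v j) ∧
      τ.reg (d + 1) = σ.reg v ∧ τ.arr = σ.arr ∧ ∀ x < d, x ≠ v → τ.reg x = σ.reg x)
      ?_ ?_ ?_).mono le_rfl ?_
    · rintro i - τ ⟨h₁, -, -, -, h₅⟩
      exact ⟨h₁, h₅ 2 (by omega) (Ne.symm hv2)⟩
    · rintro i - τ ⟨h₁, h₂, h₃, h₄, h₅⟩
      have h2 := h₅ 2 (by omega) (Ne.symm hv2)
      refine .seq ((ih ht (d := d + 2) (by omega) τ).mono (by rw [h2]) fun ρ hρ => ?_)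
      obtain ⟨h₆, h₇, h₈⟩ := hρ
      have he : t.eval τ = t.eval (σ.setReg v i) := by
        refine eval_congr ht (fun x hx => ?_) h₄
        by_cases hxv : x = v
        · simp [hxv, h₁]
        · simp [hxv, h₅ x (by omega) hxv]
      refine .seq (.set (.set ?_))
      have hdv : d ≠ v := by omega
      have hdv' : d + 1 ≠ v := by omega
      refine ⟨?_, ?_, ?_, ?_, ?_⟩
      · simp [Expr.eval, hdv.symm, h₈ v (by omega), h₁]
      · simp [Expr.eval, hdv, h₈ d (by omega), h₂, h₆, he, Finset.sum_range_succ]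
      · simp [hdv', h₈ (d + 1) (by omega), h₃]
      · simp [h₇, h₄]
      · intro x hx hxv
        simp [hxv, hx.ne, h₈ x (by omega), h₅ x hx hxv]
    · have hdv : d ≠ v := by omega
      refine ⟨by simp [Expr.eval], by simp [hdv, Expr.eval], ?_, rfl, fun x hx hxv => ?_⟩
      · simp [Expr.eval, show d + 1 ≠ v by omega, hdv.symm]
      · simp [hxv, hx.ne, show x ≠ d + 1 by omega]
    · rintro τ ⟨h₁, h₂, h₃, h₄, h₅⟩
      refine .set ⟨?_, h₄, fun x hx => ?_⟩
      · simp [eval, show d ≠ v by omega, h₂]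
      · by_cases hxv : x = v
        · simp [hxv, Expr.eval, h₃]
        · simp [hxv, h₅ x hx hxv]
  | find v t ih =>
    simp only [wf, Bool.and_eq_true, decide_eq_true_eq, bne_iff_ne] at ht
    obtain ⟨⟨hv, hv2⟩, ht⟩ := ht
    refine .seq (.set (.seq (.set (.seq (.set (.seq ?_))))))
    refine (Halts.count (N := σ.reg 2) (T := t.time (σ.reg 2) + (2 + (2 + 1) + 4)) (I := fun i τ =>
      τ.reg v = i ∧ τ.reg d = lastIndex (fun j => t.eval (σ.setReg v j)) (σ.reg 2) i ∧
      τ.reg (d + 1) = σ.reg v ∧ τ.arr = σ.arr ∧ ∀ x < d, x ≠ v → τ.reg x = σ.reg x)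
      ?_ ?_ ?_).mono le_rfl ?_
    · rintro i - τ ⟨h₁, -, -, -, h₅⟩
      exact ⟨h₁, h₅ 2 (by omega) (Ne.symm hv2)⟩
    · rintro i - τ ⟨h₁, h₂, h₃, h₄, h₅⟩
      have h2 := h₅ 2 (by omega) (Ne.symm hv2)
      refine .seq ((ih ht (d := d + 2) (by omega) τ).mono (by rw [h2]) fun ρ hρ => ?_)
      obtain ⟨h₆, h₇, h₈⟩ := hρ
      have he : t.eval τ = t.eval (σ.setReg v i) := by
        refine eval_congr ht (fun x hx => ?_) h₄
        by_cases hxv : x = v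
        · simp [hxv, h₁]
        · simp [hxv, h₅ x (by omega) hxv]
      have hdv : d ≠ v := by omega
      have hdv' : d + 1 ≠ v := by omega
      refine .seq (.cond (fun h => .set (.set ?_)) (fun h => .skip (.set ?_)))
      all_goals
        simp only [Expr.eval, h₆, he] at h
        refine ⟨?_, ?_, ?_, ?_, ?_⟩
        · simp [Expr.eval, hdv.symm, h₈ v (by omega), h₁]
        · simp [Expr.eval, hdv, h₈ d (by omega), h₈ v (by omega), h₁, h₂, lastIndex, h]
        · simp [hdv', h₈ (d + 1) (by omega), h₃]
        · simp [h₇, h₄]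
        · intro x hx hxv
          simp [hxv, hx.ne, h₈ x (by omega), h₅ x hx hxv]
    · have hdv : d ≠ v := by omega
      refine ⟨by simp [Expr.eval], by simp [hdv, Expr.eval, lastIndex], ?_, rfl, fun x hx hxv => ?_⟩
      · simp [Expr.eval, show d + 1 ≠ v by omega, hdv.symm]
      · simp [hxv, hx.ne, show x ≠ d + 1 by omega]
    · rintro τ ⟨h₁, h₂, h₃, h₄, h₅⟩
      refine .set ⟨?_, h₄, fun x hx => ?_⟩
      · simp [eval, show d ≠ v by omega, h₂]
      · by_cases hxv : x = v
        · simp [hxv, Expr.eval, h₃]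
        · simp [hxv, h₅ x hx hxv]

end Term

/-! ### Commands with bounded loops -/

/-- Commands of the richer language. In `loop v p`, the register `v` runs through all numbers below
the content of register `2`. -/
inductive Cmd where
  | skip
  | set (x : ℕ) (t : Term)
  | put (a : ℕ) (i t : Term)
  | seq (p q : Cmd)
  | ite (c : Term) (p q : Cmd)
  | loop (v : ℕ) (p : Cmd)

namespace Cmd

/-- `p` started in `σ` and repeated for `v = 0, …, n - 1`. -/
def iter (p : State → State) (v : ℕ) (σ : State) : ℕ → State
  | 0 => σ
  | n + 1 => p ((iter p v σ n).setReg v n)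

/-- The state in which a command halts. -/
def exec : Cmd → State → State
  | skip, σ => σ
  | set x t, σ => σ.setReg x (t.eval σ)
  | put a i t, σ => σ.setArr a (i.eval σ) (t.eval σ)
  | seq p q, σ => q.exec (p.exec σ)
  | ite c p q, σ => if c.eval σ = 0 then q.exec σ else p.exec σ
  | .loop v p, σ => (iter p.exec v σ (σ.reg 2)).setReg v (σ.reg 2)

/-- `p.writes x`: the command may change register `x`. -/
def writes : Cmd → ℕ → Bool
  | skip, _ => false
  | set x _, y => x == y
  | put _ _ _, _ => false
  | seq p q, y => p.writes y || q.writes y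
  | ite _ p q, y => p.writes y || q.writes y
  | .loop v p, y => v == y || p.writes y

/-- `p.stores a`: the command may change array `a`. -/
def stores : Cmd → ℕ → Bool
  | skip, _ => false
  | set _ _, _ => false
  | put a _ _, b => a == b
  | seq p q, b => p.stores b || q.stores b
  | ite _ p q, b => p.stores b || q.stores b
  | .loop _ p, b => p.stores b

/-- No reserved register is used, the loop bound is not changed, and no loop changes its own
counter. -/
def wf : Cmd → Bool
  | skip => true
  | set x t => x < 64 && x != 2 && t.wf
  | put _ i t => i.wf && t.wf
  | seq p q => p.wf && q.wf
  | ite c p q => c.wf && p.wf && q.wf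
  | .loop v p => v < 64 && v != 2 && p.wf && !p.writes v

/-- A program with the same effect as the command on the arrays and on the registers below `64`.
The registers from `64` on are used for the values of terms. -/
def compile : Cmd → Program
  | skip => .skip
  | set x t => .seq (t.compile 64) (.set x (.reg 64))
  | put a i t => .seq (i.compile 64) (.seq (t.compile 65) (.put a (.reg 64) (.reg 65)))
  | seq p q => .seq p.compile q.compile
  | ite c p q => .seq (c.compile 64) (.cond (.reg 64) p.compile q.compile)
  | .loop v p => .seq (.set v (.lit 0))
      (.loop (.lt (.reg v) (.reg 2)) (.seq p.compile (.set v (.add (.reg v) (.lit 1)))))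

/-- A bound for the running time of `compile`, in terms of the content `N` of register `2`. -/
def time : Cmd → ℕ → ℕ
  | skip, _ => 1
  | set _ t, N => t.time N + 2
  | put _ i t, N => i.time N + (t.time N + 3)
  | seq p q, N => p.time N + q.time N
  | ite c p q, N => c.time N + (2 + (p.time N + q.time N))
  | .loop _ p, N => 2 + (N * (p.time N + 4 + 4) + 4)

theorem exec_reg {p : Cmd} {x : ℕ} (h : p.writes x = false) (σ : State) :
    (p.exec σ).reg x = σ.reg x := by
  induction p generalizing σ with
  | skip => rfl
  | set y t => simp only [writes, beq_eq_false_iff_ne] at h; simp [exec, h.symm]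
  | put a i t => simp [exec]
  | seq p q ihp ihq =>
    simp only [writes, Bool.or_eq_false_iff] at h
    simp [exec, ihp h.1, ihq h.2]
  | ite c p q ihp ihq =>
    simp only [writes, Bool.or_eq_false_iff] at h
    simp only [exec]
    split_ifs <;> simp [ihp h.1, ihq h.2]
  | loop v p ih =>
    simp only [writes, Bool.or_eq_false_iff, beq_eq_false_iff_ne] at h
    have : ∀ n, (iter p.exec v σ n).reg x = σ.reg x := fun n => by
      induction n with
      | zero => rfl
      | succ n ihn => simp [iter, ih h.2, h.1.symm, ihn]
    simp [exec, h.1.symm, this]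

theorem exec_arr {p : Cmd} {a : ℕ} (h : p.stores a = false) (σ : State) :
    (p.exec σ).arr a = σ.arr a := by
  induction p generalizing σ with
  | skip => rfl
  | set y t => simp [exec]
  | put b i t => simp only [stores, beq_eq_false_iff_ne] at h; simp [exec, h.symm]
  | seq p q ihp ihq =>
    simp only [stores, Bool.or_eq_false_iff] at h
    simp [exec, ihp h.1, ihq h.2]
  | ite c p q ihp ihq =>
    simp only [stores, Bool.or_eq_false_iff] at h
    simp only [exec]
    split_ifs <;> simp [ihp h.1, ihq h.2]
  | loop v p ih =>
    simp only [stores] at h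
    have : ∀ n, (iter p.exec v σ n).arr a = σ.arr a := fun n => by
      induction n with
      | zero => rfl
      | succ n ihn => simp [iter, ih h, ihn]
    simp [exec, this]

theorem writes_two {p : Cmd} (h : p.wf) : p.writes 2 = false := by
  induction p with
  | skip => rfl
  | set y t => simp [wf] at h; simp [writes, h]
  | put a i t => rfl
  | seq p q ihp ihq => simp [wf] at h; simp [writes, ihp h.1, ihq h.2]
  | ite c p q ihp ihq => simp [wf] at h; simp [writes, ihp h.1.2, ihq h.2]
  | loop v p ih => simp [wf] at h; simp [writes, ih h.1.2, h.1.1.2]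

theorem exec_iter {p : Cmd} (hp : p.writes 2 = false) {v : ℕ} (hv : v ≠ 2) (σ : State) (n : ℕ) :
    (iter p.exec v σ n).reg 2 = σ.reg 2 := by
  induction n with
  | zero => rfl
  | succ n ih => simp [iter, exec_reg hp, ih, hv.symm]

theorem halts_compile {p : Cmd} (hp : p.wf) {σ τ : State} (hr : ∀ x < 64, τ.reg x = σ.reg x)
    (ha : τ.arr = σ.arr) :
    Halts p.compile τ (p.time (σ.reg 2)) fun ρ =>
      ρ.arr = (p.exec σ).arr ∧ ∀ x < 64, ρ.reg x = (p.exec σ).reg x := by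
  induction p generalizing σ τ with
  | skip => exact .skip ⟨ha, hr⟩
  | set y t =>
    simp only [wf, Bool.and_eq_true, decide_eq_true_eq] at hp
    have he : t.eval τ = t.eval σ := Term.eval_congr hp.2 hr ha
    refine .seq ((Term.halts_compile hp.2 le_rfl τ).mono (by rw [hr 2 (by norm_num)]) ?_)
    rintro ρ ⟨h₁, h₂, h₃⟩
    refine .set ⟨by simp [exec, h₂, ha], fun x hx => ?_⟩
    simp [exec, Expr.eval, h₁, he, h₃ x hx, hr x hx]
  | put a i t =>
    simp only [wf, Bool.and_eq_true] at hp
    refine .seq ((Term.halts_compile hp.1 le_rfl τ).mono (by rw [hr 2 (by norm_num)]) ?_)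
    rintro ρ ⟨h₁, h₂, h₃⟩
    refine .seq ((Term.halts_compile hp.2 (d := 65) (by norm_num) ρ).mono
      (by rw [h₃ 2 (by norm_num), hr 2 (by norm_num)]) ?_)
    rintro ρ' ⟨h₄, h₅, h₆⟩
    have hi : i.eval τ = i.eval σ := Term.eval_congr hp.1 hr ha
    have ht : t.eval ρ = t.eval σ :=
      Term.eval_congr hp.2 (fun x hx => by rw [h₃ x hx, hr x hx]) (by rw [h₂, ha])
    refine .put ⟨?_, fun x hx => ?_⟩
    · simp [exec, State.setArr, Expr.eval, h₄, ht, h₆ 64, h₁, hi, h₅, h₂, ha]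
    · simp [exec, h₆ x (by omega), h₃ x hx, hr x hx]
  | seq p q ihp ihq =>
    simp only [wf, Bool.and_eq_true] at hp
    refine .seq ((ihp hp.1 hr ha).mono le_rfl fun ρ hρ => ?_)
    refine (ihq hp.2 hρ.2 hρ.1).mono (by rw [exec_reg (writes_two hp.1)]) fun _ h => h
  | ite c p q ihp ihq =>
    simp only [wf, Bool.and_eq_true] at hp
    have he : c.eval τ = c.eval σ := Term.eval_congr hp.1.1 hr ha
    refine .seq ((Term.halts_compile hp.1.1 le_rfl τ).mono (by rw [hr 2 (by norm_num)]) ?_)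
    rintro ρ ⟨h₁, h₂, h₃⟩
    have hr' : ∀ x < 64, ρ.reg x = σ.reg x := fun x hx => by rw [h₃ x hx, hr x hx]
    refine .cond (fun h => ?_) (fun h => ?_)
    · simp only [Expr.eval, h₁, he] at h
      simpa [exec, h] using ihp hp.1.2 hr' (by rw [h₂, ha])
    · simp only [Expr.eval, h₁, he] at h
      simpa [exec, h] using ihq hp.2 hr' (by rw [h₂, ha])
  | loop v p ih =>
    simp only [wf, Bool.and_eq_true, decide_eq_true_eq, bne_iff_ne, Bool.not_eq_true'] at hp
    obtain ⟨⟨⟨hv, hv2⟩, hp⟩, hpv⟩ := hp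
    refine .seq (.set ?_)
    refine (Halts.count (N := σ.reg 2) (T := p.time (σ.reg 2) + 4) (I := fun i ρ =>
      ρ.reg v = i ∧ ρ.arr = (iter p.exec v σ i).arr ∧
      ∀ x < 64, x ≠ v → ρ.reg x = (iter p.exec v σ i).reg x) ?_ ?_ ?_).mono le_rfl ?_
    · rintro i - ρ ⟨h₁, h₂, h₃⟩
      exact ⟨h₁, by rw [h₃ 2 (by norm_num) (Ne.symm hv2), exec_iter (writes_two hp) hv2]⟩
    · rintro i - ρ ⟨h₁, h₂, h₃⟩
      refine .seq ((ih hp (σ := (iter p.exec v σ i).setReg v i) (fun x hx => ?_) ?_).mono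
        ?_ fun ρ' hρ' => .set ?_)
      · by_cases hxv : x = v
        · simp [hxv, h₁]
        · simp [hxv, h₃ x hx hxv]
      · exact h₂
      · simp [Ne.symm hv2, exec_iter (writes_two hp) hv2]
      · refine ⟨?_, hρ'.1, fun x hx hxv => ?_⟩
        · simp [Expr.eval, hρ'.2 v hv, exec_reg hpv]
        · simp [hxv, hρ'.2 x hx, iter]
    · refine ⟨by simp [Expr.eval], ha, fun x hx hxv => by simp [hxv, hr x hx, iter]⟩
    · rintro ρ ⟨h₁, h₂, h₃⟩
      refine ⟨h₂, fun x hx => ?_⟩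
      by_cases hxv : x = v
      · simp [exec, hxv, h₁]
      · simp [exec, hxv, h₃ x hx hxv]

/-- An invariant of a bounded loop. -/
theorem exec_loop {v : ℕ} {p : Cmd} {σ : State} (I : ℕ → State → Prop) (h₀ : I 0 σ)
    (hI : ∀ i < σ.reg 2, ∀ τ, I i τ → I (i + 1) (p.exec (τ.setReg v i)))
    (hv : ∀ τ, I (σ.reg 2) τ → I (σ.reg 2) (τ.setReg v (σ.reg 2))) :
    I (σ.reg 2) ((Cmd.loop v p).exec σ) := by
  have : ∀ n ≤ σ.reg 2, I n (iter p.exec v σ n) := fun n => by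
    induction n with
    | zero => exact fun _ => h₀
    | succ n ih => exact fun hn => hI n hn _ (ih (by omega))
  exact hv _ (this _ le_rfl)

end Cmd

/-! ### Running times are polynomial -/

/-- `g` is bounded by a polynomial. -/
def PolyBounded (g : ℕ → ℕ) : Prop := ∃ C k, ∀ N, g N ≤ C * (N + 1) ^ k

namespace PolyBounded

variable {g h : ℕ → ℕ}

theorem const (c : ℕ) : PolyBounded fun _ => c := ⟨c, 0, by simp⟩

theorem add (hg : PolyBounded g) (hh : PolyBounded h) : PolyBounded fun N => g N + h N := by
  obtain ⟨C, k, hg⟩ := hg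
  obtain ⟨D, l, hh⟩ := hh
  refine ⟨C + D, k + l, fun N => ?_⟩
  have h₁ : (N + 1) ^ k ≤ (N + 1) ^ (k + l) := Nat.pow_le_pow_right (by omega) (by omega)
  have h₂ : (N + 1) ^ l ≤ (N + 1) ^ (k + l) := Nat.pow_le_pow_right (by omega) (by omega)
  calc g N + h N ≤ C * (N + 1) ^ k + D * (N + 1) ^ l := add_le_add (hg N) (hh N)
    _ ≤ C * (N + 1) ^ (k + l) + D * (N + 1) ^ (k + l) := by gcongr
    _ = _ := by ring

theorem self_mul (hg : PolyBounded g) : PolyBounded fun N => N * g N := by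
  obtain ⟨C, k, hg⟩ := hg
  refine ⟨C, k + 1, fun N => ?_⟩
  calc N * g N ≤ (N + 1) * (C * (N + 1) ^ k) := Nat.mul_le_mul (by omega) (hg N)
    _ = _ := by ring

end PolyBounded

open PolyBounded in
theorem Term.polyBounded_time (t : Term) : PolyBounded t.time := by
  induction t with
  | lit k => exact const 2
  | reg x => exact const 2
  | get a t ih => exact ih.add (const 3)
  | op o s t ihs iht => exact ihs.add (iht.add (const 4))
  | ite c s t ihc ihs iht => exact ihc.add ((const 2).add (ihs.add iht))
  | sum v t ih =>
    exact (const 2).add ((const 2).add ((const 2).add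
      (((((ih.add (const 8)).add (const 4)).self_mul).add (const 4)).add (const 2))))
  | find v t ih =>
    exact (const 2).add ((const 2).add ((const 2).add
      (((((ih.add (const 9)).add (const 4)).self_mul).add (const 4)).add (const 2))))

open PolyBounded in
theorem Cmd.polyBounded_time (p : Cmd) : PolyBounded p.time := by
  induction p with
  | skip => exact const 1
  | set x t => exact t.polyBounded_time.add (const 2)
  | put a i t => exact i.polyBounded_time.add (t.polyBounded_time.add (const 3))
  | seq p q ihp ihq => exact ihp.add ihq
  | ite c p q ihp ihq => exact c.polyBounded_time.add ((const 2).add (ihp.add ihq))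
  | loop v p ih =>
    exact (const 2).add (((((ih.add (const 4)).add (const 4)).self_mul).add (const 4)))

end RAM

/-! ### Partial colorings of an edge list -/

/-- A loopless multigraph on `ℕ` with the edges `0, …, m - 1`, where edge `i` has the ends `s i`
and `t i`, and with a number `f v` for every vertex `v`: the colors `1, …, f v` are reserved for
all edges at `v`, so that an edge may get any color that is reserved at one of its ends. -/
structure EdgeData where
  m : ℕ
  s : ℕ → ℕ
  t : ℕ → ℕ
  f : ℕ → ℕ
  loopless : ∀ i < m, s i ≠ t i

namespace EdgeData

variable (H : EdgeData) {col col₀ : ℕ → ℕ}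

/-- The edge `i` has the end `v`. -/
def Inc (i v : ℕ) : Prop := i < H.m ∧ (H.s i = v ∨ H.t i = v)

/-- The edge `i` has the ends `p` and `q`. -/
def Link (i p q : ℕ) : Prop := i < H.m ∧ (H.s i = p ∧ H.t i = q ∨ H.s i = q ∧ H.t i = p)

/-- The end of the edge `i` other than `p`. -/
def other (i p : ℕ) : ℕ := H.s i + H.t i - p

/-- The color `c` is missing at `v`. -/
def Miss (col : ℕ → ℕ) (v c : ℕ) : Prop := ∀ i, H.Inc i v → col i ≠ c

/-- `col` is a proper partial coloring in which all colors are admissible. The color `0` stands for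
uncolored edges. -/
structure Valid (col : ℕ → ℕ) : Prop where
  proper : ∀ v i j, H.Inc i v → H.Inc j v → col i = col j → col i ≠ 0 → i = j
  legal : ∀ i p q, H.Link i p q → col i ≤ H.f p ∨ col i ≤ H.f q

/-- `1` if the color `c` is not reserved at `v`, and `0` otherwise. -/
def foreign (c v : ℕ) : ℕ := if H.f v < c then 1 else 0

/-- The number of pairs of an edge and one of its ends where the color of the edge is not
reserved. -/
def foreignCount (col : ℕ → ℕ) : ℕ :=
  ∑ i ∈ Finset.range H.m, (H.foreign (col i) (H.s i) + H.foreign (col i) (H.t i))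

/-- The total weight of the uncolored edges. -/
def uncolored (w col : ℕ → ℕ) : ℕ := ∑ i ∈ Finset.range H.m, if col i = 0 then w i else 0

/-- `A` contains exactly one end of every edge. -/
def Bip (A : Set ℕ) : Prop := ∀ i < H.m, H.s i ∈ A ↔ H.t i ∉ A

variable {H}

theorem Link.symm {i p q : ℕ} (h : H.Link i p q) : H.Link i q p := ⟨h.1, h.2.symm⟩

theorem Link.ne {i p q : ℕ} (h : H.Link i p q) : p ≠ q := by
  have := H.loopless i h.1
  rcases h.2 with ⟨rfl, rfl⟩ | ⟨rfl, rfl⟩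
  exacts [this, this.symm]

theorem Link.left {i p q : ℕ} (h : H.Link i p q) : H.Inc i p :=
  ⟨h.1, h.2.imp (·.1) (·.2)⟩

theorem Link.right {i p q : ℕ} (h : H.Link i p q) : H.Inc i q := h.symm.left

theorem Link.inc_iff {i p q v : ℕ} (h : H.Link i p q) : H.Inc i v ↔ v = p ∨ v = q := by
  obtain ⟨hi, h⟩ := h
  simp only [Inc, hi, true_and]
  rcases h with ⟨rfl, rfl⟩ | ⟨rfl, rfl⟩
  · simp [eq_comm]
  · simp [eq_comm, or_comm]

theorem Inc.link {i v : ℕ} (h : H.Inc i v) : H.Link i v (H.other i v) := by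
  obtain ⟨hi, rfl | rfl⟩ := h <;> simp [Link, other, hi]

theorem Link.other_eq {i p q : ℕ} (h : H.Link i p q) : H.other i p = q := by
  rcases h.2 with ⟨rfl, rfl⟩ | ⟨rfl, rfl⟩ <;> simp [other]

theorem Link.eq_right {i p q r : ℕ} (h : H.Link i p q) (h' : H.Link i p r) : q = r :=
  h.other_eq.symm.trans h'.other_eq

theorem Link.bip {i p q : ℕ} (h : H.Link i p q) {A : Set ℕ} (hA : H.Bip A) : p ∈ A ↔ q ∉ A := by
  have := hA i h.1
  rcases h.2 with ⟨rfl, rfl⟩ | ⟨rfl, rfl⟩ <;> tauto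

@[simp] theorem foreign_zero (v : ℕ) : H.foreign 0 v = 0 := by simp [foreign]

theorem foreign_le_one (c v : ℕ) : H.foreign c v ≤ 1 := by unfold foreign; split_ifs <;> simp

theorem foreign_of_le {c v : ℕ} (h : c ≤ H.f v) : H.foreign c v = 0 := by simp [foreign, h]

theorem foreign_of_lt {c v : ℕ} (h : H.f v < c) : H.foreign c v = 1 := by simp [foreign, h]

theorem sum_range_update {m e : ℕ} (he : e < m) (g : ℕ → ℕ → ℕ) (col : ℕ → ℕ) (c : ℕ) :
    ∑ i ∈ Finset.range m, g i (Function.update col e c i) + g e (col e)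
      = ∑ i ∈ Finset.range m, g i (col i) + g e c := by
  have h := Finset.mem_range.2 he
  rw [← Finset.sum_erase_add _ (fun i => g i (Function.update col e c i)) h,
    ← Finset.sum_erase_add _ (fun i => g i (col i)) h]
  have : ∑ i ∈ (Finset.range m).erase e, g i (Function.update col e c i)
      = ∑ i ∈ (Finset.range m).erase e, g i (col i) :=
    Finset.sum_congr rfl fun i hi => by rw [Function.update_of_ne (Finset.ne_of_mem_erase hi)]
  simp only [this, Function.update_self]
  omega

theorem foreignCount_update {e p q : ℕ} (h : H.Link e p q) (col : ℕ → ℕ) (c : ℕ) :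
    H.foreignCount (Function.update col e c) + (H.foreign (col e) p + H.foreign (col e) q)
      = H.foreignCount col + (H.foreign c p + H.foreign c q) := by
  have := sum_range_update h.1 (fun i c => H.foreign c (H.s i) + H.foreign c (H.t i)) col c
  unfold foreignCount
  rcases h.2 with ⟨rfl, rfl⟩ | ⟨rfl, rfl⟩ <;> omega

theorem uncolored_update {e : ℕ} (h : e < H.m) (w col : ℕ → ℕ) (c : ℕ) :
    H.uncolored w (Function.update col e c) + (if col e = 0 then w e else 0)
      = H.uncolored w col + (if c = 0 then w e else 0) :=
  sum_range_update h (fun i c => if c = 0 then w i else 0) col c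

/-- Giving the uncolored edge `e` the color `c`, which is missing at both ends. -/
theorem Valid.finish (hv : H.Valid col) {e p q c : ℕ} (hl : H.Link e p q)
    (hp : H.Miss col p c) (hq : H.Miss col q c) (hc : c ≤ H.f p ∨ c ≤ H.f q) :
    H.Valid (Function.update col e c) where
  proper v i j hi hj hij h0 := by
    by_contra hne
    wlog hie : i = e generalizing i j
    · by_cases hje : j = e
      · exact this j i hj hi hij.symm (hij ▸ h0) (Ne.symm hne) hje
      · rw [Function.update_of_ne hie] at hij h0
        rw [Function.update_of_ne hje] at hij
        exact hne (hv.proper v i j hi hj hij h0)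
    subst hie
    rw [Function.update_self, Function.update_of_ne (Ne.symm hne)] at hij
    rcases hl.inc_iff.1 hi with rfl | rfl
    · exact hp j hj hij.symm
    · exact hq j hj hij.symm
  legal i p' q' h := by
    by_cases hie : i = e
    · subst hie
      rw [Function.update_self]
      rcases h.2 with ⟨rfl, rfl⟩ | ⟨rfl, rfl⟩ <;> rcases hl.2 with ⟨rfl, rfl⟩ | ⟨rfl, rfl⟩ <;> tauto
    · rw [Function.update_of_ne hie]; exact hv.legal i p' q' h

theorem Valid.uncolor (hv : H.Valid col) (e : ℕ) : H.Valid (Function.update col e 0) where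
  proper v i j hi hj hij h0 := by
    have hie : i ≠ e := by rintro rfl; simp at h0
    have hje : j ≠ e := by rintro rfl; simp [hij] at h0
    rw [Function.update_of_ne hie] at hij h0
    rw [Function.update_of_ne hje] at hij
    exact hv.proper v i j hi hj hij h0
  legal i p q h := by
    by_cases hie : i = e
    · subst hie; simp
    · rw [Function.update_of_ne hie]; exact hv.legal i p q h

/-- The color `c` moves from the edge `g` to the uncolored edge `e`. -/
def kick (col : ℕ → ℕ) (e g c : ℕ) : ℕ → ℕ := Function.update (Function.update col e c) g 0

theorem kick_of_ne {e g c i : ℕ} (h₁ : i ≠ e) (h₂ : i ≠ g) : kick col e g c i = col i := by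
  simp [kick, h₁, h₂]

theorem kick_self {e g c : ℕ} (h : e ≠ g) : kick col e g c e = c := by simp [kick, h]

@[simp] theorem kick_right {e g c : ℕ} : kick col e g c g = 0 := by simp [kick]

/-- A color other than `c` that is missing at `v` stays missing. -/
theorem Miss.kick {v k e g c : ℕ} (h : H.Miss col v k) (hk : k ≠ 0) (he : H.Inc e v → c ≠ k) :
    H.Miss (kick col e g c) v k := by
  intro i hi
  by_cases hg : i = g
  · subst hg; simpa using hk.symm
  by_cases hie : i = e
  · subst hie; rw [kick_self hg]; exact he hi
  · rw [kick_of_ne hie hg]; exact h i hi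

section Kick

variable {e g p q r c : ℕ}

/-- The color `c`, missing at `p`, moves to the uncolored edge `e = pq` from the adjacent edge
`g = qr`. -/
structure Kickable (H : EdgeData) (col : ℕ → ℕ) (e g p q r c : ℕ) : Prop where
  valid : H.Valid col
  link : H.Link e p q
  link' : H.Link g q r
  col_e : col e = 0
  col_g : col g = c
  pos : c ≠ 0
  miss : H.Miss col p c
  legal : c ≤ H.f p ∨ c ≤ H.f q

namespace Kickable

variable (h : Kickable H col e g p q r c)
include h

theorem ne : e ≠ g := by
  rintro rfl; exact h.pos (h.col_g.symm.trans h.col_e)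

theorem ne_right : r ≠ p := by
  rintro rfl; exact h.miss g h.link'.right h.col_g

theorem kick_eq : kick col e g c = Function.update (Function.update col g 0) e c := by
  rw [kick, Function.update_comm h.ne]

theorem valid_kick : H.Valid (kick col e g c) := by
  rw [h.kick_eq]
  refine (h.valid.uncolor g).finish h.link (fun i hi => ?_) (fun i hi => ?_) h.legal
  · by_cases hg : i = g
    · subst hg; simpa using h.pos.symm
    · rw [Function.update_of_ne hg]; exact h.miss i hi
  · by_cases hg : i = g
    · subst hg; simpa using h.pos.symm
    · rw [Function.update_of_ne hg]
      intro hc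
      exact hg (h.valid.proper q i g hi h.link'.left (hc.trans h.col_g.symm) (hc ▸ h.pos))

theorem miss_right : H.Miss (kick col e g c) r c := by
  intro i hi
  by_cases hg : i = g
  · subst hg; simpa using h.pos.symm
  by_cases hie : i = e
  · subst hie
    rcases h.link.inc_iff.1 hi with hr | hr
    · exact absurd hr h.ne_right
    · exact absurd hr h.link'.ne.symm
  · rw [kick_of_ne hie hg]
    intro hc
    exact hg (h.valid.proper r i g hi h.link'.right (hc.trans h.col_g.symm) (hc ▸ h.pos))

theorem foreignCount_kick :
    H.foreignCount (kick col e g c) + H.foreign c r = H.foreignCount col + H.foreign c p := by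
  have h₁ := foreignCount_update h.link col c
  have h₂ := foreignCount_update h.link' (Function.update col e c) 0
  rw [Function.update_of_ne h.ne.symm, h.col_g] at h₂
  simp only [h.col_e, foreign_zero] at h₁ h₂
  unfold kick
  omega

theorem uncolored_kick (w : ℕ → ℕ) :
    H.uncolored w (kick col e g c) + w e = H.uncolored w col + w g := by
  have h₁ := uncolored_update h.link.1 w col c
  have h₂ := uncolored_update h.link'.1 w (Function.update col e c) 0
  rw [Function.update_of_ne h.ne.symm, h.col_g] at h₂
  simp only [h.col_e, h.pos, if_true, if_false] at h₁ h₂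
  unfold kick
  omega

end Kickable

end Kick

/-! ### Alternating walks -/

/-- The state of an alternating walk in the colors `a` and `b` which started with the coloring
`col₀` at the uncolored edge `e₀ = xy`, where `a` is missing at `x` and `b` is missing at `y`.
Now the edge `e = pq` is uncolored, the color `c` is to be tried on it, and `d` is the other one of
the two colors. `S` is the set of the edges that were uncolored at some time. -/
structure Walk (H : EdgeData) (w : ℕ → ℕ) (col₀ : ℕ → ℕ) (e₀ x y a b : ℕ) (S : Finset ℕ)
    (col : ℕ → ℕ) (e p q c d : ℕ) : Prop where
  valid : H.Valid col
  link : H.Link e p q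
  link₀ : H.Link e₀ x y
  col_e : col e = 0
  a_pos : a ≠ 0
  b_pos : b ≠ 0
  miss_p : H.Miss col p c
  miss_q : H.Miss col q d
  foreign_le : H.foreignCount col + H.foreign c p + H.foreign d q ≤ H.foreignCount col₀
  uncolored_eq : H.uncolored w col + w e₀ = H.uncolored w col₀ + w e
  colors : c = a ∧ d = b ∨ c = b ∧ d = a
  /-- Edges of other colors keep their color. -/
  col_of_ne : ∀ i ≠ e₀, col₀ i ≠ a → col₀ i ≠ b → col i = col₀ i
  col_of_eq : ∀ i ≠ e, col₀ i = a ∨ col₀ i = b → col i = a ∨ col i = b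
  col₀_e : e ≠ e₀ → col₀ e = a ∨ col₀ e = b
  /-- Vertices that miss `b` are not passed through. -/
  miss_b : ∀ v ≠ x, v ≠ y → H.Miss col₀ v b → H.Miss col v b ∧ v ≠ p ∧ (v = q → c = b)
  parity : ∀ A, H.Bip A → ((p ∈ A ↔ x ∈ A) ∧ c = a ∧ d = b) ∨ ((q ∈ A ↔ x ∈ A) ∧ c = b ∧ d = a)
  start : e = e₀ → c = a ∧ p = x ∧ q = y
  col_start : e ≠ e₀ → col e₀ = a ∧ a ≠ b ∧ (q = x → c = a)
  subset : S ⊆ Finset.range H.m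
  mem_start : e₀ ∈ S
  mem : e ∈ S
  /-- The walk is at a new vertex, unless it is back at `x`. -/
  fresh : q ≠ x → ∀ i ∈ S, H.Inc i q → i = e
  /-- No edge of color `a` or `b` outside `S` is at a vertex that the walk has passed through. -/
  passed : ∀ v ≠ x, v ≠ q → (∃ i ∈ S, H.Inc i v) → ∀ i ∉ S, H.Inc i v → col i ≠ a ∧ col i ≠ b

/-- The walk is back at its first edge, after flipping the colors of a path from `y` to `x`. -/
structure Returned (H : EdgeData) (w : ℕ → ℕ) (col₀ : ℕ → ℕ) (e₀ x y a b : ℕ)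
    (col : ℕ → ℕ) : Prop where
  valid : H.Valid col
  col_e : col e₀ = 0
  miss_x : H.Miss col x b
  miss_y : H.Miss col y a
  ne : a ≠ b
  foreign_le : H.foreignCount col + H.foreign b x + H.foreign a y ≤ H.foreignCount col₀
  uncolored_eq : H.uncolored w col = H.uncolored w col₀
  col_of_ne : ∀ i ≠ e₀, col₀ i ≠ a → col₀ i ≠ b → col i = col₀ i
  col_of_eq : ∀ i ≠ e₀, col₀ i = a ∨ col₀ i = b → col i = a ∨ col i = b
  miss_b : ∀ v ≠ x, v ≠ y → H.Miss col₀ v b → H.Miss col v b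
  not_bip : ∀ A, ¬ H.Bip A

/-- A coloring from which the next round can start, with a smaller potential: either one more edge
is colored, and at most one more foreign pair has been created, or there are fewer foreign pairs
(and another edge is uncolored). -/
def Improved (H : EdgeData) (w col₀ : ℕ → ℕ) (e₀ : ℕ) (col : ℕ → ℕ) : Prop :=
  H.Valid col ∧
    (H.uncolored w col + w e₀ = H.uncolored w col₀ ∧ H.foreignCount col ≤ H.foreignCount col₀ + 1 ∨
    ∃ e < H.m, H.uncolored w col + w e₀ = H.uncolored w col₀ + w e ∧
      H.foreignCount col < H.foreignCount col₀)

section Walk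

variable {w : ℕ → ℕ} {e₀ x y a b : ℕ} {S : Finset ℕ} {e p q c d : ℕ}

theorem Walk.init (hv : H.Valid col) (hl : H.Link e₀ x y) (h0 : col e₀ = 0) (ha : a ≠ 0)
    (hb : b ≠ 0) (hax : H.Miss col x a) (hby : H.Miss col y b) (hfa : a ≤ H.f x)
    (hfb : b ≤ H.f y) : H.Walk w col e₀ x y a b {e₀} col e₀ x y a b where
  valid := hv
  link := hl
  link₀ := hl
  col_e := h0
  a_pos := ha
  b_pos := hb
  miss_p := hax
  miss_q := hby
  foreign_le := by simp [foreign_of_le hfa, foreign_of_le hfb]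
  uncolored_eq := rfl
  colors := .inl ⟨rfl, rfl⟩
  col_of_ne _ _ _ _ := rfl
  col_of_eq _ _ h := h
  col₀_e h := absurd rfl h
  miss_b v hx hy h := ⟨h, hx, fun h => absurd h hy⟩
  parity A _ := .inl ⟨Iff.rfl, rfl, rfl⟩
  start _ := ⟨rfl, rfl, rfl⟩
  col_start h := absurd rfl h
  subset := by simpa using hl.1
  mem_start := by simp
  mem := by simp
  fresh _ i hi _ := by simpa using hi
  passed v hx hy h := by
    obtain ⟨i, hi, hiv⟩ := h
    rw [Finset.mem_singleton.1 hi, hl.inc_iff] at hiv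
    tauto

theorem Walk.c_pos (h : H.Walk w col₀ e₀ x y a b S col e p q c d) : c ≠ 0 := by
  rcases h.colors with ⟨rfl, -⟩ | ⟨rfl, -⟩
  exacts [h.a_pos, h.b_pos]

/-- The color to be tried is not admissible: then the walk is abandoned, and the last edge that was
recolored has lost a foreign color. -/
theorem Walk.improved_of_illegal (h : H.Walk w col₀ e₀ x y a b S col e p q c d)
    (hp : H.f p < c) : H.Improved w col₀ e₀ col := by
  refine ⟨h.valid, .inr ⟨e, h.link.1, h.uncolored_eq, ?_⟩⟩
  have := h.foreign_le
  rw [foreign_of_lt hp] at this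
  omega

/-- The color to be tried is free at both ends. -/
theorem Walk.improved_of_miss (h : H.Walk w col₀ e₀ x y a b S col e p q c d)
    (hc : c ≤ H.f p ∨ c ≤ H.f q) (hq : H.Miss col q c) :
    H.Improved w col₀ e₀ (Function.update col e c) := by
  refine ⟨h.valid.finish h.link h.miss_p hq hc, .inl ?_⟩
  have h₁ := foreignCount_update h.link col c
  have h₂ := uncolored_update h.link.1 w col c
  have h₃ := h.uncolored_eq
  have h₄ := h.foreign_le
  have h₅ := H.foreign_le_one c q
  simp only [h.col_e, h.c_pos, foreign_zero, if_true, if_false] at h₁ h₂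
  omega

theorem Walk.kickable (h : H.Walk w col₀ e₀ x y a b S col e p q c d)
    (hc : c ≤ H.f p ∨ c ≤ H.f q) {g : ℕ} (hg : H.Inc g q) (hgc : col g = c) :
    H.Kickable col e g p q (H.other g q) c :=
  ⟨h.valid, h.link, hg.link, h.col_e, hgc, h.c_pos, h.miss_p, hc⟩

theorem Walk.c_ne_d (h : H.Walk w col₀ e₀ x y a b S col e p q c d) {g : ℕ} (hg : H.Inc g q)
    (hgc : col g = c) : c ≠ d := by
  rintro rfl; exact h.miss_q g hg hgc

theorem Walk.a_ne_b (h : H.Walk w col₀ e₀ x y a b S col e p q c d) {g : ℕ} (hg : H.Inc g q)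
    (hgc : col g = c) : a ≠ b := by
  have := h.c_ne_d hg hgc
  rcases h.colors with ⟨rfl, rfl⟩ | ⟨rfl, rfl⟩
  exacts [this, this.symm]

/-- The walk returns to its first edge: this happens only at `x`. -/
theorem Walk.returned (h : H.Walk w col₀ e₀ x y a b S col e p q c d)
    (hc : c ≤ H.f p ∨ c ≤ H.f q) (hg : H.Inc e₀ q) (hgc : col e₀ = c) :
    H.Returned w col₀ e₀ x y a b (kick col e e₀ c) ∧ q = x := by
  have hk := h.kickable hc hg hgc
  have hcol := h.col_start hk.ne
  have hqx : q = x := by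
    by_contra hqx
    exact hk.ne (h.fresh hqx e₀ h.mem_start hg).symm
  refine ⟨?_, hqx⟩
  subst hqx
  have hca : c = a := hcol.2.2 rfl
  have hdb : d = b := by
    rcases h.colors with ⟨-, h⟩ | ⟨h, -⟩
    · exact h
    · exact absurd (hca.symm.trans h) hcol.2.1
  subst hca hdb
  have hr : H.other e₀ q = y := h.link₀.other_eq
  rw [hr] at hk
  have hF := hk.foreignCount_kick
  refine ⟨hk.valid_kick, kick_right, h.miss_q.kick h.b_pos fun _ => hcol.2.1,
    hk.miss_right, hcol.2.1, ?_, ?_, fun i hi h₁ h₂ => ?_, fun i hi h₁ => ?_,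
    fun v hx hy hv => ?_, fun A hA => ?_⟩
  · have := h.foreign_le; omega
  · have := hk.uncolored_kick w; have := h.uncolored_eq; omega
  · have hie : i ≠ e := by
      rintro rfl
      have := h.col₀_e hi
      tauto
    rw [kick_of_ne hie hi, h.col_of_ne i hi h₁ h₂]
  · by_cases hie : i = e
    · subst hie; rw [kick_self hi]; exact .inl rfl
    · rw [kick_of_ne hie hi]; exact h.col_of_eq i hie h₁
  · exact (h.miss_b v hx hy hv).1.kick h.b_pos fun _ => hcol.2.1
  · have h₁ := h.parity A hA
    have h₂ := h.link.bip hA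
    have := hcol.2.1
    tauto

/-- One step of the walk. -/
theorem Walk.step (h : H.Walk w col₀ e₀ x y a b S col e p q c d)
    (hc : c ≤ H.f p ∨ c ≤ H.f q) {g : ℕ} (hg : H.Inc g q) (hgc : col g = c) (hge : g ≠ e₀) :
    H.Walk w col₀ e₀ x y a b (insert g S) (kick col e g c) g q (H.other g q) d c ∧ g ∉ S := by
  have hk := h.kickable hc hg hgc
  have hcd := h.c_ne_d hg hgc
  have hab := h.a_ne_b hg hgc
  have hF := hk.foreignCount_kick
  have hU := hk.uncolored_kick w
  have hne := hk.ne
  have hlr := hk.link'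
  have hmr := hk.miss_right
  have hvk := hk.valid_kick
  set r := H.other g q
  have hdpos : d ≠ 0 := by
    rcases h.colors with ⟨-, rfl⟩ | ⟨-, rfl⟩
    exacts [h.b_pos, h.a_pos]
  have hgab : col g = a ∨ col g = b := by
    rw [hgc]; exact h.colors.imp (·.1) (·.1)
  -- at `x`, the only edge of color `a` is the first edge
  have hqx : q ≠ x := by
    intro hqx
    by_cases hee : e = e₀
    · exact h.link₀.ne (hqx.symm.trans (h.start hee).2.2)
    · obtain ⟨h₁, -, h₂⟩ := h.col_start hee
      refine hge (h.valid.proper x g e₀ (hqx ▸ hg) h.link₀.left ?_ ?_)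
      · rw [hgc, h₁, h₂ hqx]
      · rw [hgc]; exact h.c_pos
  have hgS : g ∉ S := fun hgS => hne (h.fresh hqx g hgS hg).symm
  have hstart : kick col e g c e₀ = a := by
    by_cases hee : e = e₀
    · rw [← hee, kick_self hne, (h.start hee).1]
    · rw [kick_of_ne (Ne.symm hee) hge.symm, (h.col_start hee).1]
  refine ⟨?_, hgS⟩
  constructor
  case valid => exact hvk
  case link => exact hlr
  case link₀ => exact h.link₀
  case col_e => exact kick_right
  case a_pos => exact h.a_pos
  case b_pos => exact h.b_pos
  case miss_p => exact h.miss_q.kick hdpos fun _ => hcd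
  case miss_q => exact hmr
  case foreign_le => have := h.foreign_le; omega
  case uncolored_eq => have := h.uncolored_eq; omega
  case colors => exact h.colors.symm.imp And.symm And.symm
  case col_of_ne =>
    intro i hi h₁ h₂
    have hie : i ≠ e := by
      rintro rfl
      have := h.col₀_e hi
      tauto
    have hig : i ≠ g := by
      rintro rfl
      rw [h.col_of_ne i hi h₁ h₂] at hgab
      tauto
    rw [kick_of_ne hie hig, h.col_of_ne i hi h₁ h₂]
  case col_of_eq =>
    intro i hi h₁
    by_cases hie : i = e
    · subst hie; rw [kick_self hne]; exact h.colors.imp (·.1) (·.1)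
    · rw [kick_of_ne hie hi]; exact h.col_of_eq i hie h₁
  case col₀_e =>
    intro _
    by_contra hcon
    push Not at hcon
    rw [h.col_of_ne g hge hcon.1 hcon.2] at hgab
    tauto
  case miss_b =>
    intro v hx hy hv
    obtain ⟨h₁, h₂, h₃⟩ := h.miss_b v hx hy hv
    have hvq : v ≠ q := by
      rintro rfl
      exact h₁ g hg (hgc.trans (h₃ rfl))
    refine ⟨h₁.kick h.b_pos fun hev => ?_, hvq, fun hvr => ?_⟩
    · rcases h.link.inc_iff.1 hev with hv | hv
      · exact absurd hv h₂
      · exact absurd hv hvq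
    · have : c ≠ b := by
        rintro rfl
        exact h₁ g (hvr ▸ hlr.right) hgc
      have := h.colors
      tauto
  case parity =>
    intro A hA
    have h₂ := h.link.bip hA
    have h₃ := hlr.bip hA
    rcases h.parity A hA with ⟨h₁, hca, hdb⟩ | ⟨h₁, hcb, hda⟩
    · exact .inr ⟨by rw [← h₁, h₂, h₃, not_not], hdb, hca⟩
    · exact .inl ⟨h₁, hda, hcb⟩
  case start => exact fun h' => absurd h' hge
  case col_start =>
    refine fun _ => ⟨hstart, hab, fun hrx => ?_⟩
    have hca : c ≠ a := by
      rintro rfl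
      by_cases hee : e = e₀
      · have := h.miss_p
        rw [(h.start hee).2.1] at this
        exact this g (hrx ▸ hlr.right) hgc
      · refine hge (h.valid.proper x g e₀ (hrx ▸ hlr.right) h.link₀.left ?_ ?_)
        · rw [hgc, (h.col_start hee).1]
        · rw [hgc]; exact h.c_pos
    have := h.colors
    tauto
  case subset => exact Finset.insert_subset (Finset.mem_range.2 hg.1) h.subset
  case mem_start => exact Finset.mem_insert_of_mem h.mem_start
  case mem => exact Finset.mem_insert_self g S
  case fresh =>
    intro hrx i hi hir
    rcases Finset.mem_insert.1 hi with hi | hi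
    · exact hi
    · exact absurd hgab (not_or.2 (h.passed r hrx hlr.ne.symm ⟨i, hi, hir⟩ g hgS hlr.right))
  case passed =>
    rintro v hvx hvr ⟨i, hi, hiv⟩ j hj hjv
    rw [Finset.mem_insert, not_or] at hj
    have hje : j ≠ e := by rintro rfl; exact hj.2 h.mem
    rw [kick_of_ne hje hj.1]
    by_cases hvq : v = q
    · subst hvq
      have h₁ : col j ≠ d := h.miss_q j hjv
      have h₂ : col j ≠ c := fun h₂ =>
        hj.1 (h.valid.proper v j g hjv hg (h₂.trans hgc.symm) (h₂ ▸ h.c_pos))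
      have := h.colors
      rcases h.colors with ⟨rfl, rfl⟩ | ⟨rfl, rfl⟩ <;> tauto
    · rcases Finset.mem_insert.1 hi with hi | hi
      · subst hi
        rcases hlr.inc_iff.1 hiv with h' | h' <;> tauto
      · exact h.passed v hvx hvq ⟨i, hi, hiv⟩ j hj.2 hjv

end Walk

end EdgeData

/-! ### Fans -/

namespace EdgeData

variable {H : EdgeData} {col col₀ : ℕ → ℕ}

/-- The edges `E lo, …, E k` at `x`, of which `E lo` is uncolored, where the color `C r` of
`E (r + 1)` is missing at the end of `E r` other than `x`. All these colors can be moved one edge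
down. -/
structure Fan (H : EdgeData) (x : ℕ) (E C : ℕ → ℕ) (k lo : ℕ) (col : ℕ → ℕ) : Prop where
  valid : H.Valid col
  col_lo : col (E lo) = 0
  inc : ∀ r, lo ≤ r → r ≤ k → H.Inc (E r) x
  inj : ∀ r r', lo ≤ r → r < r' → r' ≤ k → E r ≠ E r'
  color : ∀ r, lo ≤ r → r < k → col (E (r + 1)) = C r
  pos : ∀ r, lo ≤ r → r < k → C r ≠ 0
  miss : ∀ r, lo ≤ r → r < k → H.Miss col (H.other (E r) x) (C r)
  bound : ∀ r, lo < r → r < k → C r ≤ H.f (H.other (E r) x)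
  head : lo < k → C lo ≤ H.f (H.other (E lo) x) ∨ C lo ≤ H.f x

/-- The situation after the colors of `E (lo + 1), …, E r` have been moved one edge down. -/
structure Shifted (H : EdgeData) (w : ℕ → ℕ) (x : ℕ) (E C : ℕ → ℕ) (k lo : ℕ) (col₀ : ℕ → ℕ)
    (r : ℕ) (col : ℕ → ℕ) : Prop where
  fan : H.Fan x E C k r col
  bound : ∀ s, lo < s → s < k → C s ≤ H.f (H.other (E s) x)
  eq_of_eq : r = lo → col = col₀
  foreign_le : H.foreignCount col ≤ H.foreignCount col₀ + H.foreign (C lo) (H.other (E lo) x)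
  uncolored_eq : H.uncolored w col + w (E lo) = H.uncolored w col₀ + w (E r)
  miss_of_miss : ∀ v c, c ≠ 0 → (∀ r', lo ≤ r' → r' < k → C r' = c → v ≠ x ∧ v ≠ H.other (E r') x) →
    H.Miss col₀ v c → H.Miss col v c

section Fan

variable {w : ℕ → ℕ} {x : ℕ} {E C : ℕ → ℕ} {k lo r : ℕ}

theorem Fan.link (h : H.Fan x E C k lo col) (hr : lo ≤ r) (hk : r ≤ k) :
    H.Link (E r) x (H.other (E r) x) := (h.inc r hr hk).link

theorem Fan.kickable (h : H.Fan x E C k lo col) (hk : lo < k) :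
    H.Kickable col (E lo) (E (lo + 1)) (H.other (E lo) x) x (H.other (E (lo + 1)) x) (C lo) :=
  ⟨h.valid, (h.link le_rfl hk.le).symm, h.link (by omega) hk, h.col_lo, h.color lo le_rfl hk,
    h.pos lo le_rfl hk, h.miss lo le_rfl hk, h.head hk⟩

/-- The colors of a fan are distinct, being those of distinct edges at `x`. -/
theorem Fan.color_ne (h : H.Fan x E C k lo col) {r r' : ℕ} (hr : lo ≤ r) (hrr : r < r')
    (hk : r' < k) : C r ≠ C r' := by
  intro hc
  have hl := h.inc (r + 1) (by omega) (by omega)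
  have hl' := h.inc (r' + 1) (by omega) (by omega)
  refine h.inj (r + 1) (r' + 1) (by omega) (by omega) (by omega)
    (h.valid.proper x _ _ hl hl' ?_ ?_)
  · rw [h.color r hr (by omega), h.color r' (by omega) hk, hc]
  · rw [h.color r hr (by omega)]; exact h.pos r hr (by omega)

theorem Shifted.init (h : H.Fan x E C k lo col) : H.Shifted w x E C k lo col lo col where
  fan := h
  bound := h.bound
  eq_of_eq _ := rfl
  foreign_le := Nat.le_add_right _ _
  uncolored_eq := rfl
  miss_of_miss _ _ _ _ h := h

theorem Shifted.step (h : H.Shifted w x E C k lo col₀ r col) (hlo : lo ≤ r) (hr : r < k) :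
    H.Shifted w x E C k lo col₀ (r + 1) (kick col (E r) (E (r + 1)) (C r)) := by
  have hF := h.fan
  have hk := hF.kickable hr
  have hl := hF.link le_rfl hr.le
  have hne : ∀ s, r + 1 < s → s ≤ k → E s ≠ E r ∧ E s ≠ E (r + 1) := fun s hs hsk =>
    ⟨(hF.inj r s le_rfl (by omega) hsk).symm, (hF.inj (r + 1) s (by omega) hs hsk).symm⟩
  constructor
  case fan =>
    constructor
    case valid => exact hk.valid_kick
    case col_lo => exact kick_right
    case inc => exact fun s hs => hF.inc s (by omega)
    case inj => exact fun s s' hs => hF.inj s s' (by omega)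
    case color =>
      intro s hs hsk
      obtain ⟨h₁, h₂⟩ := hne (s + 1) (by omega) (by omega)
      rw [kick_of_ne h₁ h₂, hF.color s (by omega) hsk]
    case pos => exact fun s hs => hF.pos s (by omega)
    case miss =>
      intro s hs hsk
      exact (hF.miss s (by omega) hsk).kick (hF.pos s (by omega) hsk) fun _ =>
        hF.color_ne le_rfl (by omega) hsk
    case bound => exact fun s hs => hF.bound s (by omega)
    case head => exact fun hs => .inl (hF.bound (r + 1) (by omega) hs)
  case bound => exact h.bound
  case eq_of_eq => intro h'; omega
  case foreign_le =>
    have h₁ := hk.foreignCount_kick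
    rcases hlo.eq_or_lt with rfl | hlt
    · rw [h.eq_of_eq rfl] at h₁ ⊢
      omega
    · rw [foreign_of_le (h.bound r hlt hr)] at h₁
      have := h.foreign_le
      omega
  case uncolored_eq =>
    have := hk.uncolored_kick w
    have := h.uncolored_eq
    omega
  case miss_of_miss =>
    intro v c hc hv hm
    refine (h.miss_of_miss v c hc hv hm).kick hc fun hi hcc => ?_
    have := hv r hlo hr hcc
    rcases hl.inc_iff.1 hi with h' | h' <;> tauto

theorem Shifted.foreign_le_of_bound (h : H.Shifted w x E C k lo col₀ r col)
    (h0 : lo ≠ r → C lo ≤ H.f (H.other (E lo) x)) : H.foreignCount col ≤ H.foreignCount col₀ := by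
  by_cases hr : r = lo
  · rw [h.eq_of_eq hr]
  · have := h.foreign_le
    rwa [foreign_of_le (h0 (Ne.symm hr))] at this

/-- The last edge of the fan gets a color. -/
theorem Shifted.finish (h : H.Shifted w x E C k lo col₀ k col) {b : ℕ} (hb : b ≠ 0)
    (hx : H.Miss col x b) (hy : H.Miss col (H.other (E k) x) b)
    (hf : b ≤ H.f (H.other (E k) x)) :
    H.Valid (Function.update col (E k) b) ∧
      H.uncolored w (Function.update col (E k) b) + w (E lo) = H.uncolored w col₀ ∧
      H.foreignCount (Function.update col (E k) b) = H.foreignCount col + H.foreign b x := by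
  have hl := h.fan.link le_rfl le_rfl
  refine ⟨h.fan.valid.finish hl hx hy (.inr hf), ?_, ?_⟩
  · have h₁ := uncolored_update hl.1 w col b
    have h₂ := h.uncolored_eq
    simp only [h.fan.col_lo, hb, if_true, if_false] at h₁
    omega
  · have h₁ := foreignCount_update hl col b
    simp only [h.fan.col_lo, foreign_zero, foreign_of_le hf] at h₁
    omega

/-- What remains of the fan after an alternating walk from its first edge `E i` has returned. If the
color `b` was that of `E (i + 1)`, then this edge has the color `a` now. -/
theorem Returned.fan {i a b : ℕ} (h : H.Fan x E C k i col₀) (hik : i < k)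
    (hb : ∀ r, i ≤ r → r < k → C r = b → r = i) (ha : H.Miss col₀ x a) (hfa : a ≤ H.f x)
    (ha0 : a ≠ 0) (hret : H.Returned w col₀ (E i) x (H.other (E i) x) a b col) :
    H.Fan x E (fun r => if r = i ∧ C i = b then a else C r) k i col := by
  have hinc := fun r (hr : i ≤ r) (hk : r < k) => h.inc (r + 1) (by omega) hk
  have hne := fun r (hr : i ≤ r) (hk : r < k) => (h.inj i (r + 1) le_rfl (by omega) hk).symm
  have hCa : ∀ r, i ≤ r → r < k → C r ≠ a := fun r hr hk hc =>
    ha _ (hinc r hr hk) ((h.color r hr hk).trans hc)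
  have hkeep : ∀ r, i ≤ r → r < k → C r ≠ b → H.Miss col (H.other (E r) x) (C r) := by
    intro r hr hk hcb j hj hjc
    by_cases hji : j = E i
    · subst hji
      exact h.pos r hr hk (hjc.symm.trans hret.col_e)
    · by_cases hj0 : col₀ j = a ∨ col₀ j = b
      · have := hret.col_of_eq j hji hj0
        have := hCa r hr hk
        rw [hjc] at *
        tauto
      · push Not at hj0
        exact h.miss r hr hk j hj ((hret.col_of_ne j hji hj0.1 hj0.2).symm.trans hjc)
  constructor
  case valid => exact hret.valid
  case col_lo => exact hret.col_e
  case inc => exact h.inc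
  case inj => exact h.inj
  case color =>
    intro r hr hk
    have hc := h.color r hr hk
    by_cases hcb : C r = b
    · obtain rfl := hb r hr hk hcb
      simp only [hcb, and_self, if_true]
      have h₁ := hret.col_of_eq _ (hne r hr hk) (.inr (hc.trans hcb))
      exact h₁.resolve_right (hret.miss_x _ (hinc r hr hk))
    · rw [if_neg (by rintro ⟨rfl, h'⟩; exact hcb h'),
        hret.col_of_ne _ (hne r hr hk) (by rw [hc]; exact hCa r hr hk) (by rwa [hc]), hc]
  case pos => intro r hr hk; split_ifs; exacts [ha0, h.pos r hr hk]
  case miss =>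
    intro r hr hk
    split_ifs with hri
    · rw [hri.1]; exact hret.miss_y
    · exact hkeep r hr hk fun hcb => hri (by obtain rfl := hb r hr hk hcb; exact ⟨rfl, hcb⟩)
  case bound =>
    intro r hr hk
    rw [if_neg (by omega)]
    exact h.bound r hr hk
  case head =>
    intro hk
    split_ifs
    · exact .inr hfa
    · exact h.head hk

/-- After the return of an alternating walk, the colors of the fan can be moved, and its last edge
gets the color `b`. -/
theorem Returned.improved {i a b : ℕ} (h : H.Fan x E C k i col₀) (hik : i < k)
    (hb0 : b ≠ 0) (hbk : b ≤ H.f (H.other (E k) x))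
    (hb : ∀ r, i ≤ r → r < k → C r = b → r = i)
    (hi : C i ≤ H.f (H.other (E i) x))
    (hyk : H.Miss col₀ (H.other (E k) x) b) (hyik : H.other (E k) x ≠ H.other (E i) x)
    (hret : H.Returned w col₀ (E i) x (H.other (E i) x) a b col) {col' : ℕ → ℕ}
    (hs : H.Shifted w x E (fun r => if r = i ∧ C i = b then a else C r) k i col k col') :
    H.Improved w col₀ (E i) (Function.update col' (E k) b) := by
  have hC' : ∀ r, i ≤ r → r < k → (if r = i ∧ C i = b then a else C r) ≠ b := by
    intro r hr hk
    split_ifs with h'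
    · exact hret.ne
    · exact fun hcb => h' (by obtain rfl := hb r hr hk hcb; exact ⟨rfl, hcb⟩)
  have hkx := (h.link hik.le le_rfl).ne
  obtain ⟨h₁, h₂, h₃⟩ := hs.finish hb0
    (hs.miss_of_miss x b hb0 (fun r hr hk hc => absurd hc (hC' r hr hk)) hret.miss_x)
    (hs.miss_of_miss _ b hb0 (fun r hr hk hc => absurd hc (hC' r hr hk))
      (hret.miss_b _ hkx.symm hyik hyk)) hbk
  refine ⟨h₁, .inl ⟨by rw [h₂, hret.uncolored_eq], ?_⟩⟩
  have h₄ := hret.foreign_le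
  have h₅ := hs.foreign_le
  split_ifs at h₅ with h'
  · omega
  · rw [foreign_of_le hi] at h₅
    omega

/-- An improvement after moving the colors of a fan. -/
theorem Shifted.improved {i : ℕ} (h : H.Shifted w x E C k 0 col₀ i col)
    (h0 : 0 ≠ i → C 0 ≤ H.f (H.other (E 0) x)) {col' : ℕ → ℕ} (h' : H.Improved w col (E i) col') :
    H.Improved w col₀ (E 0) col' := by
  have h₁ := h.uncolored_eq
  have h₂ := h.foreign_le_of_bound h0
  obtain ⟨hv, ⟨h₃, h₄⟩ | ⟨e, he, h₃, h₄⟩⟩ := h'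
  · exact ⟨hv, .inl ⟨by omega, by omega⟩⟩
  · exact ⟨hv, .inr ⟨e, he, by omega, by omega⟩⟩

theorem Fan.extend (h : H.Fan x E C k 0 col) (hC : ∀ r < k, C r ≤ H.f (H.other (E r) x)) {c g : ℕ}
    (hc : c ≠ 0) (hm : H.Miss col (H.other (E k) x) c) (hf : c ≤ H.f (H.other (E k) x))
    (hg : H.Inc g x) (hgc : col g = c) (hne : ∀ r < k, C r ≠ c) {E' C' : ℕ → ℕ}
    (hE : ∀ r ≤ k, E' r = E r) (hE' : E' (k + 1) = g) (hC₀ : ∀ r < k, C' r = C r)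
    (hC' : C' k = c) :
    H.Fan x E' C' (k + 1) 0 col ∧ ∀ r < k + 1, C' r ≤ H.f (H.other (E' r) x) := by
  have hgE : ∀ r ≤ k, E r ≠ g := by
    rintro r hr rfl
    rcases Nat.eq_zero_or_pos r with rfl | hr0
    · exact hc (hgc.symm.trans h.col_lo)
    · obtain ⟨r, rfl⟩ := Nat.exists_eq_succ_of_ne_zero hr0.ne'
      exact hne r hr ((h.color r (Nat.zero_le r) hr).symm.trans hgc)
  have hbound : ∀ r < k + 1, C' r ≤ H.f (H.other (E' r) x) := by
    intro r hr
    rcases Nat.lt_succ_iff_lt_or_eq.1 hr with hr | rfl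
    · rw [hC₀ r hr, hE r hr.le]; exact hC r hr
    · rwa [hC', hE r le_rfl]
  refine ⟨?_, hbound⟩
  constructor
  case valid => exact h.valid
  case col_lo => rw [hE 0 (Nat.zero_le k)]; exact h.col_lo
  case inc =>
    intro r _ hr
    rcases Nat.le_succ_iff.1 hr with hr | rfl
    · rw [hE r hr]; exact h.inc r (Nat.zero_le r) hr
    · rwa [hE']
  case inj =>
    intro r r' _ hrr hr
    rcases Nat.le_succ_iff.1 hr with hr | rfl
    · rw [hE r (by omega), hE r' hr]; exact h.inj r r' (Nat.zero_le r) hrr hr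
    · rw [hE r (by omega), hE']; exact hgE r (by omega)
  case color =>
    intro r _ hr
    rcases Nat.lt_succ_iff_lt_or_eq.1 hr with hr | rfl
    · rw [hE (r + 1) hr, hC₀ r hr]; exact h.color r (Nat.zero_le r) hr
    · rw [hE', hC', hgc]
  case pos =>
    intro r _ hr
    rcases Nat.lt_succ_iff_lt_or_eq.1 hr with hr | rfl
    · rw [hC₀ r hr]; exact h.pos r (Nat.zero_le r) hr
    · rwa [hC']
  case miss =>
    intro r _ hr
    rcases Nat.lt_succ_iff_lt_or_eq.1 hr with hr | rfl
    · rw [hE r hr.le, hC₀ r hr]; exact h.miss r (Nat.zero_le r) hr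
    · rwa [hC', hE r le_rfl]
  case bound => exact fun r _ => hbound r
  case head => exact fun h' => .inl (hbound 0 h')

theorem Fan.zero (hv : H.Valid col) (h0 : col (E 0) = 0) (hx : H.Inc (E 0) x) :
    H.Fan x E C 0 0 col where
  valid := hv
  col_lo := h0
  inc r _ hr := by rwa [Nat.le_zero.1 hr]
  inj r r' _ h h' := by omega
  color r _ h := by omega
  pos r _ h := by omega
  miss r _ h := by omega
  bound r _ h := by omega
  head h := by omega

theorem Fan.lt (h : H.Fan x E C k 0 col) : k < H.m := by
  have : (Finset.range (k + 1)).card ≤ (Finset.range H.m).card := by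
    refine Finset.card_le_card_of_injOn E (fun r hr => ?_) fun r hr r' hr' hrr => ?_
    · simp only [Finset.coe_range, Set.mem_Iio] at hr ⊢
      exact (h.inc r (Nat.zero_le r) (by omega)).1
    · simp only [Finset.coe_range, Set.mem_Iio] at hr hr'
      by_contra hne
      rcases Nat.lt_or_gt_of_ne hne with hlt | hlt
      · exact h.inj r r' (Nat.zero_le r) hlt (by omega) hrr
      · exact h.inj r' r (Nat.zero_le r') hlt (by omega) hrr.symm
  simpa using this

end Fan

/-! ### Counting missing colors -/

open Finset Classical in
/-- The reserved colors that are missing at `v`. -/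
noncomputable def avail (H : EdgeData) (col : ℕ → ℕ) (v : ℕ) : Finset ℕ :=
  (Icc 1 (H.f v)).filter (H.Miss col v)

open Finset Classical in
/-- The colored edges at `v`. -/
noncomputable def coloredAt (H : EdgeData) (col : ℕ → ℕ) (v : ℕ) : Finset ℕ :=
  (range H.m).filter fun i => H.Inc i v ∧ col i ≠ 0

open Finset Classical in
/-- The degree of the vertex `v`. -/
noncomputable def deg (H : EdgeData) (v : ℕ) : ℕ := #{i ∈ range H.m | H.Inc i v}

open Finset Classical in
/-- The number of edges between `x` and `y`. -/
noncomputable def mult (H : EdgeData) (x y : ℕ) : ℕ := #{i ∈ range H.m | H.Link i x y}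

theorem mem_avail {v c : ℕ} : c ∈ H.avail col v ↔ c ≠ 0 ∧ c ≤ H.f v ∧ H.Miss col v c := by
  simp [avail, Nat.one_le_iff_ne_zero, and_assoc]

theorem le_card_avail (v : ℕ) : H.f v ≤ (H.avail col v).card + (H.coloredAt col v).card := by
  classical
  calc H.f v = (Finset.Icc 1 (H.f v)).card := by simp
    _ ≤ (H.avail col v ∪ (H.coloredAt col v).image col).card := by
        refine Finset.card_le_card fun c hc => ?_
        by_cases hm : H.Miss col v c
        · exact Finset.mem_union_left _ (by simp [avail, hm] at hc ⊢; exact hc)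
        · refine Finset.mem_union_right _ ?_
          simp only [Miss, not_forall, not_not] at hm
          obtain ⟨i, hi, rfl⟩ := hm
          simp only [Finset.mem_Icc] at hc
          exact Finset.mem_image_of_mem _ (by simp [coloredAt, hi, hi.1]; omega)
    _ ≤ _ := (Finset.card_union_le _ _).trans (Nat.add_le_add_left Finset.card_image_le _)

theorem card_coloredAt_le (v : ℕ) : (H.coloredAt col v).card ≤ H.deg v := by
  refine Finset.card_le_card fun i hi => ?_
  simp only [coloredAt, Finset.mem_filter] at hi ⊢
  tauto

theorem card_coloredAt_lt {v e : ℕ} (he : H.Inc e v) (h0 : col e = 0) :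
    (H.coloredAt col v).card < H.deg v := by
  refine Finset.card_lt_card (Finset.ssubset_iff_of_subset ?_ |>.2 ⟨e, ?_, ?_⟩)
  · intro i hi
    simp only [coloredAt, Finset.mem_filter] at hi ⊢
    tauto
  · simpa [he] using he.1
  · simp [coloredAt, h0]

theorem exists_avail {v e : ℕ} (hf : H.deg v ≤ H.f v) (he : H.Inc e v) (h0 : col e = 0) :
    ∃ c, c ∈ H.avail col v := by
  have h₁ := H.le_card_avail (col := col) v
  have h₂ := card_coloredAt_lt he h0
  exact Finset.card_pos.1 (by omega)

/-- If `f` is at least degree plus multiplicity, then the fan can be continued with a color that has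
not been used at parallel edges. -/
theorem Fan.exists_avail {x k : ℕ} {E C : ℕ → ℕ} (h : H.Fan x E C k 0 col)
    (hf : ∀ v z, H.deg v + H.mult v z ≤ H.f v) :
    ∃ c ∈ H.avail col (H.other (E k) x),
      ∀ r < k, H.other (E r) x = H.other (E k) x → C r ≠ c := by
  classical
  set y := H.other (E k) x
  have h₁ := H.le_card_avail (col := col) y
  have h₂ := H.card_coloredAt_le (col := col) y
  have h₃ := hf y x
  set R := {r ∈ Finset.range (k + 1) | H.other (E r) x = y}
  have h₄ : R.card ≤ H.mult y x := by
    refine Finset.card_le_card_of_injOn E (fun r hr => ?_) fun r hr r' hr' hrr => ?_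
    · simp only [R, Finset.coe_filter, Finset.mem_range, Set.mem_ofPred_eq] at hr ⊢
      have hl := h.link (Nat.zero_le r) (by omega)
      rw [hr.2] at hl
      exact ⟨hl.1, hl.symm⟩
    · simp only [R, Finset.coe_filter, Finset.mem_range, Set.mem_ofPred_eq] at hr hr'
      by_contra hne
      rcases Nat.lt_or_gt_of_ne hne with hlt | hlt
      · exact h.inj r r' (Nat.zero_le _) hlt (by omega) hrr
      · exact h.inj r' r (Nat.zero_le _) hlt (by omega) hrr.symm
  have h₅ : ((R.erase k).image C).card < (H.avail col y).card := by
    have hk : k ∈ R := by simp [R, y]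
    have := Finset.card_image_le (s := R.erase k) (f := C)
    rw [Finset.card_erase_of_mem hk] at this
    have := Finset.card_pos.2 ⟨k, hk⟩
    omega
  obtain ⟨c, hc, hcR⟩ := Finset.exists_mem_notMem_of_card_lt_card h₅
  refine ⟨c, hc, fun r hr hy hrc => hcR ?_⟩
  rw [← hrc]
  exact Finset.mem_image_of_mem _ (by simp [R, hy, hr.ne]; omega)

/-- If `f` is three halves of the degree, then at neighbors `y`, `z` of `x` of at least the same
degree as `x`, where `x` has an uncolored edge to `y`, there cannot be only reserved missing colors
that are present at `x` and different for `y` and `z`. -/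
theorem exists_common_avail {x y z e : ℕ} (hf : ∀ v, H.f v = 3 * H.deg v / 2)
    (hx : H.Inc e x) (hy : H.Inc e y) (h0 : col e = 0)
    (hxy : H.deg x ≤ H.deg y) (hxz : H.deg x ≤ H.deg z) (h : ∀ c ∈ H.avail col y, ¬ H.Miss col x c) :
    ∃ c ∈ H.avail col z, H.Miss col x c ∨ c ∈ H.avail col y := by
  classical
  by_contra hcon
  push Not at hcon
  have h₁ := H.le_card_avail (col := col) y
  have h₂ := card_coloredAt_lt hy h0
  have h₃ := H.le_card_avail (col := col) z
  have h₄ := H.card_coloredAt_le (col := col) z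
  have h₅ := card_coloredAt_lt hx h0
  have h₆ : (H.avail col y ∪ H.avail col z).card ≤ (H.coloredAt col x).card := by
    refine (Finset.card_le_card (t := (H.coloredAt col x).image col) fun c hc => ?_).trans
      Finset.card_image_le
    have hm : ¬ H.Miss col x c ∧ c ≠ 0 := by
      rcases Finset.mem_union.1 hc with hc | hc
      · exact ⟨h c hc, (mem_avail.1 hc).1⟩
      · exact ⟨(hcon c hc).1, (mem_avail.1 hc).1⟩
    simp only [Miss, not_forall, not_not] at hm
    obtain ⟨⟨i, hi, rfl⟩, h0⟩ := hm
    exact Finset.mem_image_of_mem _ (by simp [coloredAt, hi, hi.1, h0])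
  rw [Finset.card_union_of_disjoint (Finset.disjoint_right.2 fun c hc => (hcon c hc).2)] at h₆
  have := hf y
  have := hf z
  omega

/-! ### The potential -/

/-- The weight of an uncolored edge, for a number `K` greater than all degrees: the weights of two
edges differ by less than `K`, and coloring an edge gains at least `2 * K`. -/
noncomputable def weight (H : EdgeData) (K i : ℕ) : ℕ :=
  2 * K + min (H.deg (H.s i)) (H.deg (H.t i))

/-- The quantity that decreases in every round of the algorithm. -/
noncomputable def potential (H : EdgeData) (K : ℕ) (col : ℕ → ℕ) : ℕ :=
  K * H.foreignCount col + H.uncolored (H.weight K) col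

theorem Link.weight_eq {K i p q : ℕ} (h : H.Link i p q) :
    H.weight K i = 2 * K + min (H.deg p) (H.deg q) := by
  rcases h.2 with ⟨rfl, rfl⟩ | ⟨rfl, rfl⟩
  · rfl
  · rw [weight, min_comm]

theorem Improved.potential_lt {K e₀ : ℕ} (h : H.Improved (H.weight K) col₀ e₀ col)
    (hK : ∀ v, H.deg v < K) : H.potential K col < H.potential K col₀ := by
  have hw : 2 * K ≤ H.weight K e₀ := Nat.le_add_right _ _
  unfold potential
  obtain ⟨-, ⟨h₁, h₂⟩ | ⟨e, -, h₁, h₂⟩⟩ := h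
  · have := hK 0
    nlinarith
  · have hwe : H.weight K e < 3 * K := by
      have := hK (H.s e)
      have := min_le_left (H.deg (H.s e)) (H.deg (H.t e))
      unfold weight
      omega
    nlinarith

theorem deg_le (v : ℕ) : H.deg v ≤ H.m := by
  classical
  have := Finset.card_filter_le (Finset.range H.m) (fun i => H.Inc i v)
  rw [Finset.card_range] at this
  unfold deg
  convert this

theorem potential_zero_lt {K : ℕ} (hK : ∀ v, H.deg v < K) (hm : 2 * H.m < K) :
    H.potential K (fun _ => 0) < K * K * K := by
  have h₁ : H.foreignCount (fun _ => 0) = 0 := by simp [foreignCount]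
  have h₂ : H.uncolored (H.weight K) (fun _ => 0) ≤ H.m * (3 * K) := by
    simp only [uncolored, if_true]
    refine (Finset.sum_le_card_nsmul _ _ (3 * K) fun i _ => ?_).trans (by simp)
    have := hK (H.s i)
    have := min_le_left (H.deg (H.s i)) (H.deg (H.t i))
    unfold weight
    omega
  unfold potential
  rw [h₁, mul_zero, zero_add]
  refine h₂.trans_lt ?_
  rcases Nat.eq_zero_or_pos H.m with h0 | h0
  · rw [h0]; simp; omega
  · have : H.m * 3 < K * K := by nlinarith
    calc H.m * (3 * K) = (H.m * 3) * K := by ring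
      _ < _ := Nat.mul_lt_mul_of_pos_right this (by omega)

end EdgeData

/-! ### The vocabulary of the algorithm -/

namespace RAM

namespace Term

/-! As in the machine, a term is true if its value is nonzero. -/

def not (s : Term) : Term := ite s (lit 0) (lit 1)

def and (s t : Term) : Term := ite s t (lit 0)

def or (s t : Term) : Term := ite s (lit 1) t

/-- The term is true in the state `σ`. -/
def Holds (t : Term) (σ : State) : Prop := t.eval σ ≠ 0

section

variable {s t : Term} {σ : State}

@[simp] theorem holds_not : (not s).Holds σ ↔ ¬ s.Holds σ := by
  simp only [Holds, not, eval]; split_ifs <;> simp_all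

@[simp] theorem holds_and : (and s t).Holds σ ↔ s.Holds σ ∧ t.Holds σ := by
  simp only [Holds, and, eval]; split_ifs <;> simp_all

@[simp] theorem holds_or : (or s t).Holds σ ↔ s.Holds σ ∨ t.Holds σ := by
  simp only [Holds, or, eval]; split_ifs <;> simp_all

@[simp] theorem holds_lt : (op .lt s t).Holds σ ↔ s.eval σ < t.eval σ := by
  simp [Holds, eval, Op.eval]

@[simp] theorem holds_eq : (op .eq s t).Holds σ ↔ s.eval σ = t.eval σ := by
  simp [Holds, eval, Op.eval]

@[simp] theorem eval_lit (k : ℕ) : (lit k).eval σ = k := rfl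

@[simp] theorem eval_reg (x : ℕ) : (reg x).eval σ = σ.reg x := rfl

@[simp] theorem eval_get (a : ℕ) : (get a t).eval σ = σ.arr a (t.eval σ) := rfl

@[simp] theorem eval_add : (op .add s t).eval σ = s.eval σ + t.eval σ := rfl

@[simp] theorem eval_sub : (op .sub s t).eval σ = s.eval σ - t.eval σ := rfl

open Classical in
theorem eval_ite (c : Term) : (ite c s t).eval σ = if c.Holds σ then s.eval σ else t.eval σ := by
  simp only [eval, Holds]; split_ifs <;> simp_all

theorem lastIndex_spec (P : ℕ → ℕ) (b n : ℕ) :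
    (lastIndex P b n < n ∧ P (lastIndex P b n) ≠ 0) ∨
      (lastIndex P b n = b ∧ ∀ j < n, P j = 0) := by
  induction n with
  | zero => exact .inr ⟨rfl, by simp⟩
  | succ n ih =>
    by_cases h : P n = 0
    · simp only [lastIndex, h, if_true]
      refine ih.imp (fun h' => ⟨by omega, h'.2⟩) fun h' => ⟨h'.1, fun j hj => ?_⟩
      rcases Nat.lt_succ_iff_lt_or_eq.1 hj with hj | rfl
      exacts [h'.2 j hj, h]
    · left; simp [lastIndex, h]

theorem eval_find (v : ℕ) (t : Term) (σ : State) :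
    ((find v t).eval σ < σ.reg 2 ∧ t.Holds (σ.setReg v ((find v t).eval σ))) ∨
      ((find v t).eval σ = σ.reg 2 ∧ ∀ j < σ.reg 2, ¬ t.Holds (σ.setReg v j)) := by
  have := lastIndex_spec (fun i => t.eval (σ.setReg v i)) (σ.reg 2) (σ.reg 2)
  simpa only [Holds, eval, not_not] using this

/-- There is an `i < B` for which the term is nonzero. -/
def ex (v : ℕ) (t : Term) : Term := op .lt (find v t) (reg 2)

theorem holds_ex (v : ℕ) : (ex v t).Holds σ ↔ ∃ j < σ.reg 2, t.Holds (σ.setReg v j) := by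
  rw [ex, holds_lt, eval_reg]
  rcases eval_find v t σ with ⟨h₁, h₂⟩ | ⟨h₁, h₂⟩
  · exact ⟨fun _ => ⟨_, h₁, h₂⟩, fun _ => h₁⟩
  · refine ⟨fun h => by omega, fun ⟨j, hj, h⟩ => absurd h (h₂ j hj)⟩

/-- The edge `i` has the end `v`. -/
def inc (i v : Term) : Term :=
  and (op .lt i (reg 1)) (or (op .eq (get 0 i) v) (op .eq (get 1 i) v))

/-- The end of the edge `i` other than `v`. -/
def other (i v : Term) : Term := op .sub (op .add (get 0 i) (get 1 i)) v

/-- An edge at `v` that has the color `c`. -/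
def edgeAt (v c : Term) : Term := find 40 (and (inc (reg 40) v) (op .eq (get 2 (reg 40)) c))

/-- The color `c` is missing at `v`. -/
def miss (v c : Term) : Term := op .eq (edgeAt v c) (reg 2)

/-- The color `c` is reserved and missing at `v`. -/
def isAvail (v c : Term) : Term :=
  and (op .lt (lit 0) c) (and (not (op .lt (get 3 v) c)) (miss v c))

end

end Term

namespace Cmd

variable {p q : Cmd} {σ : State}

@[simp] theorem exec_skip : skip.exec σ = σ := rfl

@[simp] theorem exec_set (x : ℕ) (t : Term) : (set x t).exec σ = σ.setReg x (t.eval σ) := rfl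

@[simp] theorem exec_put (a : ℕ) (i t : Term) :
    (put a i t).exec σ = σ.setArr a (i.eval σ) (t.eval σ) := rfl

@[simp] theorem exec_seq : (seq p q).exec σ = q.exec (p.exec σ) := rfl

theorem exec_ite_pos {c : Term} (h : c.Holds σ) : (ite c p q).exec σ = p.exec σ := if_neg h

theorem exec_ite_neg {c : Term} (h : ¬ c.Holds σ) : (ite c p q).exec σ = q.exec σ :=
  if_pos (not_not.1 h)

end Cmd

/-- The arrays and registers that are fixed during the rounds of the algorithm hold the edge list
`H`, the numbers `f v`, the degrees and the loop bound `B`, which is large enough. -/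
structure Setup (H : EdgeData) (B : ℕ) (σ : State) : Prop where
  arr_zero : σ.arr 0 = H.s
  arr_one : σ.arr 1 = H.t
  arr_three : σ.arr 3 = H.f
  arr_four : σ.arr 4 = H.deg
  reg_one : σ.reg 1 = H.m
  reg_two : σ.reg 2 = B
  two_mul_lt : 2 * H.m < B
  f_lt : ∀ v, H.f v < B

namespace Setup

variable {H : EdgeData} {B : ℕ} {σ : State}

theorem m_lt (h : Setup H B σ) : H.m < B := by have := h.two_mul_lt; omega

theorem setReg (h : Setup H B σ) {x : ℕ} (k : ℕ) (hx : 2 < x) : Setup H B (σ.setReg x k) := by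
  refine ⟨h.1, h.2, h.3, h.4, ?_, ?_, h.7, h.8⟩
  · simp [h.5, show 1 ≠ x by omega]
  · simp [h.6, show 2 ≠ x by omega]

theorem setArr (h : Setup H B σ) {a : ℕ} (i k : ℕ) (ha : a ≠ 0 ∧ a ≠ 1 ∧ a ≠ 3 ∧ a ≠ 4) :
    Setup H B (σ.setArr a i k) := by
  refine ⟨?_, ?_, ?_, ?_, h.5, h.6, h.7, h.8⟩ <;>
  simp [h.1, h.2, h.3, h.4, ha.1.symm, ha.2.1.symm, ha.2.2.1.symm, ha.2.2.2.symm]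

theorem exec (h : Setup H B σ) {p : Cmd}
    (hp : (p.stores 0 || p.stores 1 || p.stores 3 || p.stores 4 || p.writes 1 || p.writes 2)
      = false) : Setup H B (p.exec σ) := by
  simp only [Bool.or_eq_false_iff] at hp
  obtain ⟨⟨⟨⟨⟨h₀, h₁⟩, h₃⟩, h₄⟩, h₅⟩, h₆⟩ := hp
  exact ⟨by rw [Cmd.exec_arr h₀, h.1], by rw [Cmd.exec_arr h₁, h.2], by rw [Cmd.exec_arr h₃, h.3],
    by rw [Cmd.exec_arr h₄, h.4], by rw [Cmd.exec_reg h₅, h.5], by rw [Cmd.exec_reg h₆, h.6],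
    h.7, h.8⟩

theorem holds_inc (h : Setup H B σ) (i v : Term) :
    (Term.inc i v).Holds σ ↔ H.Inc (i.eval σ) (v.eval σ) := by
  simp [Term.inc, EdgeData.Inc, h.1, h.2, h.5]

theorem eval_other (h : Setup H B σ) (i v : Term) :
    (Term.other i v).eval σ = H.other (i.eval σ) (v.eval σ) := by
  simp [Term.other, EdgeData.other, h.1, h.2]

section

variable (h : Setup H B σ) {v c : Term} (hv : ∀ j, v.eval (σ.setReg 40 j) = v.eval σ)
  (hc : ∀ j, c.eval (σ.setReg 40 j) = c.eval σ)
include h hv hc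

theorem eval_edgeAt :
    ((Term.edgeAt v c).eval σ < B ∧ H.Inc ((Term.edgeAt v c).eval σ) (v.eval σ) ∧
        σ.arr 2 ((Term.edgeAt v c).eval σ) = c.eval σ) ∨
      ((Term.edgeAt v c).eval σ = B ∧ H.Miss (σ.arr 2) (v.eval σ) (c.eval σ)) := by
  have hin := fun j i => (h.setReg (x := 40) j (by norm_num)).holds_inc i v
  rcases Term.eval_find 40 (.and (.inc (.reg 40) v) (.op .eq (.get 2 (.reg 40)) c)) σ with h' | h'
  · left
    simpa [hin, hv, hc, h.6, Term.edgeAt] using h'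
  · right
    obtain ⟨h₁, h₂⟩ := h'
    refine ⟨h₁.trans h.6, fun i hi hic => ?_⟩
    have := h₂ i (by rw [h.6]; exact hi.1.trans h.m_lt)
    simp [hin, hv, hc, hi, hic] at this

theorem holds_miss : (Term.miss v c).Holds σ ↔ H.Miss (σ.arr 2) (v.eval σ) (c.eval σ) := by
  rw [Term.miss, Term.holds_eq, Term.eval_reg, h.6]
  rcases h.eval_edgeAt hv hc with ⟨h₁, h₂, h₃⟩ | ⟨h₁, h₂⟩
  · exact ⟨fun h' => by omega, fun h' => absurd h₃ (h' _ h₂)⟩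
  · exact ⟨fun _ => h₂, fun _ => h₁⟩

theorem holds_isAvail :
    (Term.isAvail v c).Holds σ ↔ c.eval σ ∈ H.avail (σ.arr 2) (v.eval σ) := by
  simp [Term.isAvail, h.holds_miss hv hc, EdgeData.mem_avail, h.3, Nat.pos_iff_ne_zero]

end

theorem lt_of_mem_avail (h : Setup H B σ) {col : ℕ → ℕ} {v c : ℕ} (hc : c ∈ H.avail col v) :
    c < B :=
  (EdgeData.mem_avail.1 hc).2.1.trans_lt (h.f_lt v)

end Setup

end RAM

/-! ### The algorithm -/

namespace RAM

local infixr:60 " ;; " => Cmd.seq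

open Term in
/-- Moves the colors of the fan in array `5` one edge down, from the position in register `17` to
the position in register `18`. -/
def shift : Cmd :=
  .loop 7 (.ite (and (not (op .lt (reg 7) (reg 17))) (op .lt (reg 7) (reg 18)))
    (.put 2 (get 5 (reg 7)) (get 2 (get 5 (op .add (reg 7) (lit 1)))) ;;
      .put 2 (get 5 (op .add (reg 7) (lit 1))) (lit 0))
    .skip)

open Term in
/-- One step of the alternating walk. The registers `20`, …, `24` hold the uncolored edge `e`, its
ends `p` and `q`, the color `c` to be tried on it and the other color `d`. -/
def walkStep : Cmd :=
  .ite (and (op .lt (get 3 (reg 21)) (reg 23)) (op .lt (get 3 (reg 22)) (reg 23)))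
    (.set 25 (lit 0))
    (.set 26 (edgeAt (reg 22) (reg 23)) ;;
    .put 2 (reg 20) (reg 23) ;;
    .ite (op .eq (reg 26) (reg 2))
      (.set 25 (lit 0))
      (.put 2 (reg 26) (lit 0) ;;
      .set 21 (reg 22) ;;
      .set 22 (other (reg 26) (reg 22)) ;;
      .set 20 (reg 26) ;;
      .set 27 (reg 23) ;;
      .set 23 (reg 24) ;;
      .set 24 (reg 27) ;;
      .ite (op .eq (reg 20) (get 5 (reg 15))) (.set 25 (lit 2)) .skip))

open Term in
/-- The start of an alternating walk, at the fan edge with the position in register `15` and with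
the colors in the registers `12` and `16`. -/
def walkInit : Cmd :=
  .set 20 (get 5 (reg 15)) ;;
  .set 21 (reg 11) ;;
  .set 22 (other (reg 20) (reg 11)) ;;
  .set 23 (reg 12) ;;
  .set 24 (reg 16) ;;
  .set 25 (lit 1)

/-- The alternating walk. Finally register `25` holds `2` if the walk has returned to its first
edge, and `0` otherwise. -/
def walk : Cmd :=
  walkInit ;; .loop 8 (.ite (.op .eq (.reg 25) (.lit 1)) walkStep .skip)

open Term in
/-- Uses the fan: its center `x` is in register `11`, its edges are in array `5`, register `13`
holds the last position `k` and register `16` a color `b` for the last edge. In register `14`, the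
number `1` means that `b` is missing at `x`, `2` means that `b` is missing also at the fan edge
with the position in register `15`, and `3` means that the colors shall only be moved. -/
def augment : Cmd :=
  .set 17 (lit 0) ;;
  .set 18 (ite (op .eq (reg 14) (lit 2)) (reg 15) (reg 13)) ;;
  shift ;;
  .ite (op .eq (reg 14) (lit 2))
    (.set 12 (find 41 (isAvail (reg 11) (reg 41))) ;;
    walk ;;
    .ite (op .eq (reg 25) (lit 2))
      (.set 17 (reg 15) ;;
      .set 18 (reg 13) ;;
      shift ;;
      .put 2 (get 5 (reg 13)) (reg 16))
      .skip)
    (.ite (op .eq (reg 14) (lit 1)) (.put 2 (get 5 (reg 13)) (reg 16)) .skip)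

variable {H : EdgeData} {B : ℕ} {σ : State} {w : ℕ → ℕ}

theorem exec_shift (h : Setup H B σ) {x k : ℕ} {C col₀ : ℕ → ℕ} (hcol : σ.arr 2 = col₀)
    (hf : H.Fan x (σ.arr 5) C k (σ.reg 17) col₀) (h₁ : σ.reg 17 ≤ σ.reg 18) (h₂ : σ.reg 18 ≤ k)
    (hB : σ.reg 18 ≤ B) :
    H.Shifted w x (σ.arr 5) C k (σ.reg 17) col₀ (σ.reg 18) ((shift.exec σ).arr 2) := by
  have key := Cmd.exec_loop (v := 7) (σ := σ)
    (p := .ite (.and (.not (.op .lt (.reg 7) (.reg 17))) (.op .lt (.reg 7) (.reg 18)))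
      (.put 2 (.get 5 (.reg 7)) (.get 2 (.get 5 (.op .add (.reg 7) (.lit 1)))) ;;
        .put 2 (.get 5 (.op .add (.reg 7) (.lit 1))) (.lit 0))
      .skip)
    (fun j τ => τ.arr 5 = σ.arr 5 ∧ τ.reg 17 = σ.reg 17 ∧ τ.reg 18 = σ.reg 18 ∧
      H.Shifted w x (σ.arr 5) C k (σ.reg 17) col₀ (max (σ.reg 17) (min j (σ.reg 18))) (τ.arr 2))
    ?_ ?_ ?_
  · obtain ⟨-, -, -, h'⟩ := key
    rwa [h.6, min_eq_right hB, max_eq_right h₁] at h'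
  · refine ⟨rfl, rfl, rfl, ?_⟩
    rw [hcol, Nat.zero_min, Nat.max_zero]
    exact .init hf
  · rintro j hj τ ⟨hE, hlo, hhi, hs⟩
    by_cases hc : σ.reg 17 ≤ j ∧ j < σ.reg 18
    · rw [Cmd.exec_ite_pos (by simpa [hlo, hhi] using hc)]
      refine ⟨by simp [hE], by simp [hlo], by simp [hhi], ?_⟩
      rw [min_eq_left hc.2.le, max_eq_right hc.1] at hs
      rw [min_eq_left (by omega), max_eq_right (by omega)]
      have hcol := hs.fan.color j le_rfl (by omega)
      have hne := hs.fan.inj j (j + 1) le_rfl (by omega) (by omega)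
      have := hs.step hc.1 (by omega)
      simpa [hE, hcol, EdgeData.kick] using this
    · rw [Cmd.exec_ite_neg (by simpa [hlo, hhi] using hc)]
      refine ⟨hE, by simp [hlo], by simp [hhi], ?_⟩
      rw [show max (σ.reg 17) (min (j + 1) (σ.reg 18)) = max (σ.reg 17) (min j (σ.reg 18)) by omega]
      simpa using hs
  · rintro τ ⟨hE, hlo, hhi, hs⟩
    exact ⟨hE, by simp [hlo], by simp [hhi], hs⟩

/-- The state of the machine after `n` steps of an alternating walk, which goes on, has improved the
coloring, or has returned to its first edge. As the set `S` of visited edges grows in each step, the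
walk ends after at most `m` steps. -/
def Walking (H : EdgeData) (w col₀ : ℕ → ℕ) (e₀ x y a b n : ℕ) (σ : State) : Prop :=
  (σ.reg 25 = 1 ∧ ∃ S : Finset ℕ, S.card = n + 1 ∧ H.Walk w col₀ e₀ x y a b S (σ.arr 2)
    (σ.reg 20) (σ.reg 21) (σ.reg 22) (σ.reg 23) (σ.reg 24)) ∨
  (σ.reg 25 = 0 ∧ H.Improved w col₀ e₀ (σ.arr 2)) ∨
  (σ.reg 25 = 2 ∧ H.Returned w col₀ e₀ x y a b (σ.arr 2))

theorem exec_walkStep (h : Setup H B σ) {col₀ : ℕ → ℕ} {e₀ x y a b n : ℕ}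
    (he₀ : σ.arr 5 (σ.reg 15) = e₀) {S : Finset ℕ} (hS : S.card = n + 1) (h25 : σ.reg 25 = 1)
    (hw : H.Walk w col₀ e₀ x y a b S (σ.arr 2) (σ.reg 20) (σ.reg 21) (σ.reg 22) (σ.reg 23)
      (σ.reg 24)) :
    Walking H w col₀ e₀ x y a b (n + 1) (walkStep.exec σ) := by
  unfold walkStep
  by_cases hc : H.f (σ.reg 21) < σ.reg 23 ∧ H.f (σ.reg 22) < σ.reg 23
  · rw [Cmd.exec_ite_pos (by simpa [h.3] using hc)]
    exact .inr (.inl ⟨by simp, by simpa using hw.improved_of_illegal hc.1⟩)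
  rw [Cmd.exec_ite_neg (by simpa [h.3] using hc), Cmd.exec_seq, Cmd.exec_set, Cmd.exec_seq,
    Cmd.exec_put]
  have hc' : σ.reg 23 ≤ H.f (σ.reg 21) ∨ σ.reg 23 ≤ H.f (σ.reg 22) := by omega
  have hg := h.eval_edgeAt (v := .reg 22) (c := .reg 23) (by simp) (by simp)
  generalize (Term.edgeAt (.reg 22) (.reg 23)).eval σ = g at hg ⊢
  rcases hg with ⟨hgB, hg, hgc⟩ | ⟨hgB, hg⟩
  · rw [Cmd.exec_ite_neg (by simp [h.6, hgB.ne])]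
    simp only [Term.eval_reg] at hg hgc
    have hlink : σ.reg 22 ≠ H.other g (σ.reg 22) := hg.link.ne
    have hset := (((((h.setReg (x := 26) g (by norm_num)).setArr (a := 2) (σ.reg 20) (σ.reg 23)
      (by norm_num)).setArr (a := 2) g 0 (by norm_num))).setReg (x := 21) (σ.reg 22) (by norm_num))
    have hoth := hset.eval_other (.reg 26) (.reg 22)
    simp only [Term.eval_reg, State.setReg_reg, State.setArr_reg] at hoth
    norm_num at hoth
    by_cases hge : g = e₀
    · subst hge
      have hret := (hw.returned hc' hg hgc).1
      right; right
      simpa [Cmd.exec, Term.eval, Op.eval, he₀, hoth, EdgeData.kick] using hret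
    · left
      have := (hw.step hc' hg hgc hge)
      refine ⟨?_, insert g S, ?_, ?_⟩
      · simp [Cmd.exec, Term.eval, Op.eval, he₀, hge, h25]
      · rw [Finset.card_insert_of_notMem this.2, hS]
      · simpa [Cmd.exec, Term.eval, Op.eval, he₀, hge, hoth, EdgeData.kick] using this.1
  · rw [Cmd.exec_ite_pos (by simp [h.6, hgB])]
    right; left
    refine ⟨by simp, by simpa using hw.improved_of_miss hc' hg⟩

theorem exec_walk (h : Setup H B σ) (hv : H.Valid (σ.arr 2))
    (hi : H.Inc (σ.arr 5 (σ.reg 15)) (σ.reg 11)) (h0 : σ.arr 2 (σ.arr 5 (σ.reg 15)) = 0)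
    (ha : σ.reg 12 ∈ H.avail (σ.arr 2) (σ.reg 11))
    (hb : σ.reg 16 ∈ H.avail (σ.arr 2) (H.other (σ.arr 5 (σ.reg 15)) (σ.reg 11))) :
    ((walk.exec σ).reg 25 = 0 ∧
      H.Improved w (σ.arr 2) (σ.arr 5 (σ.reg 15)) ((walk.exec σ).arr 2)) ∨
    ((walk.exec σ).reg 25 = 2 ∧
      H.Returned w (σ.arr 2) (σ.arr 5 (σ.reg 15)) (σ.reg 11)
        (H.other (σ.arr 5 (σ.reg 15)) (σ.reg 11)) (σ.reg 12) (σ.reg 16)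
        ((walk.exec σ).arr 2)) := by
  set e₀ := σ.arr 5 (σ.reg 15)
  set y := H.other e₀ (σ.reg 11)
  simp only [EdgeData.mem_avail] at ha hb
  have hτ₀ : Setup H B (walkInit.exec σ) := h.exec rfl
  have hoth := (h.setReg (x := 20) e₀ (by norm_num)).setReg (x := 21) (σ.reg 11) (by norm_num)
    |>.eval_other (.reg 20) (.reg 11)
  have hinit : Walking H w (σ.arr 2) e₀ (σ.reg 11) y (σ.reg 12) (σ.reg 16) 0 (walkInit.exec σ) := by
    refine .inl ⟨by simp [walkInit], {e₀}, by simp, ?_⟩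
    have := EdgeData.Walk.init (w := w) hv hi.link h0 ha.1 hb.1 ha.2.2 hb.2.2 ha.2.1 hb.2.1
    simpa [walkInit, hoth, e₀, y] using this
  have h15 : (walkInit.exec σ).arr 5 ((walkInit.exec σ).reg 15) = e₀ := by simp [walkInit, e₀]
  unfold walk
  rw [Cmd.exec_seq]
  generalize walkInit.exec σ = τ₀ at hτ₀ hinit h15
  have key := Cmd.exec_loop (v := 8) (σ := τ₀)
    (p := .ite (.op .eq (.reg 25) (.lit 1)) walkStep .skip)
    (fun n τ => Setup H B τ ∧ τ.arr 5 (τ.reg 15) = e₀ ∧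
      Walking H w (σ.arr 2) e₀ (σ.reg 11) y (σ.reg 12) (σ.reg 16) n τ) ?_ ?_ ?_
  · obtain ⟨-, -, h' | h' | h'⟩ := key
    · obtain ⟨-, S, hS, hw⟩ := h'
      have := Finset.card_le_card hw.subset
      rw [hS, Finset.card_range, hτ₀.6] at this
      have := h.m_lt
      omega
    · exact .inl h'
    · exact .inr h'
  · exact ⟨hτ₀, h15, hinit⟩
  · rintro n - τ ⟨hτ, h15, hw⟩
    have hτ' := hτ.setReg (x := 8) n (by norm_num)
    refine ⟨hτ'.exec rfl, ?_, ?_⟩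
    · rw [Cmd.exec_arr (by rfl), Cmd.exec_reg (by rfl)]
      simpa using h15
    · rcases hw with ⟨h25, S, hS, hw⟩ | ⟨h25, hw⟩ | ⟨h25, hw⟩
      · rw [Cmd.exec_ite_pos (by simp [h25])]
        exact exec_walkStep hτ' (by simpa using h15) hS (by simp [h25]) (by simpa using hw)
      · rw [Cmd.exec_ite_neg (by simp [h25])]
        exact .inr (.inl ⟨by simp [h25], hw⟩)
      · rw [Cmd.exec_ite_neg (by simp [h25])]
        exact .inr (.inr ⟨by simp [h25], hw⟩)
  · rintro τ ⟨hτ, h15, hw⟩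
    refine ⟨hτ.setReg _ (by norm_num), by simpa using h15, ?_⟩
    simpa [Walking] using hw

end RAM

/-! ### Correctness of the augmentation -/

namespace RAM

local infixr:60 " ;; " => Cmd.seq
variable {H : EdgeData} {B : ℕ} {σ : State} {w : ℕ → ℕ}

theorem Setup.deg_lt (h : Setup H B σ) (v : ℕ) : H.deg v < B := (H.deg_le v).trans_lt h.m_lt

theorem Setup.find_avail (h : Setup H B σ) {v : Term}
    (hv : ∀ j j', v.eval ((σ.setReg 41 j).setReg 40 j') = v.eval σ)
    (hv' : ∀ j, v.eval (σ.setReg 41 j) = v.eval σ) (hne : ∃ c, c ∈ H.avail (σ.arr 2) (v.eval σ)) :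
    (Term.find 41 (.isAvail v (.reg 41))).eval σ ∈ H.avail (σ.arr 2) (v.eval σ) := by
  have hin := fun j => (h.setReg (x := 41) j (by norm_num)).holds_isAvail (v := v) (c := .reg 41)
    (by simp [hv, hv']) (by simp)
  rcases Term.eval_find 41 (.isAvail v (.reg 41)) σ with ⟨-, h'⟩ | ⟨-, h'⟩
  · simpa [hin, hv'] using h'
  · obtain ⟨c, hc⟩ := hne
    refine absurd ?_ (h' c (by rw [h.6]; exact h.lt_of_mem_avail hc))
    simpa [hin, hv'] using hc

/-- A fan has been built, and one of the three ways to use it (as told by register `14`) is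
possible. -/
structure FanReady (H : EdgeData) (B : ℕ) (C : ℕ → ℕ) (σ : State) : Prop where
  fan : H.Fan (σ.reg 11) (σ.arr 5) C (σ.reg 13) 0 (σ.arr 2)
  bound : ∀ r < σ.reg 13, C r ≤ H.f (H.other (σ.arr 5 r) (σ.reg 11))
  mode :
    (σ.reg 14 = 1 ∧ H.Miss (σ.arr 2) (σ.reg 11) (σ.reg 16) ∧
      σ.reg 16 ∈ H.avail (σ.arr 2) (H.other (σ.arr 5 (σ.reg 13)) (σ.reg 11))) ∨
    (σ.reg 14 = 2 ∧ σ.reg 15 ≤ σ.reg 13 ∧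
      σ.reg 16 ∈ H.avail (σ.arr 2) (H.other (σ.arr 5 (σ.reg 13)) (σ.reg 11)) ∧
      (σ.reg 15 = 0 ∧ σ.reg 16 ∈ H.avail (σ.arr 2) (H.other (σ.arr 5 0) (σ.reg 11)) ∨
        σ.reg 15 < σ.reg 13 ∧ C (σ.reg 15) = σ.reg 16) ∧
      (∀ r < σ.reg 13, C r = σ.reg 16 → r = σ.reg 15) ∧
      (σ.reg 15 < σ.reg 13 ∧ H.other (σ.arr 5 (σ.reg 13)) (σ.reg 11) ≠
        H.other (σ.arr 5 (σ.reg 15)) (σ.reg 11) ∨ ∃ A, H.Bip A)) ∨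
    (σ.reg 14 = 3 ∧ H.weight B (σ.arr 5 (σ.reg 13)) < H.weight B (σ.arr 5 0))

/-- The effect of one round of the algorithm. -/
def Progress (H : EdgeData) (B : ℕ) (col₀ col : ℕ → ℕ) : Prop :=
  H.Valid col ∧ H.potential B col < H.potential B col₀

theorem exec_augment (h : Setup H B σ) (hf : ∀ v, H.deg v ≤ H.f v) {C : ℕ → ℕ}
    (hr : FanReady H B C σ) : Progress H B (σ.arr 2) ((augment.exec σ).arr 2) := by
  obtain ⟨hfan, hbound, hmode⟩ := hr
  have hkB : σ.reg 13 < B := hfan.lt.trans h.m_lt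
  -- the first move of colors, up to position `n`
  have hshift : ∀ n ≤ σ.reg 13, H.Shifted (H.weight B) (σ.reg 11) (σ.arr 5) C (σ.reg 13) 0
      (σ.arr 2) n ((shift.exec ((σ.setReg 17 0).setReg 18 n)).arr 2) := by
    intro n hn
    have := exec_shift (w := H.weight B)
      ((h.setReg (x := 17) 0 (by norm_num)).setReg (x := 18) n (by norm_num))
      (x := σ.reg 11) (k := σ.reg 13) (C := C) (col₀ := σ.arr 2) rfl
      (by simpa using hfan) (by simp) (by simpa using hn) (by simp; omega)
    simpa using this
  unfold augment
  simp only [Cmd.exec_seq, Cmd.exec_set, Term.eval_lit, Term.eval_ite, Term.holds_eq,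
    Term.eval_reg, State.setReg_reg]
  have hset := fun n => (((h.setReg (x := 17) 0 (by norm_num)).setReg (x := 18) n
    (by norm_num)).exec (p := shift) rfl)
  have hregs : ∀ n x, x ≠ 7 → x ≠ 17 → x ≠ 18 →
      (shift.exec ((σ.setReg 17 0).setReg 18 n)).reg x = σ.reg x := by
    intro n x h₁ h₂ h₃
    rw [Cmd.exec_reg (by simpa [shift, Cmd.writes] using h₁.symm)]
    simp [h₂, h₃]
  have harr : ∀ n, (shift.exec ((σ.setReg 17 0).setReg 18 n)).arr 5 = σ.arr 5 := fun n => by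
    rw [Cmd.exec_arr (by rfl)]; simp
  norm_num
  rcases hmode with ⟨h14, hx, hb⟩ | ⟨h14, hik, hbk, hbi, huniq, hret⟩ | ⟨h14, hw⟩
  · -- the missing color is given to the last edge
    rw [h14]
    norm_num
    have hs := hshift _ le_rfl
    have hset := hset (σ.reg 13)
    have hregs := hregs (σ.reg 13)
    have harr := harr (σ.reg 13)
    generalize shift.exec ((σ.setReg 17 0).setReg 18 (σ.reg 13)) = τ at hs hset hregs harr ⊢
    rw [Cmd.exec_ite_neg (by simp [hregs, h14]), Cmd.exec_ite_pos (by simp [hregs, h14])]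
    rw [EdgeData.mem_avail] at hb
    have hCb : ∀ r < σ.reg 13, C r ≠ σ.reg 16 := fun r hrk hc =>
      hx _ (hfan.inc (r + 1) (Nat.zero_le _) hrk) ((hfan.color r (Nat.zero_le _) hrk).trans hc)
    obtain ⟨h₁, h₂, h₃⟩ := hs.finish hb.1
      (hs.miss_of_miss _ _ hb.1 (fun r _ hrk hc => absurd hc (hCb r hrk)) hx)
      (hs.miss_of_miss _ _ hb.1 (fun r _ hrk hc => absurd hc (hCb r hrk)) hb.2.2) hb.2.1
    have h₄ := hs.foreign_le_of_bound fun h0 => hbound 0 (by omega)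
    have h₅ := H.foreign_le_one (σ.reg 16) (σ.reg 11)
    have himp : H.Improved (H.weight B) (σ.arr 2) (σ.arr 5 0)
        (Function.update (τ.arr 2) (σ.arr 5 (σ.reg 13)) (σ.reg 16)) :=
      ⟨h₁, .inl ⟨h₂, by omega⟩⟩
    have : ((Cmd.put 2 (.get 5 (.reg 13)) (.reg 16)).exec τ).arr 2 =
        Function.update (τ.arr 2) (σ.arr 5 (σ.reg 13)) (σ.reg 16) := by
      simp [harr, hregs]
    rw [this]
    exact ⟨h₁, himp.potential_lt h.deg_lt⟩
  · -- an alternating walk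
    rw [h14]
    norm_num
    have hs := hshift _ hik
    have hset := hset (σ.reg 15)
    have hregs := hregs (σ.reg 15)
    have harr := harr (σ.reg 15)
    generalize shift.exec ((σ.setReg 17 0).setReg 18 (σ.reg 15)) = τ at hs hset hregs harr ⊢
    rw [Cmd.exec_ite_pos (by simp [hregs, h14]), Cmd.exec_seq, Cmd.exec_set]
    have hf1 := hs.fan
    have hinc := hf1.inc _ le_rfl hik
    obtain ⟨a₀, ha₀⟩ := EdgeData.exists_avail (hf _) hinc hf1.col_lo
    have ha := hset.find_avail (v := .reg 11) (by simp) (by simp) ⟨a₀, by simpa [hregs] using ha₀⟩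
    generalize (Term.find 41 (.isAvail (.reg 11) (.reg 41))).eval τ = a at ha
    rw [EdgeData.mem_avail] at hbk
    have hbi' : σ.reg 16 ∈ H.avail (τ.arr 2) (H.other (σ.arr 5 (σ.reg 15)) (σ.reg 11)) := by
      rcases hbi with ⟨h0, hbi⟩ | ⟨hik, hC⟩
      · rw [hs.eq_of_eq h0, h0]; exact hbi
      · rw [EdgeData.mem_avail, ← hC]
        exact ⟨hC ▸ hbk.1, hbound _ hik, hf1.miss _ le_rfl hik⟩
    have hτ' := hset.setReg (x := 12) a (by norm_num)
    have hwalk := exec_walk (w := H.weight B) hτ' (by simpa using hf1.valid)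
      (by simpa [harr, hregs] using hinc) (by simpa [harr, hregs] using hf1.col_lo)
      (by simpa [hregs] using ha) (by simpa [harr, hregs] using hbi')
    have hsetw := hτ'.exec (p := walk) rfl
    have hregw : ∀ x ∈ [11, 13, 15, 16], (walk.exec (τ.setReg 12 a)).reg x = σ.reg x := by
      intro x hx
      rw [Cmd.exec_reg (by fin_cases hx <;> rfl)]
      fin_cases hx <;> simp [hregs]
    have harrw : (walk.exec (τ.setReg 12 a)).arr 5 = σ.arr 5 := by
      rw [Cmd.exec_arr (by rfl)]; simp [harr]
    simp only [List.forall_mem_cons, List.not_mem_nil, false_imp_iff, implies_true, and_true]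
      at hregw
    simp [harr, hregs] at hwalk
    rw [Cmd.exec_seq]
    generalize walk.exec (τ.setReg 12 a) = ρ at hwalk hsetw hregw harrw ⊢
    obtain ⟨h11, h13, h15, h16⟩ := hregw
    have hfin : ∀ col, H.Improved (H.weight B) (τ.arr 2) (σ.arr 5 (σ.reg 15)) col →
        Progress H B (σ.arr 2) col := fun col hcol =>
      ⟨hcol.1, (hs.improved (fun h0 => hbound 0 (by omega)) hcol).potential_lt h.deg_lt⟩
    rcases hwalk with ⟨h25, himp⟩ | ⟨h25, hreturn⟩
    · rw [Cmd.exec_ite_neg (by simp [h25])]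
      exact hfin _ himp
    · rw [Cmd.exec_ite_pos (by simp [h25])]
      obtain ⟨hik, hne⟩ := hret.resolve_right fun ⟨A, hA⟩ => hreturn.not_bip A hA
      rw [EdgeData.mem_avail] at ha
      simp only [Term.eval_reg, hregs 11 (by norm_num) (by norm_num) (by norm_num)] at ha
      have hu : ∀ r, σ.reg 15 ≤ r → r < σ.reg 13 → C r = σ.reg 16 → r = σ.reg 15 :=
        fun r _ hrk hc => huniq r hrk hc
      have hfan2 := EdgeData.Returned.fan hf1 hik hu ha.2.2 ha.2.1 ha.1 hreturn
      have hs2 := exec_shift (w := H.weight B)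
        ((hsetw.setReg (x := 17) (σ.reg 15) (by norm_num)).setReg (x := 18) (σ.reg 13)
          (by norm_num))
        (x := σ.reg 11) (k := σ.reg 13) (col₀ := ρ.arr 2) rfl
        (by simpa [harrw] using hfan2) (by simpa using hik.le) (by simp) (by simpa using hkB.le)
      simp [harrw] at hs2
      have hyk := hs.miss_of_miss (H.other (σ.arr 5 (σ.reg 13)) (σ.reg 11)) (σ.reg 16) hbk.1
        (fun r _ hrk hc => by
          rw [huniq r hrk hc]
          exact ⟨(hfan.link (Nat.zero_le _) le_rfl).ne.symm, hne⟩) hbk.2.2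
      have himp := hreturn.improved hf1 hik hbk.1 hbk.2.1 hu (hbound _ hik) hyk hne hs2
      have hE := fun n m => Cmd.exec_arr (p := shift) (a := 5) rfl ((ρ.setReg 17 n).setReg 18 m)
      have h13' := fun n m => Cmd.exec_reg (p := shift) (x := 13) rfl ((ρ.setReg 17 n).setReg 18 m)
      have h16' := fun n m => Cmd.exec_reg (p := shift) (x := 16) rfl ((ρ.setReg 17 n).setReg 18 m)
      refine hfin _ ?_
      simpa [h15, h13, h16, hE, h13', h16', harrw] using himp
  · -- the uncolored edge moves towards smaller degrees
    rw [h14]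
    norm_num
    have hs := hshift _ le_rfl
    have hregs := hregs (σ.reg 13)
    generalize shift.exec ((σ.setReg 17 0).setReg 18 (σ.reg 13)) = τ at hs hregs ⊢
    rw [Cmd.exec_ite_neg (by simp [hregs, h14]), Cmd.exec_ite_neg (by simp [hregs, h14])]
    refine ⟨hs.fan.valid, ?_⟩
    have h₁ := hs.uncolored_eq
    have h₂ := hs.foreign_le_of_bound fun h0 => hbound 0 (by omega)
    have := Nat.mul_le_mul_left B h₂
    simp only [EdgeData.potential, Cmd.exec_skip]
    omega

end RAM

namespace RAM

local infixr:60 " ;; " => Cmd.seq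
variable {H : EdgeData} {B : ℕ} {σ : State} {w : ℕ → ℕ}

/-! ### Building the fans -/

open Term in
/-- For bipartite multigraphs the fan is just the uncolored edge in register `10`. -/
def bipartiteFan : Cmd :=
  .put 5 (lit 0) (reg 10) ;;
  .set 11 (get 0 (reg 10)) ;;
  .set 13 (lit 0) ;;
  .set 14 (lit 2) ;;
  .set 15 (lit 0) ;;
  .set 28 (other (reg 10) (reg 11)) ;;
  .set 16 (find 41 (isAvail (reg 28) (reg 41)))

open Term in
/-- One edge more for the fan, unless the fan is found to be complete. The color for the last edge
must not be one that has been used before at a parallel edge. -/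
def vizingStep : Cmd :=
  .set 28 (other (get 5 (reg 13)) (reg 11)) ;;
  .set 16 (find 41 (and (isAvail (reg 28) (reg 41)) (not (ex 42 (and (op .lt (reg 42) (reg 13))
    (and (op .eq (other (get 5 (reg 42)) (reg 11)) (reg 28))
      (op .eq (get 6 (reg 42)) (reg 41)))))))) ;;
  .set 29 (edgeAt (reg 11) (reg 16)) ;;
  .ite (op .eq (reg 29) (reg 2)) (.set 14 (lit 1))
    (.set 15 (find 42 (and (op .lt (reg 42) (reg 13)) (op .eq (get 6 (reg 42)) (reg 16)))) ;;
    .ite (op .lt (reg 15) (reg 2)) (.set 14 (lit 2))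
      (.put 6 (reg 13) (reg 16) ;;
      .set 13 (op .add (reg 13) (lit 1)) ;;
      .put 5 (reg 13) (reg 29)))

open Term in
/-- The fan for Vizing's bound. -/
def vizingFan : Cmd :=
  .put 5 (lit 0) (reg 10) ;;
  .set 11 (get 0 (reg 10)) ;;
  .set 13 (lit 0) ;;
  .set 14 (lit 0) ;;
  .loop 6 (.ite (op .eq (reg 14) (lit 0)) vizingStep .skip)

open Term in
/-- The fan for Shannon's bound, with at most two edges. Its center is an end of the uncolored edge
of the smaller degree. -/
def shannonFan : Cmd :=
  .put 5 (lit 0) (reg 10) ;;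
  .set 11 (ite (op .lt (get 4 (get 1 (reg 10))) (get 4 (get 0 (reg 10))))
    (get 1 (reg 10)) (get 0 (reg 10))) ;;
  .set 13 (lit 0) ;;
  .set 15 (lit 0) ;;
  .set 28 (other (reg 10) (reg 11)) ;;
  .set 16 (find 41 (and (isAvail (reg 28) (reg 41)) (miss (reg 11) (reg 41)))) ;;
  .ite (op .lt (reg 16) (reg 2)) (.set 14 (lit 1))
    (.set 16 (find 41 (isAvail (reg 28) (reg 41))) ;;
    .put 5 (lit 1) (edgeAt (reg 11) (reg 16)) ;;
    .set 13 (lit 1) ;;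
    .set 29 (other (get 5 (lit 1)) (reg 11)) ;;
    .ite (op .lt (get 4 (reg 29)) (get 4 (reg 11))) (.set 14 (lit 3))
      (.set 16 (find 41 (and (isAvail (reg 29) (reg 41))
        (or (miss (reg 11) (reg 41)) (isAvail (reg 28) (reg 41))))) ;;
      .ite (miss (reg 11) (reg 16)) (.set 14 (lit 1)) (.set 14 (lit 2))))

/-- From an uncolored edge in register `10`, the command builds a fan that can be used. -/
def BuildsFan (H : EdgeData) (B : ℕ) (p : Cmd) : Prop :=
  ∀ σ, Setup H B σ → H.Valid (σ.arr 2) → σ.reg 10 < H.m → σ.arr 2 (σ.reg 10) = 0 →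
    ∃ C, FanReady H B C (p.exec σ)

theorem _root_.EdgeData.link_self {i : ℕ} (hi : i < H.m) : H.Link i (H.s i) (H.t i) :=
  ⟨hi, .inl ⟨rfl, rfl⟩⟩

theorem buildsFan_bipartiteFan (hf : ∀ v, H.deg v ≤ H.f v) {A : Set ℕ} (hA : H.Bip A) :
    BuildsFan H B bipartiteFan := by
  intro σ h hv hm h0
  have hl := H.link_self hm
  refine ⟨fun _ => 0, ?_⟩
  have hoth : H.other (σ.reg 10) (H.s (σ.reg 10)) = H.t (σ.reg 10) := hl.other_eq
  unfold bipartiteFan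
  simp only [Cmd.exec_seq, Cmd.exec_set, Cmd.exec_put]
  set τ : State := (State.setReg _ 15 _) with hτ
  have hset : Setup H B τ :=
    ((((h.setArr _ _ (by norm_num)).setReg _ (by norm_num)).setReg _ (by norm_num)).setReg _
      (by norm_num)).setReg _ (by norm_num)
  have ho := hset.eval_other (.reg 10) (.reg 11)
  have hreg : τ.reg 10 = σ.reg 10 ∧ τ.reg 11 = H.s (σ.reg 10) ∧ τ.reg 13 = 0 ∧ τ.reg 14 = 2 ∧
    τ.reg 15 = 0 ∧ τ.arr 5 0 = σ.reg 10 ∧ τ.arr 2 = σ.arr 2 := by simp [hτ, h.1]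
  clear_value τ
  obtain ⟨h10, h11, h13, h14, h15, h5, h2⟩ := hreg
  simp only [Term.eval_reg, h10, h11, hoth] at ho
  rw [ho]
  obtain ⟨c₀, hc₀⟩ := EdgeData.exists_avail (hf _) hl.right h0
  have hb := (hset.setReg (x := 28) (H.t (σ.reg 10)) (by norm_num)).find_avail (v := .reg 28)
    (by simp) (by simp) ⟨c₀, by simpa [h2] using hc₀⟩
  generalize (Term.find 41 (.isAvail (.reg 28) (.reg 41))).eval _ = b at hb
  simp only [State.setReg_arr, Term.eval_reg, State.setReg_reg, h2, if_true] at hb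
  constructor
  case fan =>
    simp only [State.setReg_reg, State.setReg_arr, h2, h13, h11]
    exact .zero hv (by rw [h5]; exact h0) (by rw [h5]; exact hl.left)
  case bound => simp [h13]
  case mode =>
    right; left
    have hy : H.other (τ.arr 5 0) (τ.reg 11) = H.t (σ.reg 10) := by rw [h5, h11, hoth]
    simp only [State.setReg_reg, State.setReg_arr, h14, h15, h13, h2]
    norm_num
    rw [hy]
    exact ⟨hb, A, hA⟩

/-- While the fan for Vizing's bound is being built, array `6` holds its colors. -/
def Building (H : EdgeData) (B n : ℕ) (col : ℕ → ℕ) (σ : State) : Prop :=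
  σ.arr 2 = col ∧ ((σ.reg 14 = 0 ∧ σ.reg 13 = n ∧
    H.Fan (σ.reg 11) (σ.arr 5) (σ.arr 6) (σ.reg 13) 0 (σ.arr 2) ∧
    ∀ r < σ.reg 13, σ.arr 6 r ≤ H.f (H.other (σ.arr 5 r) (σ.reg 11))) ∨
  (σ.reg 14 ≠ 0 ∧ FanReady H B (σ.arr 6) σ))

theorem exec_vizingStep (h : Setup H B σ) (hf : ∀ v z, H.deg v + H.mult v z ≤ H.f v) {n : ℕ}
    (h14 : σ.reg 14 = 0) (h13 : σ.reg 13 = n)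
    (hfan : H.Fan (σ.reg 11) (σ.arr 5) (σ.arr 6) (σ.reg 13) 0 (σ.arr 2))
    (hbound : ∀ r < σ.reg 13, σ.arr 6 r ≤ H.f (H.other (σ.arr 5 r) (σ.reg 11))) :
    Building H B (n + 1) (σ.arr 2) (vizingStep.exec σ) := by
  have hkB : σ.reg 13 < B := hfan.lt.trans h.m_lt
  unfold vizingStep
  simp only [Cmd.exec_seq, Cmd.exec_set]
  rw [h.eval_other]
  simp only [Term.eval_get, Term.eval_reg]
  set y := H.other (σ.arr 5 (σ.reg 13)) (σ.reg 11) with hy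
  have hset := h.setReg (x := 28) y (by norm_num)
  -- the color for the last edge of the fan
  obtain ⟨b, hb, hbnew, hbe⟩ : ∃ b ∈ H.avail (σ.arr 2) y,
      (∀ r < σ.reg 13, H.other (σ.arr 5 r) (σ.reg 11) = y → σ.arr 6 r ≠ b) ∧
      (Term.find 41 (.and (.isAvail (.reg 28) (.reg 41)) (.not (.ex 42 (.and
        (.op .lt (.reg 42) (.reg 13)) (.and (.op .eq (.other (.get 5 (.reg 42)) (.reg 11)) (.reg 28))
        (.op .eq (.get 6 (.reg 42)) (.reg 41)))))))).eval (σ.setReg 28 y) = b := by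
    refine ⟨_, ?_, ?_, rfl⟩
    all_goals
      have hav := fun j => (hset.setReg (x := 41) j (by norm_num)).holds_isAvail (v := .reg 28)
        (c := .reg 41) (by simp) (by simp)
      have hot := fun j j' => ((hset.setReg (x := 41) j (by norm_num)).setReg (x := 42) j'
        (by norm_num)).eval_other (.get 5 (.reg 42)) (.reg 11)
      rcases Term.eval_find 41 (.and (.isAvail (.reg 28) (.reg 41)) (.not (.ex 42 (.and
        (.op .lt (.reg 42) (.reg 13)) (.and (.op .eq (.other (.get 5 (.reg 42)) (.reg 11)) (.reg 28))
        (.op .eq (.get 6 (.reg 42)) (.reg 41))))))) (σ.setReg 28 y) with ⟨-, h'⟩ | ⟨-, h'⟩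
    · simp [hav] at h'
      exact h'.1
    · exfalso
      obtain ⟨c, hc, hcn⟩ := hfan.exists_avail hf
      refine h' c (by simpa [h.6] using h.lt_of_mem_avail hc) ?_
      simp [hav, Term.holds_ex, hot]
      exact ⟨hc, fun r _ hr => hcn r hr⟩
    · simp [hav, Term.holds_ex, hot, h.6] at h'
      exact fun r hr => h'.2 r (by omega) hr
    · exfalso
      obtain ⟨c, hc, hcn⟩ := hfan.exists_avail hf
      refine h' c (by simpa [h.6] using h.lt_of_mem_avail hc) ?_
      simp [hav, Term.holds_ex, hot]
      exact ⟨hc, fun r _ hr => hcn r hr⟩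
  rw [hbe]
  clear hbe
  have hset' := hset.setReg (x := 16) b (by norm_num)
  have hg := hset'.eval_edgeAt (v := .reg 11) (c := .reg 16) (by simp) (by simp)
  generalize (Term.edgeAt (.reg 11) (.reg 16)).eval _ = g at hg
  simp at hg
  have hset'' := hset'.setReg (x := 29) g (by norm_num)
  have hbm := EdgeData.mem_avail.1 hb
  rcases hg with ⟨hgB, hg, hgc⟩ | ⟨rfl, hg⟩
  · rw [Cmd.exec_ite_neg (by simp [h.6, hgB.ne]), Cmd.exec_seq, Cmd.exec_set]
    have hi := Term.eval_find 42 (.and (.op .lt (.reg 42) (.reg 13))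
      (.op .eq (.get 6 (.reg 42)) (.reg 16))) (((σ.setReg 28 y).setReg 16 b).setReg 29 g)
    generalize (Term.find 42 _).eval _ = i at hi
    simp [h.6] at hi
    rcases hi with ⟨hiB, hik, hib⟩ | ⟨rfl, hi⟩
    · rw [Cmd.exec_ite_pos (by simpa [h.6] using hiB)]
      refine ⟨by simp, .inr ⟨by simp, by simpa using hfan, by simpa using hbound, ?_⟩⟩
      right; left
      simp only [Cmd.exec_set, State.setReg_reg, State.setReg_arr, Term.eval_lit]
      norm_num
      refine ⟨hik.le, hb, .inr ⟨hik, hib⟩, fun r hr hrb => ?_, .inl ⟨hik, fun hyy => ?_⟩⟩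
      · by_contra hne
        rcases Nat.lt_or_gt_of_ne hne with hlt | hlt
        · exact hfan.color_ne (Nat.zero_le r) hlt hik (hrb.trans hib.symm)
        · exact hfan.color_ne (Nat.zero_le i) hlt hr (hib.trans hrb.symm)
      · exact hbnew i hik (hyy.symm.trans hy.symm) hib
    · rw [Cmd.exec_ite_neg (by simp [h.6])]
      refine ⟨by simp, .inl ⟨by simp [h14], by simp [h13], ?_⟩⟩
      have := hfan.extend hbound hbm.1 hbm.2.2 hbm.2.1 hg hgc (fun r hr => hi r (by omega) hr)
        (E' := Function.update (σ.arr 5) (σ.reg 13 + 1) g)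
        (C' := Function.update (σ.arr 6) (σ.reg 13) b)
        (fun r hr => Function.update_of_ne (by omega) _ _) (Function.update_self _ _ _)
        (fun r hr => Function.update_of_ne (by omega) _ _) (Function.update_self _ _ _)
      simpa using this
  · rw [Cmd.exec_ite_pos (by simp [h.6])]
    refine ⟨by simp, .inr ⟨by simp, by simpa using hfan, by simpa using hbound, ?_⟩⟩
    left
    simp only [Cmd.exec_set, State.setReg_reg, State.setReg_arr, Term.eval_lit]
    norm_num
    exact ⟨hg, hb⟩

theorem buildsFan_vizingFan (hf : ∀ v z, H.deg v + H.mult v z ≤ H.f v) :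
    BuildsFan H B vizingFan := by
  intro σ h hv hm h0
  have hl := H.link_self hm
  unfold vizingFan
  simp only [Cmd.exec_seq, Cmd.exec_set, Cmd.exec_put]
  set τ : State := (State.setReg _ 14 _) with hτ
  have hset : Setup H B τ :=
    (((h.setArr _ _ (by norm_num)).setReg _ (by norm_num)).setReg _ (by norm_num)).setReg _
      (by norm_num)
  have hreg : τ.reg 11 = H.s (σ.reg 10) ∧ τ.reg 13 = 0 ∧ τ.reg 14 = 0 ∧
    τ.arr 5 0 = σ.reg 10 ∧ τ.arr 2 = σ.arr 2 := by simp [hτ, h.1]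
  clear_value τ
  obtain ⟨h11, h13, h14, h5, h2⟩ := hreg
  have key := Cmd.exec_loop (v := 6) (σ := τ)
    (p := .ite (.op .eq (.reg 14) (.lit 0)) vizingStep .skip)
    (fun n ρ => Setup H B ρ ∧ Building H B n (σ.arr 2) ρ) ?_ ?_ ?_
  · obtain ⟨-, -, h' | h'⟩ := key
    · obtain ⟨-, hk, hfan, -⟩ := h'
      have := hfan.lt
      rw [hk, hset.6] at this
      exact absurd (this.trans h.m_lt) (lt_irrefl _)
    · exact ⟨_, h'.2⟩
  · refine ⟨hset, h2, .inl ⟨h14, h13, ?_, by simp [h13]⟩⟩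
    rw [h13, h2, h11]
    exact .zero hv (by rw [h5]; exact h0) (by rw [h5]; exact hl.left)
  · rintro n - ρ ⟨hρ, hcol, hb⟩
    have hρ' := hρ.setReg (x := 6) n (by norm_num)
    refine ⟨hρ'.exec rfl, ?_⟩
    rcases hb with ⟨h14, h13, hfan, hbound⟩ | ⟨h14, hb⟩
    · rw [Cmd.exec_ite_pos (by simp [h14]), ← hcol]
      exact exec_vizingStep hρ' hf (by simp [h14]) (by simp [h13]) (by simpa using hfan)
        (by simpa using hbound)
    · rw [Cmd.exec_ite_neg (by simp [h14])]
      exact ⟨by simp [hcol], .inr ⟨by simp [h14], ⟨by simpa using hb.fan, by simpa using hb.bound,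
        by simpa using hb.mode⟩⟩⟩
  · rintro ρ ⟨hρ, hcol, hb⟩
    refine ⟨hρ.setReg _ (by norm_num), by simp [hcol], ?_⟩
    rcases hb with ⟨h14, h13, hfan, hbound⟩ | ⟨h14, hb⟩
    · exact .inl ⟨by simp [h14], by simp [h13], by simpa using hfan, by simpa using hbound⟩
    · exact .inr ⟨by simp [h14], ⟨by simpa using hb.fan, by simpa using hb.bound,
        by simpa using hb.mode⟩⟩

end RAM

namespace RAM

local infixr:60 " ;; " => Cmd.seq
variable {H : EdgeData} {B : ℕ} {σ : State} {w : ℕ → ℕ}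

theorem buildsFan_shannonFan (hf : ∀ v, H.f v = 3 * H.deg v / 2) :
    BuildsFan H B shannonFan := by
  intro σ h hv hm h0
  have hdf : ∀ v, H.deg v ≤ H.f v := fun v => by rw [hf]; omega
  unfold shannonFan
  simp only [Cmd.exec_seq, Cmd.exec_set, Cmd.exec_put]
  -- the ends of the uncolored edge
  obtain ⟨x, hx⟩ : ∃ x, (Term.ite (.op .lt (.get 4 (.get 1 (.reg 10))) (.get 4 (.get 0 (.reg 10))))
    (.get 1 (.reg 10)) (.get 0 (.reg 10))).eval (σ.setArr 5 ((Term.lit 0).eval σ)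
      ((Term.reg 10).eval σ)) = x := ⟨_, rfl⟩
  rw [hx]
  obtain ⟨y, hl, hxy⟩ : ∃ y, H.Link (σ.reg 10) x y ∧ H.deg x ≤ H.deg y := by
    rw [Term.eval_ite] at hx
    simp [h.1, h.2, h.4] at hx
    split_ifs at hx with hlt
    · exact ⟨H.s (σ.reg 10), hx ▸ (H.link_self hm).symm, hx ▸ hlt.le⟩
    · exact ⟨H.t (σ.reg 10), hx ▸ H.link_self hm, hx ▸ not_lt.1 hlt⟩
  set τ : State := (State.setReg _ 15 _) with hτ
  have hset : Setup H B τ :=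
    (((h.setArr _ _ (by norm_num)).setReg _ (by norm_num)).setReg _ (by norm_num)).setReg _
      (by norm_num)
  have ho := hset.eval_other (.reg 10) (.reg 11)
  have hreg : τ.reg 10 = σ.reg 10 ∧ τ.reg 11 = x ∧ τ.reg 13 = 0 ∧ τ.reg 15 = 0 ∧
    τ.arr 5 0 = σ.reg 10 ∧ τ.arr 2 = σ.arr 2 := by simp [hτ]
  clear_value τ
  obtain ⟨h10, h11, h13, h15, h5, h2⟩ := hreg
  simp only [Term.eval_reg, h10, h11, hl.other_eq] at ho
  rw [ho]
  have hset₁ := hset.setReg (x := 28) y (by norm_num)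
  have hb := Term.eval_find 41 (.and (.isAvail (.reg 28) (.reg 41)) (.miss (.reg 11) (.reg 41)))
    (τ.setReg 28 y)
  have hav := fun j => (hset₁.setReg (x := 41) j (by norm_num)).holds_isAvail (v := .reg 28)
    (c := .reg 41) (by simp) (by simp)
  have hmi := fun j => (hset₁.setReg (x := 41) j (by norm_num)).holds_miss (v := .reg 11)
    (c := .reg 41) (by simp) (by simp)
  generalize (Term.find 41 _).eval _ = b at hb
  simp [hav, hmi, h2, h11, hset.6] at hb
  rcases hb with ⟨hbB, hby, hbx⟩ | ⟨hbB, hno⟩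
  · rw [Cmd.exec_ite_pos (by simpa [hset.6] using hbB)]
    refine ⟨fun _ => 0, ?_, ?_, ?_⟩
    · simp only [Cmd.exec_set, State.setReg_reg, State.setReg_arr]
      norm_num
      rw [h11, h13, h2]
      exact .zero hv (by rw [h5]; exact h0) (by rw [h5]; exact hl.left)
    · simp [h13]
    · left
      simp only [Cmd.exec_set, State.setReg_reg, State.setReg_arr]
      norm_num
      rw [h11, h13, h2, h5, hl.other_eq]
      exact ⟨hbx, hby⟩
  rw [Cmd.exec_ite_neg (by simp [hset.6, hbB])]
  clear hbB
  simp only [Cmd.exec_seq, Cmd.exec_set, Cmd.exec_put]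
  obtain ⟨c₀, hc₀⟩ := EdgeData.exists_avail (hdf _) hl.right h0
  have hset₂ := hset₁.setReg (x := 16) b (by norm_num)
  have hc := hset₂.find_avail (v := .reg 28) (by simp) (by simp) ⟨c₀, by simpa [h2] using hc₀⟩
  generalize (Term.find 41 _).eval _ = c at hc
  simp only [State.setReg_arr, Term.eval_reg, State.setReg_reg, h2] at hc
  norm_num at hc
  have hcm := EdgeData.mem_avail.1 hc
  have hset₃ := hset₂.setReg (x := 16) c (by norm_num)
  have hg := hset₃.eval_edgeAt (v := .reg 11) (c := .reg 16) (by simp) (by simp)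
  generalize (Term.edgeAt (.reg 11) (.reg 16)).eval _ = g at hg
  simp [h2, h11] at hg
  obtain ⟨hgB, hg, hgc⟩ := hg.resolve_right fun hg =>
    hno c (h.lt_of_mem_avail hc) hc hg.2
  -- the second edge of the fan
  have hfan := (EdgeData.Fan.zero (E := τ.arr 5) (C := fun _ => c) hv (by rw [h5]; exact h0)
    (by rw [h5]; exact hl.left)).extend (k := 0) (x := x) (by simp) hcm.1
      (by rw [h5, hl.other_eq]; exact hcm.2.2) (by rw [h5, hl.other_eq]; exact hcm.2.1) hg hgc
      (by simp) (E' := Function.update (τ.arr 5) 1 g) (C' := fun _ => c)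
      (fun r hr => Function.update_of_ne (by omega) _ _) (Function.update_self _ _ _)
      (by simp) rfl
  have hyz : y ≠ H.other g x := by
    intro hyz
    refine hcm.2.2 g ?_ hgc
    have := hg.link.right
    rwa [← hyz] at this
  have hset₄ : Setup H B _ := (hset₃.setArr (a := 5) 1 g (by norm_num)).setReg (x := 13) 1
    (by norm_num)
  have ho' := hset₄.eval_other (.get 5 (.lit 1)) (.reg 11)
  simp only [Term.eval_lit]
  rw [ho']
  simp only [Term.eval_get, Term.eval_lit, Term.eval_reg, State.setReg_arr, State.setArr_arr,
    State.setReg_reg, State.setArr_reg]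
  norm_num
  rw [h11]
  have hlz := hg.link
  generalize H.other g x = z at hyz hlz
  set ρ : State := State.setReg _ 29 z with hρ
  have hsetρ : Setup H B ρ := hset₄.setReg _ (by norm_num)
  have hreg : ρ.reg 11 = x ∧ ρ.reg 13 = 1 ∧ ρ.reg 15 = 0 ∧ ρ.reg 28 = y ∧ ρ.reg 29 = z ∧
      ρ.arr 5 = Function.update (τ.arr 5) 1 g ∧ ρ.arr 2 = σ.arr 2 := by
    simp [hρ, h11, h15, h2]
  clear_value ρ
  obtain ⟨h11, h13, h15, h28, h29, h5', h2⟩ := hreg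
  have hE0 : ρ.arr 5 0 = σ.reg 10 := by simp [h5', h5]
  have hE1 : ρ.arr 5 1 = g := by simp [h5']
  rw [← h5'] at hfan
  refine ⟨fun _ => c, ?_⟩
  by_cases hdeg : H.deg z < H.deg x
  · rw [Cmd.exec_ite_pos (by simpa [hsetρ.4, h29, h11] using hdeg)]
    constructor
    case fan => simpa [h11, h13, h2] using hfan.1
    case bound => simpa [h11, h13, h2] using hfan.2
    case mode =>
      right; right
      simp only [Cmd.exec_set, State.setReg_reg, State.setReg_arr, Term.eval_lit]
      norm_num
      rw [h13, hE0, hE1, hl.weight_eq, hlz.weight_eq]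
      omega
  · rw [Cmd.exec_ite_neg (by simpa [hsetρ.4, h29, h11] using hdeg), Cmd.exec_seq, Cmd.exec_set]
    have hb := Term.eval_find 41 (.and (.isAvail (.reg 29) (.reg 41))
      (.or (.miss (.reg 11) (.reg 41)) (.isAvail (.reg 28) (.reg 41)))) ρ
    have hav := fun j => (hsetρ.setReg (x := 41) j (by norm_num)).holds_isAvail (v := .reg 28)
      (c := .reg 41) (by simp) (by simp)
    have hav' := fun j => (hsetρ.setReg (x := 41) j (by norm_num)).holds_isAvail (v := .reg 29)
      (c := .reg 41) (by simp) (by simp)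
    have hmi := fun j => (hsetρ.setReg (x := 41) j (by norm_num)).holds_miss (v := .reg 11)
      (c := .reg 41) (by simp) (by simp)
    generalize (Term.find 41 _).eval _ = b at hb
    simp [hav, hav', hmi, h2, h11, h28, h29, hsetρ.6] at hb
    rcases hb with ⟨-, hbz, hb⟩ | ⟨-, hb⟩
    · have hmb := (hsetρ.setReg (x := 16) b (by norm_num)).holds_miss (v := .reg 11)
        (c := .reg 16) (by simp) (by simp)
      simp [h11, h2] at hmb
      by_cases hbx : H.Miss (σ.arr 2) x b
      · rw [Cmd.exec_ite_pos (hmb.2 hbx)]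
        refine ⟨by simpa [h11, h13, h2] using hfan.1, by simpa [h11, h13, h2] using hfan.2, ?_⟩
        left
        simp only [Cmd.exec_set, State.setReg_reg, State.setReg_arr, Term.eval_lit]
        norm_num
        rw [h11, h13, h2, hE1, hlz.other_eq]
        exact ⟨hbx, hbz⟩
      · rw [Cmd.exec_ite_neg (fun h' => hbx (hmb.1 h'))]
        refine ⟨by simpa [h11, h13, h2] using hfan.1, by simpa [h11, h13, h2] using hfan.2, ?_⟩
        right; left
        simp only [Cmd.exec_set, State.setReg_reg, State.setReg_arr, Term.eval_lit]
        norm_num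
        rw [h11, h13, h15, h2, hE0, hE1, hlz.other_eq, hl.other_eq]
        exact ⟨by omega, hbz, .inl ⟨rfl, hb.resolve_left hbx⟩, fun r hr _ => by omega,
          .inl ⟨by omega, hyz.symm⟩⟩
    · exfalso
      obtain ⟨b', hb₁, hb₂⟩ := EdgeData.exists_common_avail hf hl.left hl.right h0 hxy
        (not_lt.1 hdeg) (fun c hc => hno c (h.lt_of_mem_avail hc) hc)
      have := hb b' (h.lt_of_mem_avail hb₁) hb₁
      tauto

/-! ### The program -/

/-- The number of `i < B` for which the term is nonzero. -/
def Term.count (v : ℕ) (t : Term) : Term := sum v (ite t (lit 1) (lit 0))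

open Classical in
theorem Term.eval_count (v : ℕ) (t : Term) (σ : State) :
    (count v t).eval σ = ((Finset.range (σ.reg 2)).filter fun i => t.Holds (σ.setReg v i)).card := by
  rw [Finset.card_filter]
  exact Finset.sum_congr rfl fun i _ => Term.eval_ite t

/-- Handles an uncolored edge, if there is one. -/
def round (fan : Cmd) : Cmd :=
  .set 10 (.find 40 (.and (.op .lt (.reg 40) (.reg 1)) (.op .eq (.get 2 (.reg 40)) (.lit 0)))) ;;
  .ite (.op .lt (.reg 10) (.reg 2)) (fan ;; augment) .skip

/-- The degree of the vertex in register `3`. -/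
def degree : Term := .count 40 (.inc (.reg 40) (.reg 3))

/-- The algorithm, where `f` computes the number `f v` for the vertex `v` in register `3`. The
colors are in array `2`, the numbers `f v` in array `3` and the degrees in array `4`. There are `B ^ 3`
rounds, more than the potential at the start. -/
def main (f : Term) (fan : Cmd) : Cmd :=
  .loop 3 (.put 4 (.reg 3) degree) ;;
  .loop 3 (.put 3 (.reg 3) f) ;;
  .loop 3 (.loop 4 (.loop 5 (round fan)))

/-- After `n` rounds, all edges are colored, or the potential has decreased `n` times. -/
def AfterRounds (H : EdgeData) (B N n : ℕ) (σ : State) : Prop :=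
  Setup H B σ ∧ H.Valid (σ.arr 2) ∧ ((∀ i < H.m, σ.arr 2 i ≠ 0) ∨ H.potential B (σ.arr 2) + n ≤ N)

theorem AfterRounds.setReg {N n x : ℕ} (h : AfterRounds H B N n σ) (hx : 2 < x) (k : ℕ) :
    AfterRounds H B N n (σ.setReg x k) := ⟨h.1.setReg k hx, h.2⟩

theorem AfterRounds.round {fan : Cmd} {N n : ℕ} (h : AfterRounds H B N n σ)
    (hf : ∀ v, H.deg v ≤ H.f v) (hfan : BuildsFan H B fan)
    (hst : (fan.stores 0 || fan.stores 1 || fan.stores 3 || fan.stores 4 || fan.writes 1 ||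
      fan.writes 2) = false) (hst2 : fan.stores 2 = false) :
    AfterRounds H B N (n + 1) ((round fan).exec σ) := by
  obtain ⟨hset, hv, h⟩ := h
  unfold RAM.round
  rw [Cmd.exec_seq, Cmd.exec_set]
  have he := Term.eval_find 40 (.and (.op .lt (.reg 40) (.reg 1))
    (.op .eq (.get 2 (.reg 40)) (.lit 0))) σ
  generalize (Term.find 40 _).eval _ = e at he
  have hset' := hset.setReg (x := 10) e (by norm_num)
  simp [hset.5, hset.6] at he
  rcases he with ⟨heB, hem, he0⟩ | ⟨heB, he⟩
  · rw [Cmd.exec_ite_pos (by simpa [hset.6] using heB), Cmd.exec_seq]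
    obtain ⟨C, hC⟩ := hfan _ hset' (by simpa using hv) (by simpa using hem) (by simpa using he0)
    have hset'' := hset'.exec hst
    have hprog := exec_augment hset'' hf hC
    have hcol : (fan.exec (σ.setReg 10 e)).arr 2 = σ.arr 2 := by rw [Cmd.exec_arr hst2]; simp
    rw [hcol] at hprog
    refine ⟨hset''.exec rfl, hprog.1, .inr ?_⟩
    have h' := h.resolve_left fun h' => h' e hem he0
    have := hprog.2
    omega
  · rw [Cmd.exec_ite_neg (by simp [hset.6, heB])]
    exact ⟨hset', by simpa using hv, .inl fun i hi => he i (hi.trans hset.m_lt) hi⟩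

theorem AfterRounds.loop {p : Cmd} {N l v : ℕ} (hv : 2 < v)
    (hp : ∀ n σ, AfterRounds H B N n σ → AfterRounds H B N (n + l) (p.exec σ)) (n : ℕ) (σ : State)
    (h : AfterRounds H B N n σ) : AfterRounds H B N (n + B * l) ((Cmd.loop v p).exec σ) := by
  have key := Cmd.exec_loop (v := v) (p := p) (σ := σ) (fun j => AfterRounds H B N (n + j * l))
    (by simpa using h) (fun j _ τ hτ => ?_) (fun τ hτ => hτ.setReg hv _)
  · rwa [h.1.6] at key
  · have := hp _ _ (hτ.setReg hv j)
    rwa [add_assoc, ← Nat.succ_mul] at this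

/-- At the start, the arrays `0` and `1` hold the ends of the edges and the other arrays are
empty. -/
structure Start (H : EdgeData) (B : ℕ) (σ : State) : Prop where
  arr_zero : σ.arr 0 = H.s
  arr_one : σ.arr 1 = H.t
  arr_of_two_le : ∀ a, 2 ≤ a → σ.arr a = fun _ => 0
  reg_one : σ.reg 1 = H.m
  reg_two : σ.reg 2 = B

/-- Filling an array. -/
theorem exec_loop_put {a v : ℕ} {t : Term} {g : ℕ → ℕ} (h0 : σ.arr a = fun _ => 0)
    (P : State → Prop) (hP : P σ) (hset : ∀ τ k, P τ → P (τ.setReg v k))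
    (hput : ∀ τ i k, P τ → P (τ.setArr a i k))
    (ht : ∀ τ, P τ → τ.reg v < σ.reg 2 → t.eval τ = g (τ.reg v)) (hg : ∀ i ≥ σ.reg 2, g i = 0) :
    P ((Cmd.loop v (.put a (.reg v) t)).exec σ) ∧
      ((Cmd.loop v (.put a (.reg v) t)).exec σ).arr a = g := by
  have key := Cmd.exec_loop (v := v) (p := .put a (.reg v) t) (σ := σ)
    (fun n τ => P τ ∧ τ.arr a = fun i => if i < n then g i else 0) ?_ ?_ ?_
  · refine ⟨key.1, key.2.trans (funext fun i => ?_)⟩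
    split_ifs with hi
    · rfl
    · exact (hg i (not_lt.1 hi)).symm
  · exact ⟨hP, by simpa using h0⟩
  · rintro n hn τ ⟨hτ, ha⟩
    refine ⟨hput _ _ _ (hset _ _ hτ), ?_⟩
    have := ht _ (hset τ n hτ) (by simpa using hn)
    simp only [State.setReg_reg, if_true] at this
    funext i
    simp only [Cmd.exec_put, this, State.setArr_arr, if_true, State.setReg_arr, ha, Term.eval_reg,
      State.setReg_reg, Function.update_apply]
    by_cases hi : i = n
    · simp [hi]
    · simp only [hi, if_false, show i < n + 1 ↔ i < n by omega]
  · rintro τ ⟨hτ, ha⟩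
    exact ⟨hset _ _ hτ, by simpa using ha⟩

theorem Start.exec_main {f : Term} {fan : Cmd} (h : Start H B σ) (hm : 2 * H.m < B)
    (hs : ∀ i < H.m, H.s i < B ∧ H.t i < B) (hfB : ∀ v, H.f v < B) (hf0 : ∀ v ≥ B, H.f v = 0)
    (hf : ∀ v, H.deg v ≤ H.f v)
    (hfe : ∀ τ, τ.arr 0 = H.s → τ.arr 1 = H.t → τ.arr 4 = H.deg → τ.reg 1 = H.m → τ.reg 2 = B →
      τ.reg 3 < B → f.eval τ = H.f (τ.reg 3))
    (hfan : BuildsFan H B fan)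
    (hst : (fan.stores 0 || fan.stores 1 || fan.stores 3 || fan.stores 4 || fan.writes 1 ||
      fan.writes 2) = false) (hst2 : fan.stores 2 = false) :
    H.Valid (((main f fan).exec σ).arr 2) ∧ ∀ i < H.m, ((main f fan).exec σ).arr 2 i ≠ 0 := by
  have hdeg : ∀ v ≥ B, H.deg v = 0 := by
    intro v hv
    by_contra h0
    obtain ⟨i, hi⟩ := Finset.card_pos.1 (Nat.pos_of_ne_zero h0)
    simp only [Finset.mem_filter] at hi
    replace hi := hi.2
    have := hs i hi.1
    rcases hi.2 with h' | h' <;> omega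
  have h₁ := exec_loop_put (a := 4) (v := 3) (t := degree) (g := H.deg)
    (h.arr_of_two_le 4 (by norm_num))
    (fun τ => τ.arr 0 = H.s ∧ τ.arr 1 = H.t ∧ τ.arr 2 = (fun _ => 0) ∧ τ.arr 3 = (fun _ => 0) ∧
      τ.reg 1 = H.m ∧ τ.reg 2 = B)
    ⟨h.1, h.2, h.3 2 le_rfl, h.3 3 (by norm_num), h.4, h.5⟩
    (fun τ k hτ => by simpa using hτ) (fun τ i k hτ => by simpa using hτ)
    (fun τ hτ _ => ?_) (by rwa [h.5])
  · unfold main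
    rw [Cmd.exec_seq, Cmd.exec_seq]
    generalize (Cmd.loop 3 (.put 4 (.reg 3) degree)).exec σ = τ at h₁ ⊢
    obtain ⟨⟨e₀, e₁, e₂, e₃, r₁, r₂⟩, e₄⟩ := h₁
    have h₂ := exec_loop_put (a := 3) (v := 3) (t := f) (g := H.f) e₃
      (fun τ => τ.arr 0 = H.s ∧ τ.arr 1 = H.t ∧ τ.arr 2 = (fun _ => 0) ∧ τ.arr 4 = H.deg ∧
        τ.reg 1 = H.m ∧ τ.reg 2 = B) ⟨e₀, e₁, e₂, e₄, r₁, r₂⟩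
      (fun τ k hτ => by simpa using hτ) (fun τ i k hτ => by simpa using hτ)
      (fun τ hτ h3 => hfe τ hτ.1 hτ.2.1 hτ.2.2.2.1 hτ.2.2.2.2.1 hτ.2.2.2.2.2 (by rwa [r₂] at h3))
      (by rwa [r₂])
    generalize (Cmd.loop 3 (.put 3 (.reg 3) f)).exec τ = ρ at h₂ ⊢
    obtain ⟨⟨e₀, e₁, e₂, e₄, r₁, r₂⟩, e₃⟩ := h₂
    have hinit : AfterRounds H B (H.potential B fun _ => 0) 0 ρ := by
      refine ⟨⟨e₀, e₁, e₃, e₄, r₁, r₂, hm, hfB⟩, ?_, .inr (by rw [e₂, add_zero])⟩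
      rw [e₂]
      exact ⟨fun v i j _ _ _ h0 => absurd rfl h0, fun i p q _ => .inl (Nat.zero_le _)⟩
    have hfin := AfterRounds.loop (v := 3) (by norm_num) (AfterRounds.loop (v := 4) (by norm_num)
      (AfterRounds.loop (v := 5) (l := 1) (by norm_num)
        fun n σ hσ => hσ.round hf hfan hst hst2)) 0 ρ hinit
    refine ⟨hfin.2.1, hfin.2.2.resolve_right fun hle => ?_⟩
    have hlt := H.potential_zero_lt (K := B) (fun v => (H.deg_le v).trans_lt (by omega)) hm
    rw [mul_one, zero_add, ← mul_assoc] at hle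
    omega
  · obtain ⟨e₀, e₁, e₂, e₃, r₁, r₂⟩ := hτ
    classical
    have hin : ∀ j, (Term.inc (.reg 40) (.reg 3)).Holds (τ.setReg 40 j) ↔ H.Inc j (τ.reg 3) := by
      intro j
      simp [Term.inc, EdgeData.Inc, e₀, e₁, r₁]
    simp only [degree, Term.eval_count, hin, r₂]
    rw [EdgeData.deg]
    congr 1
    ext i
    simp only [Finset.mem_filter, Finset.mem_range]
    exact ⟨fun h' => ⟨h'.2.1, h'.2⟩, fun h' => ⟨by omega, h'.2⟩⟩
end RAM

/-! ### The numbers of reserved colors -/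

namespace RAM

variable {H : EdgeData} {B : ℕ} {σ : State}

theorem Term.eval_count_eq {v N : ℕ} {t : Term} (hN : N ≤ σ.reg 2)
    (h : ∀ k < σ.reg 2, t.Holds (σ.setReg v k) ↔ k < N) : (count v t).eval σ = N := by
  classical
  rw [eval_count]
  have : (Finset.range (σ.reg 2)).filter (fun k => t.Holds (σ.setReg v k)) = Finset.range N := by
    ext k
    simp only [Finset.mem_filter, Finset.mem_range]
    exact ⟨fun hk => (h k hk.1).1 hk.2, fun hk => ⟨by omega, (h k (by omega)).2 hk⟩⟩
  rw [this, Finset.card_range]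

/-- The term computes `H.f v` for the vertex `v` in register `3`, once array `4` holds the
degrees. -/
def Computes (H : EdgeData) (B : ℕ) (f : Term) : Prop :=
  ∀ τ : State, τ.arr 0 = H.s → τ.arr 1 = H.t → τ.arr 4 = H.deg → τ.reg 1 = H.m → τ.reg 2 = B →
    τ.reg 3 < B → f.eval τ = H.f (τ.reg 3)

/-- The degree, read off from array `4`. -/
def bipartiteBound : Term := .get 4 (.reg 3)

/-- `⌊3d / 2⌋` is the number of `k` with `2k + 1 < 3d`. -/
def shannonBound : Term :=
  .count 40 (.op .lt (.op .add (.op .add (.reg 40) (.reg 40)) (.lit 1))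
    (.op .add (.get 4 (.reg 3)) (.op .add (.get 4 (.reg 3)) (.get 4 (.reg 3)))))

/-- The number of edges between the vertices in the registers `3` and `41`. -/
def multiplicity : Term :=
  .count 40 (.and (.inc (.reg 40) (.reg 3)) (.op .eq (.other (.reg 40) (.reg 3)) (.reg 41)))

/-- The largest multiplicity at a vertex is the number of `k` that are less than some
multiplicity. -/
def vizingBound : Term :=
  .op .add (.get 4 (.reg 3)) (.count 42 (.ex 41 (.op .lt (.reg 42) multiplicity)))

theorem computes_bipartiteBound (hf : ∀ v, H.f v = H.deg v) : Computes H B bipartiteBound :=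
  fun τ _ _ h4 _ _ _ => by simp [bipartiteBound, h4, hf]

theorem computes_shannonBound (hf : ∀ v, H.f v = 3 * H.deg v / 2) (hB : ∀ v, H.f v < B) :
    Computes H B shannonBound := fun τ _ _ h4 _ h2 _ => by
  refine Term.eval_count_eq (h2 ▸ (hB _).le) fun k _ => ?_
  simp [h4, hf]
  omega

theorem eval_multiplicity (hm : H.m ≤ B) (h0 : σ.arr 0 = H.s) (h1 : σ.arr 1 = H.t)
    (hr : σ.reg 1 = H.m) (h2 : σ.reg 2 = B) :
    multiplicity.eval σ = H.mult (σ.reg 3) (σ.reg 41) := by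
  classical
  have hin : ∀ j, (Term.inc (.reg 40) (.reg 3)).Holds (σ.setReg 40 j) ↔ H.Inc j (σ.reg 3) := by
    intro j
    simp [Term.inc, EdgeData.Inc, h0, h1, hr]
  rw [multiplicity, Term.eval_count, EdgeData.mult]
  congr 1
  ext i
  simp only [Finset.mem_filter, Finset.mem_range, Term.holds_and, hin, Term.holds_eq]
  have ho : (Term.other (.reg 40) (.reg 3)).eval (σ.setReg 40 i) = H.other i (σ.reg 3) := by
    simp [Term.other, EdgeData.other, h0, h1]
  rw [ho]
  simp only [Term.eval_reg, State.setReg_reg]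
  norm_num
  constructor
  · rintro ⟨-, h, he⟩
    exact ⟨h.1, he ▸ h.link⟩
  · rintro ⟨h, hl⟩
    exact ⟨by omega, hl.left, hl.other_eq⟩

theorem computes_vizingBound {M : ℕ → ℕ} (hf : ∀ v, H.f v = H.deg v + M v)
    (hM : ∀ v k, k < M v ↔ ∃ z < B, k < H.mult v z) (hB : ∀ v, H.f v < B) (hm : H.m ≤ B) :
    Computes H B vizingBound := fun τ h0 h1 h4 hr h2 _ => by
  have hMB : M (τ.reg 3) ≤ B := by have := hB (τ.reg 3); rw [hf] at this; omega
  rw [vizingBound, Term.eval_add, hf, Term.eval_count_eq (h2 ▸ hMB)]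
  · simp [h4]
  · intro k _
    rw [Term.holds_ex, hM]
    simp only [Term.holds_lt, State.setReg_reg]
    norm_num
    rw [h2]
    refine exists_congr fun z => and_congr_right fun _ => ?_
    rw [eval_multiplicity (H := H) (B := B) hm] <;> simp [h0, h1, hr, h2]

/-- The program sets the bound `B = n + 2m + 2` of the loops first. -/
def program (f : Term) (fan : Cmd) : Program :=
  .seq (.set 2 (.add (.lit 2) (.add (.reg 0) (.add (.reg 1) (.reg 1))))) (main f fan).compile

/-- The program is well formed and does not change its input. -/
def Admissible (f : Term) (fan : Cmd) : Bool :=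
  (main f fan).wf && !(fan.stores 0 || fan.stores 1 || fan.stores 3 || fan.stores 4 ||
    fan.writes 1 || fan.writes 2) && !fan.stores 2

end RAM

/-! ### Edge lists of graphs -/

namespace Graph

variable {α : Type u} {β : Type v} {G : Graph α β}

namespace EdgeList

variable (D : G.EdgeList)

/-- The function on the numbers of the vertices that is given by `g`, and `0` elsewhere. -/
def extend (g : α → ℕ) (v : ℕ) : ℕ := if h : v < D.n then g (D.vertex ⟨v, h⟩) else 0

theorem extend_val (g : α → ℕ) (v : Fin D.n) : D.extend g v = g (D.vertex v) := by
  simp [extend]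

theorem extend_of_le (g : α → ℕ) {v : ℕ} (h : D.n ≤ v) : D.extend g v = 0 :=
  dif_neg (not_lt.2 h)

theorem fst_eq (i : Fin D.m) : (RAM.State.init D).arr 0 i = D.fst i := by
  simp [RAM.State.init]

theorem snd_eq (i : Fin D.m) : (RAM.State.init D).arr 1 i = D.snd i := by
  simp [RAM.State.init]

/-- The edge list with the colors `1, …, g x` reserved for the edges at `x`. -/
def data [G.Loopless] (g : α → ℕ) : EdgeData where
  m := D.m
  s := (RAM.State.init D).arr 0
  t := (RAM.State.init D).arr 1
  f := D.extend g
  loopless i hi h := by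
    rw [D.fst_eq ⟨i, hi⟩, D.snd_eq ⟨i, hi⟩, Fin.val_inj] at h
    exact (D.isLink ⟨i, hi⟩).ne (by rw [h])

theorem vertex_inj {a b : Fin D.n} : (D.vertex a : α) = D.vertex b ↔ a = b := by
  rw [Subtype.val_inj, D.vertex.injective.eq_iff]

open Classical in
theorem ncard_eq {S : Set β} (hS : S ⊆ E(G)) {P : ℕ → Prop}
    (h : ∀ i : Fin D.m, (D.edge i : β) ∈ S ↔ P i) :
    S.ncard = ((Finset.range D.m).filter P).card := by
  rw [← Set.ncard_coe_finset]
  symm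
  have hlt : ∀ i ∈ (((Finset.range D.m).filter P : Finset ℕ) : Set ℕ), i < D.m := by simp_all
  refine Set.ncard_congr (fun i hi => (D.edge ⟨i, hlt i hi⟩ : β)) (fun i hi => ?_)
    (fun i j hi hj hij => ?_) (fun e he => ?_)
  · exact (h ⟨i, hlt i hi⟩).2 (Finset.mem_filter.1 (Finset.mem_coe.1 hi)).2
  · rw [Subtype.val_inj, D.edge.injective.eq_iff] at hij
    exact Fin.mk.inj hij
  · obtain ⟨i, hi⟩ := D.edge.surjective ⟨e, hS he⟩
    have hie : (D.edge i : β) = e := by rw [hi]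
    refine ⟨i, ?_, hie⟩
    exact Finset.mem_coe.2 (Finset.mem_filter.2 ⟨Finset.mem_range.2 i.2, (h i).1 (hie ▸ he)⟩)

theorem finite_edgeSet (D : G.EdgeList) : E(G).Finite := Finite.of_equiv _ D.edge

theorem finite_vertexSet (D : G.EdgeList) : V(G).Finite := Finite.of_equiv _ D.vertex

theorem ncard_edgeSet : E(G).ncard = D.m := by
  rw [← Nat.card_coe_set_eq, ← Nat.card_congr D.edge, Nat.card_fin]

theorem ncard_vertexSet : V(G).ncard = D.n := by
  rw [← Nat.card_coe_set_eq, ← Nat.card_congr D.vertex, Nat.card_fin]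

variable [G.Loopless] {g : α → ℕ}

theorem f_data (v : ℕ) : (D.data g).f v = D.extend g v := rfl

theorem link_iff (i : Fin D.m) (a b : Fin D.n) :
    (D.data g).Link i a b ↔ G.IsLink (D.edge i) (D.vertex a) (D.vertex b) := by
  have h : (D.data g).Link i a b ↔
      (D.fst i = a ∧ D.snd i = b ∨ D.fst i = b ∧ D.snd i = a) := by
    simp only [EdgeData.Link, data, D.fst_eq, D.snd_eq, Fin.val_inj, i.2, true_and]
  rw [h, (D.isLink i).isLink_iff]
  simp only [vertex_inj]

theorem lt_of_link {i a b : ℕ} (h : (D.data g).Link i a b) : a < D.n ∧ b < D.n := by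
  have h₁ := (D.fst ⟨i, h.1⟩).2
  have h₂ := (D.snd ⟨i, h.1⟩).2
  have h' := h.2
  simp only [data] at h'
  rw [D.fst_eq ⟨i, h.1⟩, D.snd_eq ⟨i, h.1⟩] at h'
  omega

theorem inc_iff (i : Fin D.m) (a : Fin D.n) :
    (D.data g).Inc i a ↔ G.Inc (D.edge i) (D.vertex a) := by
  constructor
  · intro h
    have hl := h.link
    obtain ⟨b, hb⟩ : ∃ b : Fin D.n, (D.data g).other i a = b := ⟨⟨_, (D.lt_of_link hl).2⟩, rfl⟩
    rw [hb, link_iff] at hl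
    exact hl.inc_left
  · rintro ⟨y, hy⟩
    obtain ⟨b, hb⟩ := D.vertex.surjective ⟨y, hy.right_mem⟩
    have hb' : y = D.vertex b := by rw [hb]
    rw [hb', ← D.link_iff (g := g)] at hy
    exact hy.left

theorem deg_data (v : ℕ) : (D.data g).deg v = D.extend G.degree v := by
  by_cases hv : v < D.n
  · rw [show v = ((⟨v, hv⟩ : Fin D.n) : ℕ) from rfl, extend_val, degree,
      D.ncard_eq (G.incidenceSet_subset_edgeSet _) (P := fun i => (D.data g).Inc i v)
        fun i => (D.inc_iff (g := g) i ⟨v, hv⟩).symm]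
    rfl
  · rw [D.extend_of_le _ (not_lt.1 hv), EdgeData.deg, Finset.card_eq_zero]
    refine Finset.eq_empty_of_forall_notMem fun i hi => ?_
    simp only [Finset.mem_filter] at hi
    exact hv (D.lt_of_link hi.2.link).1

theorem mult_data (a b : Fin D.n) :
    (D.data g).mult a b = G.multiplicity (D.vertex a) (D.vertex b) := by
  rw [multiplicity, D.ncard_eq (S := {e | G.IsLink e (D.vertex a) (D.vertex b)})
    (P := fun i => (D.data g).Link i a b)
    (fun e (he : G.IsLink e _ _) => he.edge_mem) fun i => (D.link_iff (g := g) i a b).symm]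
  rfl

theorem mult_data_eq_zero {a b : ℕ} (h : ¬ (a < D.n ∧ b < D.n)) : (D.data g).mult a b = 0 := by
  rw [EdgeData.mult, Finset.card_eq_zero]
  refine Finset.eq_empty_of_forall_notMem fun i hi => ?_
  simp only [Finset.mem_filter] at hi
  exact h (D.lt_of_link hi.2)

end EdgeList

theorem degree_le_ncard_edgeSet (hE : E(G).Finite) (x : α) : G.degree x ≤ E(G).ncard :=
  Set.ncard_le_ncard (G.incidenceSet_subset_edgeSet x) hE

theorem multiplicity_le_degree (hE : E(G).Finite) (x y : α) : G.multiplicity x y ≤ G.degree x :=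
  Set.ncard_le_ncard (fun _ he => ⟨y, he⟩) (hE.subset (G.incidenceSet_subset_edgeSet x))

theorem lt_maxMultiplicityAt (hE : E(G).Finite) {x : α} (hx : x ∈ V(G)) {k : ℕ} :
    k < G.maxMultiplicityAt x ↔ ∃ y ∈ V(G), k < G.multiplicity x y := by
  have hb : BddAbove (G.multiplicity x '' V(G)) :=
    ⟨G.degree x, by rintro _ ⟨y, -, rfl⟩; exact multiplicity_le_degree hE x y⟩
  rw [maxMultiplicityAt, lt_csSup_iff hb ⟨_, x, hx, rfl⟩]
  simp

theorem maxMultiplicityAt_le_degree (hE : E(G).Finite) {x : α} (hx : x ∈ V(G)) :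
    G.maxMultiplicityAt x ≤ G.degree x := by
  by_contra! h
  obtain ⟨y, -, hy⟩ := (lt_maxMultiplicityAt hE hx).1 h
  exact hy.not_ge (multiplicity_le_degree hE x y)

theorem ncard_edgeSet_le (hV : V(G).Finite) (hE : E(G).Finite) :
    E(G).ncard ≤ V(G).ncard * G.maxDegree := by
  classical
  have hb : BddAbove (G.degree '' V(G)) :=
    ⟨E(G).ncard, by rintro _ ⟨y, -, rfl⟩; exact degree_le_ncard_edgeSet hE y⟩
  have hfin : ∀ x, (G.incidenceSet x).Finite := fun x =>
    hE.subset (G.incidenceSet_subset_edgeSet x)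
  have hsub : hE.toFinset ⊆ hV.toFinset.biUnion fun x => (hfin x).toFinset := by
    intro e he
    obtain ⟨x, y, h⟩ := exists_isLink_of_mem_edgeSet (hE.mem_toFinset.1 he)
    simp only [Finset.mem_biUnion, Set.Finite.mem_toFinset]
    exact ⟨x, h.left_mem, y, h⟩
  rw [Set.ncard_eq_toFinset_card _ hE, Set.ncard_eq_toFinset_card _ hV]
  refine (Finset.card_le_card hsub).trans (Finset.card_biUnion_le_card_mul _ _ _ fun x hx => ?_)
  rw [← Set.ncard_eq_toFinset_card _ (hfin x)]
  exact le_csSup hb ⟨x, hV.mem_toFinset.1 hx, rfl⟩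

theorem exists_edgeList (hV : V(G).Finite) (hE : E(G).Finite) : Nonempty G.EdgeList := by
  have := hV.to_subtype
  have := hE.to_subtype
  have v := Finite.equivFin V(G)
  have e := Finite.equivFin E(G)
  choose s t h using fun i => exists_isLink_of_mem_edgeSet (e.symm i).2
  exact ⟨_, _, v.symm, e.symm, fun i => v ⟨s i, (h i).left_mem⟩, fun i => v ⟨t i, (h i).right_mem⟩,
    fun i => by
      rw [v.symm_apply_apply, v.symm_apply_apply]; exact h i⟩

end Graph

/-! ### The coloring of a graph by the program -/

namespace Graph.EdgeList

open RAM

variable {α : Type u} {β : Type v} {G : Graph α β}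

/-- The conditions under which the program colors the graph with the colors `1, …, g x` reserved
at `x`. -/
structure Colorable (D : G.EdgeList) [G.Loopless] (g : α → ℕ) (f : Term) (fan : Cmd) : Prop where
  degree_le : ∀ x ∈ V(G), G.degree x ≤ g x
  le : ∀ x ∈ V(G), g x ≤ 2 * D.m
  computes : Computes (D.data g) (D.n + 2 * D.m + 2) f
  buildsFan : BuildsFan (D.data g) (D.n + 2 * D.m + 2) fan

variable (D : G.EdgeList) [G.Loopless] {g : α → ℕ} {f : Term} {fan : Cmd}

theorem Colorable.outputs {D : G.EdgeList} (h : D.Colorable g f fan) (ha : Admissible f fan) :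
    ∃ φ : β → ℕ, (program f fan).Outputs D (8 + (main f fan).time (D.n + 2 * D.m + 2)) φ ∧
      G.IsProperEdgeColoring φ ∧
      ∀ e x y, G.IsLink e x y → φ e ∈ Set.Icc 1 (max (g x) (g y)) := by
  classical
  simp only [Admissible, Bool.and_eq_true, Bool.not_eq_true'] at ha
  obtain ⟨⟨hwf, hst⟩, hst2⟩ := ha
  set B := D.n + 2 * D.m + 2 with hB
  set σ := (State.init D).setReg 2 B with hσ
  have hstart : Start (D.data g) B σ := by
    refine ⟨rfl, rfl, fun a ha => funext fun i => ?_, by simp [hσ, State.init, data], by simp [hσ]⟩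
    simp [hσ, State.init, show a ≠ 0 by omega, show a ≠ 1 by omega]
  have hex : ∀ v, (∃ x ∈ V(G), D.extend g v = g x ∧ D.extend G.degree v = G.degree x) ∨
      D.extend g v = 0 ∧ D.extend G.degree v = 0 := fun v => by
    by_cases hv : v < D.n
    · exact .inl ⟨_, (D.vertex ⟨v, hv⟩).2, D.extend_val g ⟨v, hv⟩, D.extend_val _ ⟨v, hv⟩⟩
    · exact .inr ⟨D.extend_of_le _ (not_lt.1 hv), D.extend_of_le _ (not_lt.1 hv)⟩
  obtain ⟨hvalid, hcol⟩ := hstart.exec_main (f := f) (fan := fan)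
    (show 2 * D.m < B by omega)
    (fun i hi => by
      have := D.lt_of_link (g := g) (EdgeData.link_self hi)
      omega)
    (fun v => by
      rcases hex v with ⟨x, hx, hx', -⟩ | ⟨hx', -⟩
      · exact (hx'.le.trans (h.le x hx)).trans_lt (by omega)
      · exact hx'.trans_lt (by omega))
    (fun v hv => D.extend_of_le g (by omega))
    (fun v => by
      rw [deg_data]
      rcases hex v with ⟨x, hx, hx', hd⟩ | ⟨-, hd⟩
      · exact hd.le.trans ((h.degree_le x hx).trans hx'.ge)
      · exact hd.le.trans (Nat.zero_le _))
    h.computes h.buildsFan hst hst2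
  set col := ((main f fan).exec σ).arr 2 with hcoldef
  have hout : Halts (program f fan) (State.init D) (8 + (main f fan).time B) fun ρ =>
      ρ.arr 2 = col := by
    refine .seq (.set ?_)
    have he : (State.init D).setReg 2 (Expr.eval (State.init D)
        (.add (.lit 2) (.add (.reg 0) (.add (.reg 1) (.reg 1))))) = σ := by
      rw [hσ]
      congr 1
      simp [Expr.eval, State.init, hB]
      ring
    rw [he]
    refine (Cmd.halts_compile hwf (fun _ _ => rfl) rfl).mono (by rw [hstart.5]) fun ρ hρ => ?_
    rw [hρ.1]
  obtain ⟨t, ρ, hrun, ht, hρ⟩ := hout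
  have hφ : ∀ i : Fin D.m, (fun e => if he : e ∈ E(G) then col (D.edge.symm ⟨e, he⟩) else 0)
      (D.edge i : β) = col i := fun i => by simp
  refine ⟨fun e => if he : e ∈ E(G) then col (D.edge.symm ⟨e, he⟩) else 0,
    ⟨t, ρ, hrun, ht, fun i => by rw [hρ, hφ]⟩, ?_, ?_⟩
  · intro e e' x hne hx hx'
    obtain ⟨i, hi⟩ := D.edge.surjective ⟨e, hx.edge_mem⟩
    obtain ⟨j, hj⟩ := D.edge.surjective ⟨e', hx'.edge_mem⟩
    obtain ⟨a, ha⟩ := D.vertex.surjective ⟨x, hx.vertex_mem⟩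
    obtain rfl : (D.edge i : β) = e := by rw [hi]
    obtain rfl : (D.edge j : β) = e' := by rw [hj]
    obtain rfl : (D.vertex a : α) = x := by rw [ha]
    rw [hφ, hφ]
    rw [← D.inc_iff (g := g)] at hx hx'
    intro hc
    exact hne (by rw [Fin.ext (hvalid.proper a i j hx hx' hc (hcol i i.2))])
  · intro e x y hl
    obtain ⟨i, hi⟩ := D.edge.surjective ⟨e, hl.edge_mem⟩
    obtain ⟨a, ha⟩ := D.vertex.surjective ⟨x, hl.left_mem⟩
    obtain ⟨b, hb⟩ := D.vertex.surjective ⟨y, hl.right_mem⟩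
    obtain rfl : (D.edge i : β) = e := by rw [hi]
    obtain rfl : (D.vertex a : α) = x := by rw [ha]
    obtain rfl : (D.vertex b : α) = y := by rw [hb]
    rw [hφ]
    rw [← D.link_iff (g := g)] at hl
    have := hvalid.legal i a b hl
    rw [show (D.data g).f a = g (D.vertex a) from D.extend_val g a,
      show (D.data g).f b = g (D.vertex b) from D.extend_val g b] at this
    exact ⟨Nat.one_le_iff_ne_zero.2 (hcol i i.2), le_max_iff.2 this⟩

theorem colorable_bipartite (hb : G.IsBipartite) :
    D.Colorable G.degree bipartiteBound bipartiteFan := by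
  obtain ⟨A, hA⟩ := hb
  have hf : ∀ v, (D.data G.degree).f v = (D.data G.degree).deg v := fun v => (D.deg_data v).symm
  refine ⟨fun _ _ => le_rfl, fun x _ => ?_, computes_bipartiteBound hf,
    buildsFan_bipartiteFan (A := {v | ∃ h : v < D.n, (D.vertex ⟨v, h⟩ : α) ∈ A})
      (fun v => (hf v).ge) fun i hi => ?_⟩
  · have := degree_le_ncard_edgeSet D.finite_edgeSet x
    rw [D.ncard_edgeSet] at this
    omega
  · have := hA _ _ _ (D.isLink ⟨i, hi⟩)
    change (State.init D).arr 0 i ∈ _ ↔ (State.init D).arr 1 i ∉ _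
    rw [D.fst_eq ⟨i, hi⟩, D.snd_eq ⟨i, hi⟩]
    simpa using this

theorem colorable_shannon :
    D.Colorable (fun x => 3 * G.degree x / 2) shannonBound shannonFan := by
  have hle := fun x => degree_le_ncard_edgeSet D.finite_edgeSet x
  rw [D.ncard_edgeSet] at hle
  have hf : ∀ v, (D.data fun x => 3 * G.degree x / 2).f v =
      3 * (D.data fun x => 3 * G.degree x / 2).deg v / 2 := fun v => by
    rw [deg_data]
    by_cases hv : v < D.n <;> simp [data, extend, hv]
  have h2 : ∀ x, 3 * G.degree x / 2 ≤ 2 * D.m := fun x => by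
    have := hle x
    omega
  refine ⟨fun x _ => by omega, fun x _ => h2 x, computes_shannonBound hf fun v => ?_,
    buildsFan_shannonFan hf⟩
  rw [f_data, extend]
  split_ifs with hv
  · exact (h2 _).trans_lt (by omega)
  · omega

theorem colorable_vizing :
    D.Colorable (fun x => G.degree x + G.maxMultiplicityAt x) vizingBound vizingFan := by
  have hE := D.finite_edgeSet
  have hle := fun x => degree_le_ncard_edgeSet hE x
  rw [D.ncard_edgeSet] at hle
  have h2 : ∀ x ∈ V(G), G.degree x + G.maxMultiplicityAt x ≤ 2 * D.m := fun x hx => by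
    have := hle x
    have := maxMultiplicityAt_le_degree hE hx
    omega
  set H := D.data fun x => G.degree x + G.maxMultiplicityAt x with hH
  have hf : ∀ v, H.f v = H.deg v + D.extend G.maxMultiplicityAt v := fun v => by
    rw [hH, deg_data]
    by_cases hv : v < D.n <;> simp [data, extend, hv]
  have hM : ∀ v k, k < D.extend G.maxMultiplicityAt v ↔
      ∃ z < D.n + 2 * D.m + 2, k < H.mult v z := fun v k => by
    by_cases hv : v < D.n
    · rw [show v = ((⟨v, hv⟩ : Fin D.n) : ℕ) from rfl, extend_val,
        lt_maxMultiplicityAt hE (D.vertex _).2]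
      constructor
      · rintro ⟨y, hy, h⟩
        obtain ⟨b, hb⟩ := D.vertex.surjective ⟨y, hy⟩
        refine ⟨b, by omega, ?_⟩
        rwa [hH, mult_data, hb]
      · rintro ⟨z, -, h⟩
        by_cases hz : z < D.n
        · exact ⟨_, (D.vertex ⟨z, hz⟩).2, by rwa [← D.mult_data]⟩
        · rw [hH, mult_data_eq_zero _ fun h' => hz h'.2] at h
          omega
    · rw [D.extend_of_le _ (not_lt.1 hv)]
      simp [hH, mult_data_eq_zero _ fun h' => hv h'.1]
  refine ⟨fun x _ => by omega, h2, computes_vizingBound hf hM (fun v => ?_)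
    (show D.m ≤ _ by omega), buildsFan_vizingFan fun v z => ?_⟩
  · rw [f_data, extend]
    split_ifs with hv
    · exact (h2 _ (D.vertex _).2).trans_lt (by omega)
    · omega
  · change H.deg v + H.mult v z ≤ H.f v
    rw [hf]
    by_contra! h
    have hlt : D.extend G.maxMultiplicityAt v < H.mult v z := by omega
    by_cases hz : z < D.n
    · exact lt_irrefl _ ((hM v _).2 ⟨z, by omega, hlt⟩)
    · rw [hH, mult_data_eq_zero _ fun h' => hz h'.2] at hlt
      omega

end Graph.EdgeList

/-! ### The running time -/

theorem RAM.exists_time_bound (p : Cmd) : ∃ C k, ∀ n m Δ, m ≤ n * Δ →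
    8 + p.time (n + 2 * m + 2) ≤ C * (n + Δ + 1) ^ k := by
  obtain ⟨C, k, h⟩ := p.polyBounded_time
  refine ⟨8 + C * 3 ^ k, 2 * k, fun n m Δ hm => ?_⟩
  have h₁ : n + 2 * m + 2 + 1 ≤ 3 * (n + Δ + 1) ^ 2 := by nlinarith
  have h₂ : 1 ≤ (n + Δ + 1) ^ (2 * k) := Nat.one_le_pow _ _ (by omega)
  calc 8 + p.time (n + 2 * m + 2) ≤ 8 + C * (n + 2 * m + 2 + 1) ^ k := by gcongr; exact h _
    _ ≤ 8 * (n + Δ + 1) ^ (2 * k) + C * (3 * (n + Δ + 1) ^ 2) ^ k := by gcongr; omega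
    _ = _ := by rw [mul_pow, ← pow_mul]; ring

open RAM in
theorem Graph.exists_program (f : Term) (fan : Cmd) (ha : Admissible f fan) :
    ∃ (p : Program) (C k : ℕ), ∀ (α : Type u) (β : Type v) (G : Graph α β) [G.Loopless]
      (D : G.EdgeList) (g : α → ℕ), D.Colorable g f fan → ∃ φ : β → ℕ,
        p.Outputs D (C * (V(G).ncard + G.maxDegree + 1) ^ k) φ ∧
        G.IsProperEdgeColoring φ ∧
        ∀ e x y, G.IsLink e x y → φ e ∈ Set.Icc 1 (max (g x) (g y)) := by
  obtain ⟨C, k, hC⟩ := exists_time_bound (main f fan)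
  refine ⟨program f fan, C, k, fun α β G _ D g h => ?_⟩
  obtain ⟨φ, ⟨t, σ, hr, ht, ho⟩, hφ⟩ := h.outputs ha
  refine ⟨φ, ⟨t, σ, hr, ht.trans ?_, ho⟩, hφ⟩
  rw [D.ncard_vertexSet]
  refine hC _ _ _ ?_
  rw [← D.ncard_edgeSet, ← D.ncard_vertexSet]
  exact ncard_edgeSet_le D.finite_vertexSet D.finite_edgeSet

theorem corollary1p5 :
    -- existence of the three colorings
    (∀ (α : Type u) (β : Type v) (G : Graph α β), V(G).Finite → E(G).Finite → G.Loopless →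
      (∃ φ : β → ℕ, G.IsProperEdgeColoring φ ∧ ∀ e x y, G.IsLink e x y →
        φ e ∈ Set.Icc 1 (max (3 * G.degree x / 2) (3 * G.degree y / 2))) ∧
      (∃ φ : β → ℕ, G.IsProperEdgeColoring φ ∧ ∀ e x y, G.IsLink e x y →
        φ e ∈ Set.Icc 1 (max (G.degree x + G.maxMultiplicityAt x)
          (G.degree y + G.maxMultiplicityAt y))) ∧
      (G.IsBipartite → ∃ φ : β → ℕ, G.IsProperEdgeColoring φ ∧ ∀ e x y, G.IsLink e x y →
        φ e ∈ Set.Icc 1 (max (G.degree x) (G.degree y)))) ∧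
    -- an algorithm for each of them, with running time polynomial in `n` and `Δ`
    (∃ (p : RAM.Program) (C k : ℕ), ∀ (α : Type u) (β : Type v) (G : Graph α β), G.Loopless →
      ∀ D : G.EdgeList, ∃ φ : β → ℕ,
        p.Outputs D (C * (V(G).ncard + G.maxDegree + 1) ^ k) φ ∧
        G.IsProperEdgeColoring φ ∧ ∀ e x y, G.IsLink e x y →
          φ e ∈ Set.Icc 1 (max (3 * G.degree x / 2) (3 * G.degree y / 2))) ∧
    (∃ (p : RAM.Program) (C k : ℕ), ∀ (α : Type u) (β : Type v) (G : Graph α β), G.Loopless →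
      ∀ D : G.EdgeList, ∃ φ : β → ℕ,
        p.Outputs D (C * (V(G).ncard + G.maxDegree + 1) ^ k) φ ∧
        G.IsProperEdgeColoring φ ∧ ∀ e x y, G.IsLink e x y →
          φ e ∈ Set.Icc 1 (max (G.degree x + G.maxMultiplicityAt x)
            (G.degree y + G.maxMultiplicityAt y))) ∧
    (∃ (p : RAM.Program) (C k : ℕ), ∀ (α : Type u) (β : Type v) (G : Graph α β), G.Loopless →
      G.IsBipartite → ∀ D : G.EdgeList, ∃ φ : β → ℕ,
        p.Outputs D (C * (V(G).ncard + G.maxDegree + 1) ^ k) φ ∧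
        G.IsProperEdgeColoring φ ∧ ∀ e x y, G.IsLink e x y →
          φ e ∈ Set.Icc 1 (max (G.degree x) (G.degree y))) := by
  obtain ⟨p₁, C₁, k₁, h₁⟩ := Graph.exists_program.{u, v} RAM.shannonBound RAM.shannonFan rfl
  obtain ⟨p₂, C₂, k₂, h₂⟩ := Graph.exists_program.{u, v} RAM.vizingBound RAM.vizingFan rfl
  obtain ⟨p₃, C₃, k₃, h₃⟩ := Graph.exists_program.{u, v} RAM.bipartiteBound RAM.bipartiteFan rfl
  refine ⟨fun α β G hV hE _ => ?_, ⟨p₁, C₁, k₁, fun α β G _ D => ?_⟩,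
    ⟨p₂, C₂, k₂, fun α β G _ D => ?_⟩, ⟨p₃, C₃, k₃, fun α β G _ hb D => ?_⟩⟩
  · obtain ⟨D⟩ := Graph.exists_edgeList hV hE
    obtain ⟨φ₁, -, hφ₁⟩ := h₁ α β G D _ D.colorable_shannon
    obtain ⟨φ₂, -, hφ₂⟩ := h₂ α β G D _ D.colorable_vizing
    refine ⟨⟨φ₁, hφ₁⟩, ⟨φ₂, hφ₂⟩, fun hb => ?_⟩
    obtain ⟨φ₃, -, hφ₃⟩ := h₃ α β G D _ (D.colorable_bipartite hb)
    exact ⟨φ₃, hφ₃⟩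
  · exact h₁ α β G D _ D.colorable_shannon
  · exact h₂ α β G D _ D.colorable_vizing
  · exact h₃ α β G D _ (D.colorable_bipartite hb)
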